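/- Consider three bodies with positions $q_1,q_2,q_3\in\mathbb R^3$ (pairwise distinct), masses $m_1=m_2=\mu>0$, $m_3=1$, and potential $$V(q)=-\frac{\alpha_3}{\|q_1-q_2\|}-\frac{\alpha_1}{\|q_2-q_3\|}-\frac{\alpha_2}{\|q_3-q_1\|},\qquad \alpha_3=1,\ (\alpha_1,\alpha_2)\in\mathbb R^2 .$$ A central configuration is a $q$ for which some $\lambda\in\mathbb R$ satisfies $\partial V/\partial q_i=\lambda m_i(q_i-Q)$ for all $i$, where $Q$ is the center of mass. For $j\in\{1,2,3\}$ let $N_j(\alpha_1,\alpha_2)$ be the number of collinear central configurations with body $j$ between the other two, counted up to translations, rotations and dilations. Put $f=\alpha_1f_1+\alpha_2f_2+f_3$ with $$f_1=m_1u^2(1+u)^2(m_2+m_2u+m_3u),\quad f_2=-m_2(1+u)^2(m_1+m_3+m_1u),\quad f_3=-m_3u^2(m_2-m_1u),$$ and let $n_i(\alpha_1,\alpha_2)$ be the number of distinct real zeros of $f$ in $I_i$, where $I_1=(-\infty,-1)$, $I_2=(-1,0)$, $I_3=(0,\infty)$. Let $\Gamma\subset\mathbb R^2$ be the curve consisting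 of all finite values on $\mathbb R\cup\{\infty\}$ of the continuous extension of $$c(u)=\Big(\frac{f_3f_2'-f_2f_3'}{f_2f_1'-f_1f_2'},\ \frac{f_1f_3'-f_3f_1'}{f_2f_1'-f_1f_2'}\Big)(u).$$ **Theorem.** For every $\mu>0$ the complement in the $(\alpha_1,\alpha_2)$-plane of the two coordinate axes and $\Gamma$ has exactly 13 connected components (regions). They can be numbered $1,\dots,13$ so that on each region the signs of $(\alpha_1,\alpha_2)$ and the triple $(n_1,n_2,n_3)$ are constant, with the following values: | region | signs | $(n_1,n_2,n_3)$ | region | signs | $(n_1,n_2,n_3)$ | |---|---|---|---|---|---| | 1 | $(+,+)$ | $(0,0,1)$ | 8 | $(-,+)$ | $(1,2,0)$ | | 2 | $(+,+)$ | $(0,2,1)$ | 9 | $(-,+)$ | $(1,0,0)$ | | 3 | $(+,-)$ | $(0,1,0)$ | 10 | $(+,+)$ | $(2,0,1)$ | | 4 | $(+,-)$ | $(2,1,0)$ | 11 | $(-,+)$ | $(1,0,2)$ | | 5 | $(-,-)$ | $(3,1,1)$ | 12 | $(+,-)$ | $(0,1,2)$ | | 6 | $(-,-)$ | $(1,1,1)$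 | 13 | $(-,-)$ | $(1,1,3)$ | | 7 | $(-,-)$ | $(1,3,1)$ | | | | For every $(\alpha_1,\alpha_2)$ in one of the regions the zeros count collinear central configurations: $n_3(\alpha_1,\alpha_2)=N_3(\alpha_1,\alpha_2)$, $n_1(\alpha_1,\alpha_2)=N_2(-\alpha_1,\alpha_2)$ and $n_2(\alpha_1,\alpha_2)=N_1(\alpha_1,-\alpha_2)$. In particular the number $N_3$ of collinear central configurations with body 3 in the middle is constant on each region. Moreover, whichever body $j$ is in the middle, the set of values taken by $N_j$ on the whole $(\alpha_1,\alpha_2)$-plane is exactly $\{0,1,2,3\}$. -/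

import Mathlib

open Polynomial Filter Topology

noncomputable section

/-! Bodies 1, 2, 3 are indexed by `0, 1, 2 : Fin 3`. -/

/-- Positions of three bodies in space. -/
abbrev Config : Type := Fin 3 → EuclideanSpace ℝ (Fin 3)

/-- The potential
`V(q) = - α₃ / ‖q₁ - q₂‖ - α₁ / ‖q₂ - q₃‖ - α₂ / ‖q₃ - q₁‖`. -/
def potential (α : Fin 3 → ℝ) (q : Config) : ℝ :=
  - α 2 / ‖q 0 - q 1‖ - α 0 / ‖q 1 - q 2‖ - α 1 / ‖q 2 - q 0‖

/-- `q` is a central configuration of the charged three-body system with masses `m` and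
coefficients `α`: there are no collisions, and for some multiplier `l` one has
`∂V/∂qᵢ = l mᵢ (qᵢ - Q)` for all `i`, where `Q` is the center of mass. -/
def IsCentral (m α : Fin 3 → ℝ) (q : Config) : Prop :=
  Function.Injective q ∧
    ∃ l : ℝ, ∀ i : Fin 3,
      gradient (fun x => potential α (Function.update q i x)) (q i) =
        (l * m i) • (q i - Finset.univ.centerMass m q)

/-- Equivalence under translations, rotations and dilations by `t ∈ ℝ*`. Since `t` may be negative
and the dimension is odd, allowing all linear isometries instead of rotations changes nothing. -/
def SimilarConfig (q q' : Config) : Prop :=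
  ∃ (t : ℝ) (A : EuclideanSpace ℝ (Fin 3) ≃ₗᵢ[ℝ] EuclideanSpace ℝ (Fin 3))
    (a : EuclideanSpace ℝ (Fin 3)), t ≠ 0 ∧ ∀ i, q' i = t • A (q i) + a

/-- The three bodies lie on a line, with body `j` strictly between the two others
(addition in `Fin 3` is cyclic). -/
def CollinearWithMiddle (j : Fin 3) (q : Config) : Prop :=
  Sbtw ℝ (q (j + 1)) (q j) (q (j + 2))

/-- The number of collinear central configurations with body `j` between the two others, counted up
to translations, rotations and dilations. -/
def numCollinearCentral (m α : Fin 3 → ℝ) (j : Fin 3) : ℕ∞ :=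
  ((fun q : Config => {q' : Config | SimilarConfig q q'}) ''
    {q : Config | CollinearWithMiddle j q ∧ IsCentral m α q}).encard

/-- `f₁(u) = m₁ u² (1 + u)² (m₂ + m₂ u + m₃ u)` -/
def f₁ (m : Fin 3 → ℝ) : ℝ[X] :=
  C (m 0) * X ^ 2 * (1 + X) ^ 2 * (C (m 1) + C (m 1) * X + C (m 2) * X)

/-- `f₂(u) = - m₂ (1 + u)² (m₁ + m₃ + m₁ u)` -/
def f₂ (m : Fin 3 → ℝ) : ℝ[X] :=
  - (C (m 1) * (1 + X) ^ 2 * (C (m 0) + C (m 2) + C (m 0) * X))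

/-- `f₃(u) = - m₃ u² (m₂ - m₁ u)` -/
def f₃ (m : Fin 3 → ℝ) : ℝ[X] :=
  - (C (m 2) * X ^ 2 * (C (m 1) - C (m 0) * X))

/-- The polynomial `f = α₁ f₁ + α₂ f₂ + α₃ f₃` of the reduced equation. -/
def redPoly (m α : Fin 3 → ℝ) : ℝ[X] :=
  C (α 0) * f₁ m + C (α 1) * f₂ m + C (α 2) * f₃ m

/-- The intervals `I₁ = (-∞, -1)`, `I₂ = (-1, 0)`, `I₃ = (0, ∞)`. -/
def interval : Fin 3 → Set ℝ :=
  ![Set.Iio (-1), Set.Ioo (-1) 0, Set.Ioi 0]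

/-- The number of (distinct) real zeros of `f` in the interval `I_i`. -/
def numRoots (m α : Fin 3 → ℝ) (i : Fin 3) : ℕ∞ :=
  {u : ℝ | u ∈ interval i ∧ (redPoly m α).eval u = 0}.encard

/-- The rational parameterization of `Γ`: the point `(α₁, α₂)` for which `f(u) = f'(u) = 0`
when `α₃ = 1`. -/
def gammaParam (m : Fin 3 → ℝ) (u : ℝ) : ℝ × ℝ :=
  (((f₃ m * derivative (f₂ m) - f₂ m * derivative (f₃ m)).eval u /
      (f₂ m * derivative (f₁ m) - f₁ m * derivative (f₂ m)).eval u),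
   ((f₁ m * derivative (f₃ m) - f₃ m * derivative (f₁ m)).eval u /
      (f₂ m * derivative (f₁ m) - f₁ m * derivative (f₂ m)).eval u))

/-- The curve `Γ`: all values of the continuous extension of the rational map `gammaParam` to
`u ∈ ℝ ∪ {∞}`; the parameters where it has no finite limit are the points of `Γ` at infinity. -/
def gammaCurve (m : Fin 3 → ℝ) : Set (ℝ × ℝ) :=
  {p | (∃ u : ℝ, Tendsto (gammaParam m) (𝓝[≠] u) (𝓝 p)) ∨
    Tendsto (gammaParam m) (cocompact ℝ) (𝓝 p)}

/-- The parameter plane without the two axes and the curve `Γ`. -/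
def planeMinusCurves (m : Fin 3 → ℝ) : Set (ℝ × ℝ) :=
  {p | p.1 ≠ 0 ∧ p.2 ≠ 0 ∧ p ∉ gammaCurve m}

/-- The regions: connected components of the complement of the axes and `Γ`. -/
def regions (m : Fin 3 → ℝ) : Set (Set (ℝ × ℝ)) :=
  {S | ∃ p ∈ planeMinusCurves m, S = connectedComponentIn (planeMinusCurves m) p}

/-- The numbers of zeros in `(I₁, I₂, I₃)`; row `k` belongs to region `k + 1`. -/
def zerosTable : Fin 13 → Fin 3 → ℕ :=
  ![![0, 0, 1], ![0, 2, 1], ![0, 1, 0], ![2, 1, 0], ![3, 1, 1], ![1, 1, 1], ![1, 3, 1],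
    ![1, 2, 0], ![1, 0, 0], ![2, 0, 1], ![1, 0, 2], ![0, 1, 2], ![1, 1, 3]]

/-- The signs of `(α₁, α₂)` on the regions; entry `k` belongs to region `k + 1`. -/
def quadrantTable : Fin 13 → SignType × SignType :=
  ![(1, 1), (1, 1), (1, -1), (1, -1), (-1, -1), (-1, -1), (-1, -1),
    (-1, 1), (-1, 1), (1, 1), (-1, 1), (1, -1), (-1, -1)]

end

noncomputable section

/-! A collinear configuration is determined up to similarity by the ratio `u` in `q₃ - q₁ = u (q₂ -
q₃)`, and the interval containing `u` tells which body is in the middle. Eliminating the multiplier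
from the three equations leaves one scalar equation. It is `f(u) = 0` up to a change of sign of one
parameter, because the signs of `u` and `1 + u` enter through `u / |u|³` and `(1 + u) / |1 + u|³`
(`isCentral_iff`, `numCollinearCentral_eq`).

Counting. Each interval is mapped to `x > 0`, where `f` becomes a quintic whose two top coefficients
are negative and whose two bottom ones have equal sign (`EndPattern`). Descartes' rule allows three
positive zeros with multiplicity if the constant term is positive, two if it is negative. So, unless
there is a double zero, either all zeros are simple downward crossings (one or none), or there is an
upward crossing and the bound is attained. Double zeros occur exactly on `Γ`, since its
parameterization is Cramer's rule for `f = f' = 0` (`mem_gammaCurve_iff`). The signs of the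
parameters fix the parities, and estimates in each quadrant show that at most one interval carries
the additional pair of zeros. Thirteen combinations of a quadrant and such an interval (or none)
survive: the sets `cell` (`exists_cell`).

Topology. The cells are open, disjoint, nonempty and cover the complement of the curves, so they are
its components as soon as they are connected (`connectedComponentIn_eq_cell`). Where `α₂ > 0`, this
follows from monotonicity in the parameters and a fibre argument
(`IsOpen.isPreconnected_of_fibers`). In the negative quadrant the cells with three zeros in `I₂` or
`I₃` are continuous images of planar domains, with the upward zero `x` and `α₁` as coordinates; the
cell without additional zeros is joined by explicit paths to `(-2, -2)` (`hub_of_le`). The other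
cells are reflections in the diagonal, which corresponds to `u ↦ 1 / u`.

Values. At most three zeros exist for all parameters, axes included (`numRoots_le_three`), and each
column of the table contains 0, 1, 2 and 3. -/

/-! ### Quintics, types of zeros, and Descartes' bound -/

/-- The quintic function with coefficient vector `c`. -/
def quin (c : Fin 6 → ℝ) (x : ℝ) : ℝ :=
  c 0 + c 1 * x + c 2 * x ^ 2 + c 3 * x ^ 3 + c 4 * x ^ 4 + c 5 * x ^ 5

/-- The derivative of `quin c`. -/
def dquin (c : Fin 6 → ℝ) (x : ℝ) : ℝ :=
  c 1 + 2 * c 2 * x + 3 * c 3 * x ^ 2 + 4 * c 4 * x ^ 3 + 5 * c 5 * x ^ 4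

/-- The polynomial whose evaluation is `quin c`. -/
def quinPoly (c : Fin 6 → ℝ) : ℝ[X] :=
  C (c 0) + C (c 1) * X + C (c 2) * X ^ 2 + C (c 3) * X ^ 3 + C (c 4) * X ^ 4 + C (c 5) * X ^ 5

/-- The coefficient vector has the sign pattern `-, -, ?, ?, s, s` in descending order. -/
structure EndPattern (c : Fin 6 → ℝ) : Prop where
  five : c 5 < 0
  four : c 4 < 0
  ends : 0 < c 0 * c 1

/-- Some positive zero of the quintic is a simple upward crossing. -/
def HasUp (c : Fin 6 → ℝ) : Prop := ∃ x, 0 < x ∧ quin c x = 0 ∧ 0 < dquin c x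

/-- All positive zeros of the quintic are simple downward crossings. -/
def AllDown (c : Fin 6 → ℝ) : Prop := ∀ x, 0 < x → quin c x = 0 → dquin c x < 0

/-- The quintic has a multiple positive zero. -/
def HasDouble (c : Fin 6 → ℝ) : Prop := ∃ x, 0 < x ∧ quin c x = 0 ∧ dquin c x = 0

/-- The set of positive zeros. -/
def posZeros (c : Fin 6 → ℝ) : Set ℝ := {x | 0 < x ∧ quin c x = 0}

lemma eval_quinPoly (c : Fin 6 → ℝ) (x : ℝ) : (quinPoly c).eval x = quin c x := by
  simp [quinPoly, quin]

lemma eval_derivative_quinPoly (c : Fin 6 → ℝ) (x : ℝ) :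
    (derivative (quinPoly c)).eval x = dquin c x := by
  simp [quinPoly, dquin]
  ring

lemma hasDerivAt_quin (c : Fin 6 → ℝ) (x : ℝ) : HasDerivAt (quin c) (dquin c x) x := by
  have h := (quinPoly c).hasDerivAt x
  rw [eval_derivative_quinPoly] at h
  exact h.congr_of_eventuallyEq (Eventually.of_forall fun y => (eval_quinPoly c y).symm)

lemma continuous_quin (c : Fin 6 → ℝ) : Continuous (quin c) := by
  unfold quin; fun_prop

lemma natDegree_quinPoly {c : Fin 6 → ℝ} (h : c 5 ≠ 0) : (quinPoly c).natDegree = 5 := by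
  unfold quinPoly; compute_degree!

lemma coeffList_quinPoly {c : Fin 6 → ℝ} (h : c 5 ≠ 0) :
    (quinPoly c).coeffList = [c 5, c 4, c 3, c 2, c 1, c 0] := by
  have hne : quinPoly c ≠ 0 := by
    intro h0
    have := natDegree_quinPoly h
    simp [h0] at this
  have hd : (quinPoly c).degree = 5 := by
    rw [degree_eq_natDegree hne, natDegree_quinPoly h]; rfl
  have hs : (quinPoly c).degree.succ = 6 := by rw [hd]; rfl
  rw [coeffList, hs]
  simp [List.range_succ, quinPoly, coeff_X, coeff_C]

lemma quinPoly_ne_zero {c : Fin 6 → ℝ} (h : c 5 ≠ 0) : quinPoly c ≠ 0 := by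
  intro h0
  have := natDegree_quinPoly h
  simp [h0] at this

/-- The number of positive zeros counted with multiplicity. -/
def posCount (c : Fin 6 → ℝ) : ℕ := (quinPoly c).roots.countP (0 < ·)

/-- Sign variations of a list of signs. -/
def signVar (l : List SignType) : ℕ :=
  ((l.filter (· ≠ 0)).destutter (· ≠ ·)).length - 1

/-- Descartes' rule of signs, phrased on a list of signs. Only the two middle signs are unknown, so
the bounds that follow are finite checks. -/
lemma posCount_le_signVar {c : Fin 6 → ℝ} (h : c 5 ≠ 0) :
    posCount c ≤ signVar [SignType.sign (c 5), SignType.sign (c 4), SignType.sign (c 3),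
      SignType.sign (c 2), SignType.sign (c 1), SignType.sign (c 0)] := by
  have := roots_countP_pos_le_signVariations (quinPoly c)
  rw [signVariations, coeffList_quinPoly h] at this
  exact this

lemma signVar_odd : ∀ s t : SignType, signVar [-1, -1, s, t, 1, 1] ≤ 3 := by decide
lemma signVar_odd_le_one : ∀ s t : SignType, ¬ (s = 1 ∧ t = -1) →
    signVar [-1, -1, s, t, 1, 1] ≤ 1 := by decide
lemma signVar_even : ∀ s t : SignType, signVar [-1, -1, s, t, -1, -1] ≤ 2 := by decide

namespace EndPattern

variable {c : Fin 6 → ℝ} (hc : EndPattern c)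
include hc

lemma zero_ne : c 0 ≠ 0 := fun h => by have := hc.ends; simp [h] at this

lemma posCount_le_three (h0 : 0 < c 0) : posCount c ≤ 3 := by
  have h1 : 0 < c 1 := pos_of_mul_pos_right (by simpa [mul_comm] using hc.ends) h0.le
  have := posCount_le_signVar hc.five.ne
  rw [sign_neg hc.five, sign_neg hc.four, sign_pos h1, sign_pos h0] at this
  exact this.trans (signVar_odd _ _)

lemma posCount_le_one (h0 : 0 < c 0) (h : ¬ (0 < c 3 ∧ c 2 < 0)) : posCount c ≤ 1 := by
  have h1 : 0 < c 1 := pos_of_mul_pos_right (by simpa [mul_comm] using hc.ends) h0.le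
  have := posCount_le_signVar hc.five.ne
  rw [sign_neg hc.five, sign_neg hc.four, sign_pos h1, sign_pos h0] at this
  exact this.trans (signVar_odd_le_one _ _ (by rwa [sign_eq_one_iff, sign_eq_neg_one_iff]))

lemma posCount_le_two (h0 : c 0 < 0) : posCount c ≤ 2 := by
  have h1 : c 1 < 0 := by
    by_contra h
    nlinarith [hc.ends]
  have := posCount_le_signVar hc.five.ne
  rw [sign_neg hc.five, sign_neg hc.four, sign_neg h1, sign_neg h0] at this
  exact this.trans (signVar_even _ _)

end EndPattern

lemma card_le_posCount {c : Fin 6 → ℝ} (h : c 5 ≠ 0) (s : Finset ℝ)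
    (hs : ∀ x ∈ s, 0 < x ∧ quin c x = 0) : s.card ≤ posCount c := by
  have hle : s.val ≤ (quinPoly c).roots := by
    rw [Multiset.le_iff_subset s.nodup]
    intro x hx
    rw [mem_roots (quinPoly_ne_zero h), IsRoot, eval_quinPoly]
    exact (hs x hx).2
  have h1 := Multiset.countP_le_of_le (fun x : ℝ => 0 < x) hle
  have h2 : Multiset.countP (fun x : ℝ => 0 < x) s.val = Multiset.card s.val :=
    Multiset.countP_eq_card.mpr fun x hx => (hs x hx).1
  rw [h2] at h1
  exact h1

/-- A double zero occupies two places in the multiset of roots; the other zeros come on top. -/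
lemma two_add_card_le_posCount {c : Fin 6 → ℝ} (h : c 5 ≠ 0) {d : ℝ} (hd : 0 < d)
    (hd0 : quin c d = 0) (hd1 : dquin c d = 0) (s : Finset ℝ) (hds : d ∉ s)
    (hs : ∀ x ∈ s, 0 < x ∧ quin c x = 0) : 2 + s.card ≤ posCount c := by
  have hne := quinPoly_ne_zero h
  have hle : d ::ₘ d ::ₘ s.val ≤ (quinPoly c).roots := by
    rw [Multiset.le_iff_count]
    intro x
    rw [Multiset.count_cons, Multiset.count_cons, count_roots]
    by_cases hx : x = d
    · subst hx
      have h1 : 1 < (quinPoly c).rootMultiplicity x := by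
        rw [one_lt_rootMultiplicity_iff_isRoot hne]
        simp [IsRoot, eval_quinPoly, eval_derivative_quinPoly, hd0, hd1]
      have h0 : Multiset.count x s.val = 0 := Multiset.count_eq_zero.mpr hds
      simp only [if_true, h0]; omega
    · simp only [hx, if_false, add_zero]
      by_cases hxs : x ∈ s
      · have h1 : Multiset.count x s.val = 1 := Multiset.count_eq_one_of_mem s.nodup hxs
        rw [h1]
        have : 0 < (quinPoly c).rootMultiplicity x := by
          rw [rootMultiplicity_pos hne]
          simp [IsRoot, eval_quinPoly, (hs x hxs).2]
        omega
      · have h0 : Multiset.count x s.val = 0 := Multiset.count_eq_zero.mpr hxs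
        omega
  have h1 := Multiset.countP_le_of_le (fun x : ℝ => 0 < x) hle
  have h2 : Multiset.countP (fun x : ℝ => 0 < x) (d ::ₘ d ::ₘ s.val)
      = Multiset.card (d ::ₘ d ::ₘ s.val) := by
    refine Multiset.countP_eq_card.mpr fun x hx => ?_
    simp only [Multiset.mem_cons] at hx
    rcases hx with rfl | rfl | hx
    · exact hd
    · exact hd
    · exact (hs x hx).1
  rw [h2] at h1
  simp only [Multiset.card_cons, Finset.card_val] at h1
  unfold posCount
  omega

/-! ### Crossings -/

/-- At the last point where `f ≤ 0` the slope cannot be negative, since `f` is positive to its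
right. Only the weak inequality results; a vanishing slope has to be excluded separately. -/
lemma exists_root_up {f f' : ℝ → ℝ} (hf : ∀ x, HasDerivAt f (f' x) x) {s t : ℝ} (hst : s < t)
    (hs : f s < 0) (ht : 0 < f t) : ∃ z ∈ Set.Ioo s t, f z = 0 ∧ 0 ≤ f' z := by
  have hcont : Continuous f := continuous_iff_continuousAt.2 fun x => (hf x).continuousAt
  set A := {x | x ∈ Set.Icc s t ∧ f x ≤ 0} with hA
  have hAne : A.Nonempty := ⟨s, ⟨le_refl _, hst.le⟩, hs.le⟩
  have hAb : BddAbove A := ⟨t, fun x hx => hx.1.2⟩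
  have hAc : IsClosed A := isClosed_Icc.inter (isClosed_le hcont continuous_const)
  have hz := hAc.csSup_mem hAne hAb
  set z := sSup A
  have hzt : z < t := lt_of_le_of_ne hz.1.2 fun h => by have := hz.2; rw [h] at this; linarith
  have hpos : ∀ x ∈ Set.Ioc z t, 0 < f x := by
    intro x hx
    by_contra h
    have : x ∈ A := ⟨⟨hz.1.1.trans hx.1.le, hx.2⟩, not_lt.1 h⟩
    exact absurd (le_csSup hAb this) (not_le.2 hx.1)
  have hz0 : f z = 0 := by
    refine le_antisymm hz.2 ?_
    have hclos : z ∈ closure (Set.Ioc z t) := by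
      rw [closure_Ioc hzt.ne]; exact ⟨le_refl _, hzt.le⟩
    exact closure_minimal (fun x hx => (hpos x hx).le)
      (isClosed_le continuous_const hcont) hclos
  have hsz : s < z := lt_of_le_of_ne hz.1.1 fun h => by rw [← h] at hz0; linarith
  refine ⟨z, ⟨hsz, hzt⟩, hz0, ?_⟩
  by_contra hneg
  push Not at hneg
  have hev := eventually_nhdsWithin_sign_eq_of_deriv_neg (f := f) (x₀ := z)
    (by rw [(hf z).deriv]; exact hneg) hz0
  have h2 : ∀ᶠ x in 𝓝[>] z, f x < 0 := by
    filter_upwards [hev.filter_mono nhdsWithin_le_nhds, self_mem_nhdsWithin] with x hx hxz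
    have : (SignType.sign (z - x)) = -1 := sign_neg (sub_neg.2 hxz)
    rw [this] at hx
    exact sign_eq_neg_one_iff.1 hx
  have h3 : ∀ᶠ x in 𝓝[>] z, x ∈ Set.Ioc z t := Ioc_mem_nhdsGT hzt
  obtain ⟨x, hx1, hx2⟩ := (h2.and h3).exists
  linarith [hpos x hx2]

lemma exists_near_up {f : ℝ → ℝ} {f' x : ℝ} (hf : HasDerivAt f f' x) (hx : f x = 0) (h : 0 < f')
    {l r : ℝ} (hl : l < x) (hr : x < r) :
    ∃ s t, s ∈ Set.Ioo l x ∧ t ∈ Set.Ioo x r ∧ f s < 0 ∧ 0 < f t := by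
  have hev := eventually_nhdsWithin_sign_eq_of_deriv_pos (f := f) (x₀ := x)
    (by rw [hf.deriv]; exact h) hx
  have h1 : ∀ᶠ y in 𝓝[<] x, y ∈ Set.Ioo l x ∧ SignType.sign (f y) = SignType.sign (y - x) :=
    Filter.Eventually.and (Ioo_mem_nhdsLT hl) (hev.filter_mono nhdsWithin_le_nhds)
  have h2 : ∀ᶠ y in 𝓝[>] x, y ∈ Set.Ioo x r ∧ SignType.sign (f y) = SignType.sign (y - x) :=
    Filter.Eventually.and (Ioo_mem_nhdsGT hr) (hev.filter_mono nhdsWithin_le_nhds)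
  obtain ⟨s, hs, hs'⟩ := h1.exists
  obtain ⟨t, ht, ht'⟩ := h2.exists
  refine ⟨s, t, hs, ht, ?_, ?_⟩
  · rw [sign_neg (sub_neg.2 hs.2)] at hs'; exact sign_eq_neg_one_iff.1 hs'
  · rw [sign_pos (sub_pos.2 ht.1)] at ht'; exact sign_eq_one_iff.1 ht'

lemma exists_near_down {f : ℝ → ℝ} {f' x : ℝ} (hf : HasDerivAt f f' x) (hx : f x = 0) (h : f' < 0)
    {l r : ℝ} (hl : l < x) (hr : x < r) :
    ∃ s t, s ∈ Set.Ioo l x ∧ t ∈ Set.Ioo x r ∧ 0 < f s ∧ f t < 0 := by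
  obtain ⟨s, t, hs, ht, h1, h2⟩ := exists_near_up hf.neg (by simp [hx]) (neg_pos.2 h) hl hr
  exact ⟨s, t, hs, ht, by simpa using h1, by simpa using h2⟩

lemma exists_root_between {f : ℝ → ℝ} (hf : Continuous f) {s t : ℝ} (hst : s < t)
    (h : f s * f t < 0) : ∃ z ∈ Set.Ioo s t, f z = 0 := by
  rcases mul_neg_iff.1 h with ⟨h1, h2⟩ | ⟨h1, h2⟩
  · exact intermediate_value_Ioo' hst.le hf.continuousOn ⟨h2, h1⟩
  · exact intermediate_value_Ioo hst.le hf.continuousOn ⟨h1, h2⟩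

lemma quin_zero (c : Fin 6 → ℝ) : quin c 0 = c 0 := by simp [quin]

lemma exists_quin_neg {c : Fin 6 → ℝ} (h : c 5 < 0) (t : ℝ) : ∃ x, t < x ∧ quin c x < 0 := by
  set S := |c 0| + |c 1| + |c 2| + |c 3| + |c 4| with hS
  have hS0 : 0 ≤ S := by positivity
  refine ⟨max (|t| + 1) ((S + 1) / (-c 5)), lt_of_lt_of_le (by linarith [le_abs_self t])
    (le_max_left _ _), ?_⟩
  set x := max (|t| + 1) ((S + 1) / (-c 5))
  have hx1 : 1 ≤ x := le_trans (by linarith [abs_nonneg t]) (le_max_left _ _)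
  have hx2 : S + 1 ≤ x * (-c 5) := by
    rw [← div_le_iff₀ (by linarith)]; exact le_max_right _ _
  have hb : ∀ k : ℕ, k ≤ 4 → ∀ a : ℝ, a * x ^ k ≤ |a| * x ^ 4 := by
    intro k hk a
    have h1 : x ^ k ≤ x ^ 4 := pow_le_pow_right₀ hx1 hk
    have h0 : 0 ≤ x ^ k := by positivity
    calc a * x ^ k ≤ |a| * x ^ k := mul_le_mul_of_nonneg_right (le_abs_self a) h0
      _ ≤ |a| * x ^ 4 := mul_le_mul_of_nonneg_left h1 (abs_nonneg a)
  have e0 := hb 0 (by norm_num) (c 0)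
  have e1 := hb 1 (by norm_num) (c 1)
  have e2 := hb 2 (by norm_num) (c 2)
  have e3 := hb 3 (by norm_num) (c 3)
  have e4 := hb 4 (by norm_num) (c 4)
  have hx4 : 0 < x ^ 4 := by positivity
  have key : quin c x ≤ x ^ 4 * (S + c 5 * x) := by
    unfold quin
    simp only [pow_zero, pow_one, mul_one] at e0 e1
    rw [hS]; linarith [e0, e1, e2, e3, e4]
  have : x ^ 4 * (S + c 5 * x) < 0 := mul_neg_of_pos_of_neg hx4 (by linarith)
  linarith

lemma encard_eq_of_finset {A : Set ℝ} {s : Finset ℝ} (h : A = ↑s) : A.encard = s.card := by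
  rw [h, Set.encard_coe_eq_coe_finsetCard]

/-! ### Exact number of zeros from the type of crossing -/

namespace EndPattern

variable {c : Fin 6 → ℝ} (hc : EndPattern c)
include hc

/-- Three zeros around an upward crossing when `c 0` is positive. -/
lemma exists_three (h0 : 0 < c 0) {s t : ℝ} (hs : 0 < s) (h1 : quin c s < 0)
    (h2 : 0 < quin c t) :
    (∃ x ∈ Set.Ioo 0 s, quin c x = 0) ∧ (∃ x, t < x ∧ quin c x = 0) := by
  refine ⟨exists_root_between (continuous_quin c) hs ?_, ?_⟩
  · rw [quin_zero]; exact mul_neg_of_pos_of_neg h0 h1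
  · obtain ⟨R, hR, hR'⟩ := exists_quin_neg hc.five t
    obtain ⟨z, hz, hz'⟩ := exists_root_between (continuous_quin c) hR (mul_neg_of_pos_of_neg h2 hR')
    exact ⟨z, hz.1, hz'⟩

lemma exists_finset_of_hasUp_odd (h0 : 0 < c 0) (h : HasUp c) :
    ∃ s : Finset ℝ, s.card = 3 ∧ ∀ x ∈ s, 0 < x ∧ quin c x = 0 := by
  obtain ⟨x, hx, hx0, hx1⟩ := h
  obtain ⟨s, t, hs, ht, h1, h2⟩ := exists_near_up (hasDerivAt_quin c x) hx0 hx1 hx (lt_add_one x)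
  obtain ⟨⟨y, hy, hy0⟩, z, hz, hz0⟩ := hc.exists_three h0 hs.1 h1 h2
  have hyx : y < x := hy.2.trans hs.2
  have hxz : x < z := ht.1.trans hz
  refine ⟨{y, x, z}, ?_, ?_⟩
  · rw [Finset.card_eq_three]
    exact ⟨y, x, z, hyx.ne, (hyx.trans hxz).ne, hxz.ne, rfl⟩
  · intro w hw
    simp only [Finset.mem_insert, Finset.mem_singleton] at hw
    rcases hw with rfl | rfl | rfl
    · exact ⟨hy.1, hy0⟩
    · exact ⟨hx, hx0⟩
    · exact ⟨hx.trans hxz, hz0⟩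

lemma exists_finset_of_hasUp_even (h : HasUp c) :
    ∃ s : Finset ℝ, s.card = 2 ∧ ∀ x ∈ s, 0 < x ∧ quin c x = 0 := by
  obtain ⟨x, hx, hx0, hx1⟩ := h
  obtain ⟨s, t, hs, ht, h1, h2⟩ := exists_near_up (hasDerivAt_quin c x) hx0 hx1 hx (lt_add_one x)
  obtain ⟨R, hR, hR'⟩ := exists_quin_neg hc.five t
  obtain ⟨z, hz, hz'⟩ := exists_root_between (continuous_quin c) hR (mul_neg_of_pos_of_neg h2 hR')
  have hxz : x < z := ht.1.trans hz.1
  refine ⟨{x, z}, Finset.card_pair hxz.ne, ?_⟩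
  intro w hw
  simp only [Finset.mem_insert, Finset.mem_singleton] at hw
  rcases hw with rfl | rfl
  · exact ⟨hx, hx0⟩
  · exact ⟨hx.trans hxz, hz'⟩

lemma posZeros_eq_of_card {s : Finset ℝ} (hs : ∀ x ∈ s, 0 < x ∧ quin c x = 0)
    (h : posCount c ≤ s.card) : posZeros c = ↑s := by
  ext x
  refine ⟨fun hx => ?_, fun hx => hs x hx⟩
  by_contra hxs
  have := card_le_posCount hc.five.ne (insert x s) (by
    intro y hy
    rcases Finset.mem_insert.1 hy with rfl | hy
    · exact hx
    · exact hs y hy)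
  rw [Finset.card_insert_of_notMem hxs] at this
  omega

lemma not_hasDouble_of_card {s : Finset ℝ} (hs : ∀ x ∈ s, 0 < x ∧ quin c x = 0)
    (h : posCount c ≤ s.card) : ¬ HasDouble c := by
  rintro ⟨d, hd, hd0, hd1⟩
  have := two_add_card_le_posCount hc.five.ne hd hd0 hd1 (s.erase d) (Finset.notMem_erase d s)
    fun x hx => hs x (Finset.mem_of_mem_erase hx)
  have h2 := Finset.pred_card_le_card_erase (s := s) (a := d)
  omega

/-- An upward crossing forces further zeros by the intermediate value theorem. Together they exhaust
Descartes' bound, which leaves no room for multiplicity. -/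
lemma not_hasDouble (h : HasUp c) : ¬ HasDouble c := by
  rcases lt_or_gt_of_ne hc.zero_ne with h0 | h0
  · obtain ⟨s, hs, hs'⟩ := hc.exists_finset_of_hasUp_even h
    exact hc.not_hasDouble_of_card hs' (hs ▸ hc.posCount_le_two h0)
  · obtain ⟨s, hs, hs'⟩ := hc.exists_finset_of_hasUp_odd h0 h
    exact hc.not_hasDouble_of_card hs' (hs ▸ hc.posCount_le_three h0)

lemma encard_of_hasUp (h : HasUp c) : (posZeros c).encard = if 0 < c 0 then 3 else 2 := by
  rcases lt_or_gt_of_ne hc.zero_ne with h0 | h0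
  · obtain ⟨s, hs, hs'⟩ := hc.exists_finset_of_hasUp_even h
    rw [encard_eq_of_finset (hc.posZeros_eq_of_card hs' (hs ▸ hc.posCount_le_two h0)), hs,
      if_neg (not_lt.2 h0.le)]
    rfl
  · obtain ⟨s, hs, hs'⟩ := hc.exists_finset_of_hasUp_odd h0 h
    rw [encard_eq_of_finset (hc.posZeros_eq_of_card hs' (hs ▸ hc.posCount_le_three h0)), hs,
      if_pos h0]
    rfl

/-- A zero that is not a downward crossing entails at least two zeros with multiplicity, and only
the sign pattern `-, -, +, -, +, +` permits more than one. This turns the existence of extra zeros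
into inequalities between coefficients. -/
lemma coeff_signs (h0 : 0 < c 0) (h : ¬ AllDown c) : 0 < c 3 ∧ c 2 < 0 := by
  by_contra hcon
  have h1 := hc.posCount_le_one h0 hcon
  unfold AllDown at h
  push Not at h
  obtain ⟨x, hx, hx0, hx1⟩ := h
  rcases hx1.eq_or_lt with hx1 | hx1
  · have := two_add_card_le_posCount hc.five.ne hx hx0 hx1.symm ∅ (by simp) (by simp)
    omega
  · obtain ⟨s, hs, hs'⟩ := hc.exists_finset_of_hasUp_odd h0 ⟨x, hx, hx0, hx1⟩
    have := card_le_posCount hc.five.ne s hs'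
    omega

lemma exists_root (h0 : 0 < c 0) : ∃ x, 0 < x ∧ quin c x = 0 := by
  obtain ⟨R, hR, hR'⟩ := exists_quin_neg hc.five 0
  obtain ⟨z, hz, hz'⟩ := exists_root_between (continuous_quin c) hR
    (by rw [quin_zero]; exact mul_neg_of_pos_of_neg h0 hR')
  exact ⟨z, hz.1, hz'⟩

lemma hasUp_iff_even (h0 : c 0 < 0) : HasUp c ↔ ∃ x, 0 < x ∧ 0 < quin c x := by
  constructor
  · rintro ⟨x, hx, hx0, hx1⟩
    obtain ⟨s, t, hs, ht, h1, h2⟩ := exists_near_up (hasDerivAt_quin c x) hx0 hx1 hx (lt_add_one x)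
    exact ⟨t, hx.trans ht.1, h2⟩
  · rintro ⟨x, hx, hx0⟩
    obtain ⟨z, hz, hz0, hz1⟩ := exists_root_up (hasDerivAt_quin c) hx (by rwa [quin_zero]) hx0
    -- If the slope at `z` vanished, the double zero and the zero beyond `x` would make three, but
    -- Descartes allows two.
    refine ⟨z, hz.1, hz0, hz1.lt_of_ne' fun hz2 => ?_⟩
    obtain ⟨R, hR, hR'⟩ := exists_quin_neg hc.five x
    obtain ⟨w, hw, hw'⟩ := exists_root_between (continuous_quin c) hR
      (mul_neg_of_pos_of_neg hx0 hR')
    have := two_add_card_le_posCount hc.five.ne hz.1 hz0 hz2 {w}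
      (by simp only [Finset.mem_singleton]; exact (hz.2.trans hw.1).ne)
      (by simp only [Finset.mem_singleton]; rintro _ rfl; exact ⟨hx.trans hw.1, hw'⟩)
    have h2 := hc.posCount_le_two h0
    simp at this
    omega

end EndPattern

/-- Between two downward crossings the function rises from negative to positive values, so there is
a zero with nonnegative slope. -/
lemma AllDown.unique {c : Fin 6 → ℝ} (h : AllDown c) {x y : ℝ} (hx : 0 < x) (hy : 0 < y)
    (hx0 : quin c x = 0) (hy0 : quin c y = 0) : x = y := by
  by_contra hne
  wlog hxy : x < y generalizing x y
  · exact this hy hx hy0 hx0 (Ne.symm hne) (lt_of_le_of_ne (not_lt.1 hxy) (Ne.symm hne))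
  obtain ⟨-, t, -, ht, -, h1⟩ := exists_near_down (hasDerivAt_quin c x) hx0 (h x hx hx0)
    (sub_one_lt x) hxy
  obtain ⟨s, -, hs, -, h2, -⟩ := exists_near_down (hasDerivAt_quin c y) hy0 (h y hy hy0)
    ht.2 (lt_add_one y)
  obtain ⟨z, hz, hz0, hz1⟩ := exists_root_up (hasDerivAt_quin c) hs.1 h1 h2
  have hzx : 0 < z := hx.trans (ht.1.trans hz.1)
  linarith [h z hzx hz0]

lemma AllDown.not_hasUp {c : Fin 6 → ℝ} (h : AllDown c) : ¬ HasUp c := by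
  rintro ⟨x, hx, hx0, hx1⟩
  linarith [h x hx hx0]

lemma AllDown.not_hasDouble {c : Fin 6 → ℝ} (h : AllDown c) : ¬ HasDouble c := by
  rintro ⟨x, hx, hx0, hx1⟩
  linarith [h x hx hx0]

lemma AllDown.neg_of_even {c : Fin 6 → ℝ} (h : AllDown c) (h0 : c 0 < 0) {x : ℝ} (hx : 0 < x) :
    quin c x < 0 := by
  by_contra hcon
  push Not at hcon
  rcases hcon.eq_or_lt with hx0 | hx0
  · obtain ⟨s, -, hs, -, h2, -⟩ := exists_near_down (hasDerivAt_quin c x) hx0.symm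
      (h x hx hx0.symm) hx (lt_add_one x)
    obtain ⟨z, hz, hz0, hz1⟩ := exists_root_up (hasDerivAt_quin c) hs.1 (by rwa [quin_zero]) h2
    linarith [h z hz.1 hz0]
  · obtain ⟨z, hz, hz0, hz1⟩ := exists_root_up (hasDerivAt_quin c) hx (by rwa [quin_zero]) hx0
    linarith [h z hz.1 hz0]

lemma allDown_of_neg {c : Fin 6 → ℝ} (h : ∀ x, 0 < x → quin c x < 0) : AllDown c :=
  fun x hx hx0 => by linarith [h x hx]

lemma EndPattern.encard_of_allDown {c : Fin 6 → ℝ} (hc : EndPattern c) (h : AllDown c) :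
    (posZeros c).encard = if 0 < c 0 then 1 else 0 := by
  rcases lt_or_gt_of_ne hc.zero_ne with h0 | h0
  · rw [if_neg (not_lt.2 h0.le), Set.encard_eq_zero]
    ext x
    simp only [posZeros, Set.mem_ofPred_eq, Set.mem_empty_iff_false, iff_false, not_and]
    exact fun hx => (h.neg_of_even h0 hx).ne
  · rw [if_pos h0, Set.encard_eq_one]
    obtain ⟨x, hx, hx0⟩ := hc.exists_root h0
    exact ⟨x, Set.eq_singleton_iff_unique_mem.2
      ⟨⟨hx, hx0⟩, fun y hy => h.unique hy.1 hx hy.2 hx0⟩⟩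

lemma hasUp_or_allDown_or_hasDouble (c : Fin 6 → ℝ) : HasUp c ∨ AllDown c ∨ HasDouble c := by
  by_cases h1 : AllDown c
  · exact Or.inr (Or.inl h1)
  unfold AllDown at h1
  push Not at h1
  obtain ⟨x, hx, hx0, hx1⟩ := h1
  rcases hx1.eq_or_lt with hx1 | hx1
  · exact Or.inr (Or.inr ⟨x, hx, hx0, hx1.symm⟩)
  · exact Or.inl ⟨x, hx, hx0, hx1⟩

/-! ### Openness -/

lemma continuous_uncurry_quin : Continuous fun p : (Fin 6 → ℝ) × ℝ => quin p.1 p.2 := by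
  unfold quin; fun_prop

lemma continuous_uncurry_dquin : Continuous fun p : (Fin 6 → ℝ) × ℝ => dquin p.1 p.2 := by
  unfold dquin; fun_prop

/-- The sign change between two points close to the zero survives small perturbations, and the slope
stays positive on the neighbourhood containing the new zero. -/
lemma isOpen_hasUp : IsOpen {c : Fin 6 → ℝ | HasUp c} := by
  rw [isOpen_iff_mem_nhds]
  rintro c ⟨x, hx, hx0, hx1⟩
  have hU : ∀ᶠ p : (Fin 6 → ℝ) × ℝ in 𝓝 c ×ˢ 𝓝 x, 0 < dquin p.1 p.2 := by
    rw [← nhds_prod_eq]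
    exact continuous_uncurry_dquin.continuousAt.eventually (lt_mem_nhds hx1)
  obtain ⟨pa, hpa, pb, hpb, hab⟩ := eventually_prod_iff.1 hU
  obtain ⟨ε, hε, hball⟩ := Metric.eventually_nhds_iff.1 hpb
  obtain ⟨s, t, hs, ht, h1, h2⟩ := exists_near_up (hasDerivAt_quin c x) hx0 hx1
    (l := max 0 (x - ε)) (r := x + ε) (max_lt hx (by linarith)) (by linarith)
  have e1 : ∀ᶠ c' in 𝓝 c, quin c' s < 0 :=
    ((continuous_uncurry_quin.comp (Continuous.prodMk continuous_id
      (continuous_const (y := s)))).continuousAt (x := c)).eventually (gt_mem_nhds h1)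
  have e2 : ∀ᶠ c' in 𝓝 c, 0 < quin c' t :=
    ((continuous_uncurry_quin.comp (Continuous.prodMk continuous_id
      (continuous_const (y := t)))).continuousAt (x := c)).eventually (lt_mem_nhds h2)
  filter_upwards [hpa, e1, e2] with c' hc' h1' h2'
  obtain ⟨z, hz, hz0⟩ := exists_root_between (continuous_quin c') (hs.2.trans ht.1)
    (mul_neg_of_neg_of_pos h1' h2')
  have hs0 : 0 < s := (le_max_left _ _).trans_lt hs.1
  have hs1 : x - ε < s := (le_max_right _ _).trans_lt hs.1
  refine ⟨z, hs0.trans hz.1, hz0, hab hc' (hball ?_)⟩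
  rw [Real.dist_eq, abs_lt]
  constructor <;> linarith [hz.1, hz.2, ht.2]

/-- The reversed coefficient vector. -/
def revc (c : Fin 6 → ℝ) : Fin 6 → ℝ := fun i => c (Fin.rev i)

lemma quin_revc (c : Fin 6 → ℝ) {x : ℝ} (hx : x ≠ 0) : quin (revc c) x = x ^ 5 * quin c x⁻¹ := by
  simp only [quin, revc, Fin.rev, Fin.isValue]
  simp only [Fin.reduceFinMk, Fin.coe_ofNat_eq_mod, Nat.reduceMod, Nat.reduceAdd, Nat.reduceSub]
  field_simp
  ring

lemma dquin_revc (c : Fin 6 → ℝ) {x : ℝ} (hx : x ≠ 0) :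
    dquin (revc c) x = 5 * x ^ 4 * quin c x⁻¹ - x ^ 3 * dquin c x⁻¹ := by
  simp only [quin, dquin, revc, Fin.rev, Fin.isValue]
  simp only [Fin.reduceFinMk, Fin.coe_ofNat_eq_mod, Nat.reduceMod, Nat.reduceAdd, Nat.reduceSub]
  field_simp
  ring

/-- Projection along the compact factor `[0, 1]` is a closed map. The factor `σ = ±1` selects the
sign of the slope. -/
lemma isClosed_exists_mem_Icc (σ : ℝ) :
    IsClosed {c : Fin 6 → ℝ | ∃ x ∈ Set.Icc (0 : ℝ) 1, quin c x = 0 ∧ 0 ≤ σ * dquin c x} := by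
  have h : {c : Fin 6 → ℝ | ∃ x ∈ Set.Icc (0 : ℝ) 1, quin c x = 0 ∧ 0 ≤ σ * dquin c x} =
      Prod.fst '' {p : (Fin 6 → ℝ) × Set.Icc (0 : ℝ) 1 |
        quin p.1 p.2 = 0 ∧ 0 ≤ σ * dquin p.1 p.2} := by
    ext c
    simp only [Set.mem_ofPred_eq, Set.mem_image, Prod.exists, Subtype.exists]
    constructor
    · rintro ⟨x, hx, h1, h2⟩; exact ⟨c, x, hx, ⟨h1, h2⟩, rfl⟩
    · rintro ⟨_, x, hx, ⟨h1, h2⟩, rfl⟩; exact ⟨x, hx, h1, h2⟩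
  rw [h]
  refine isClosedMap_fst_of_compactSpace _ (IsClosed.inter ?_ ?_)
  · exact isClosed_eq (continuous_uncurry_quin.comp
      (continuous_fst.prodMk (continuous_subtype_val.comp continuous_snd))) continuous_const
  · exact isClosed_le continuous_const (continuous_const.mul (continuous_uncurry_dquin.comp
      (continuous_fst.prodMk (continuous_subtype_val.comp continuous_snd))))

lemma continuous_revc : Continuous revc := by
  unfold revc; fun_prop

/-- The half line is not compact, so bad zeros could escape to `0` or `∞`. It is covered by `[0, 1]`
and its image under `x ↦ 1 / x`; nonvanishing end coefficients exclude zeros at the added endpoints.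
Reversal changes the sign of the slope at a zero, hence `σ = -1` in the second chart. -/
lemma isOpen_allDown : IsOpen {c : Fin 6 → ℝ | (c 0 ≠ 0 ∧ c 5 ≠ 0) ∧ AllDown c} := by
  have h : {c : Fin 6 → ℝ | (c 0 ≠ 0 ∧ c 5 ≠ 0) ∧ AllDown c} =
      ({c | c 0 ≠ 0} ∩ {c | c 5 ≠ 0}) ∩
      ({c : Fin 6 → ℝ | ∃ x ∈ Set.Icc (0 : ℝ) 1, quin c x = 0 ∧ 0 ≤ 1 * dquin c x}ᶜ ∩
      (revc ⁻¹' {c : Fin 6 → ℝ | ∃ x ∈ Set.Icc (0 : ℝ) 1, quin c x = 0 ∧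
        0 ≤ (-1) * dquin c x})ᶜ) := by
    ext c
    simp only [Set.mem_ofPred_eq, Set.mem_inter_iff, Set.mem_compl_iff, Set.mem_preimage]
    refine and_congr_right fun ⟨h0, h5⟩ => ⟨fun h => ⟨?_, ?_⟩, fun ⟨h1, h2⟩ => ?_⟩
    · rintro ⟨x, hx, hx0, hx1⟩
      rcases hx.1.eq_or_lt with rfl | hxp
      · exact h0 (by rw [quin_zero] at hx0; exact hx0)
      · linarith [h x hxp hx0]
    · rintro ⟨x, hx, hx0, hx1⟩
      rcases hx.1.eq_or_lt with rfl | hxp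
      · rw [quin_zero] at hx0; exact h5 hx0
      · rw [quin_revc c hxp.ne'] at hx0
        have hx0' : quin c x⁻¹ = 0 := by
          rcases mul_eq_zero.1 hx0 with h' | h'
          · exact absurd h' (by positivity)
          · exact h'
        rw [dquin_revc c hxp.ne', hx0'] at hx1
        have h3 := h x⁻¹ (inv_pos.2 hxp) hx0'
        have : 0 < x ^ 3 := by positivity
        nlinarith
    · intro x hx hx0
      by_contra hcon
      push Not at hcon
      rcases le_total x 1 with hx1 | hx1
      · exact h1 ⟨x, ⟨hx.le, hx1⟩, hx0, by linarith⟩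
      · refine h2 ⟨x⁻¹, ⟨(inv_pos.2 hx).le, inv_le_one_of_one_le₀ hx1⟩, ?_, ?_⟩
        · rw [quin_revc c (inv_pos.2 hx).ne', inv_inv, hx0, mul_zero]
        · rw [dquin_revc c (inv_pos.2 hx).ne', inv_inv, hx0]
          have : 0 < x⁻¹ ^ 3 := by positivity
          nlinarith
  rw [h]
  refine ((isOpen_ne_fun (by fun_prop) (by fun_prop)).inter
    (isOpen_ne_fun (by fun_prop) (by fun_prop))).inter
    ((isClosed_exists_mem_Icc 1).isOpen_compl.inter
    ((isClosed_exists_mem_Icc (-1)).preimage continuous_revc).isOpen_compl)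

/-! ### The reduced equation in the three charts -/

/-- Coefficients of the reduced equation on `I₂` in the coordinate `x = - u / (1 + u)`. -/
def coefInner (μ a b : ℝ) : Fin 6 → ℝ :=
  ![-(μ + 1) * b, -(2 * μ + 3) * b, -1 + μ * a - (μ + 3) * b, -4 - a - b, -5, -2]

/-- Coefficients of the reduced equation on `I₃`. -/
def coefMiddle (μ a b : ℝ) : Fin 6 → ℝ :=
  ![-(μ + 1) * b, -(3 * μ + 2) * b, μ * a - (3 * μ + 1) * b - 1, (3 * μ + 1) * a - μ * b + 1,
    (3 * μ + 2) * a, (μ + 1) * a]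

/-- Coefficients of the reduced equation on the three intervals, with negative leading term. -/
def coefs (μ : ℝ) (p : ℝ × ℝ) : Fin 3 → Fin 6 → ℝ :=
  ![coefInner μ p.2 p.1, coefInner μ p.1 p.2, (-p.1) • coefMiddle μ p.1 p.2]

/-- The reduced polynomial divided by `μ`. -/
def redFun (μ a b u : ℝ) : ℝ :=
  a * (u ^ 2 * (1 + u) ^ 2 * (μ + (μ + 1) * u)) - b * ((1 + u) ^ 2 * (μ + 1 + μ * u)) +
    u ^ 2 * (u - 1)

/-- The derivative of `redFun`. -/
def redFun' (μ a b u : ℝ) : ℝ :=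
  a * (2 * u * (1 + u) ^ 2 * (μ + (μ + 1) * u) + u ^ 2 * (2 * (1 + u)) * (μ + (μ + 1) * u) +
    u ^ 2 * (1 + u) ^ 2 * (μ + 1)) -
  b * (2 * (1 + u) * (μ + 1 + μ * u) + (1 + u) ^ 2 * μ) + (3 * u ^ 2 - 2 * u)

lemma quin_coefInner (μ a b x : ℝ) : quin (coefInner μ a b) x =
    a * (x ^ 2 * (μ - x)) - b * ((1 + x) ^ 2 * (μ + 1 + x)) -
      x ^ 2 * (1 + 2 * x) * (1 + x) ^ 2 := by
  simp [quin, coefInner]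
  ring

lemma quin_coefMiddle (μ a b x : ℝ) : quin (coefMiddle μ a b) x = redFun μ a b x := by
  simp [quin, coefMiddle, redFun]
  ring

lemma dquin_coefMiddle (μ a b x : ℝ) : dquin (coefMiddle μ a b) x = redFun' μ a b x := by
  simp [dquin, coefMiddle, redFun']
  ring

lemma quin_smul (s : ℝ) (c : Fin 6 → ℝ) (x : ℝ) : quin (s • c) x = s * quin c x := by
  simp [quin]
  ring

lemma dquin_smul (s : ℝ) (c : Fin 6 → ℝ) (x : ℝ) : dquin (s • c) x = s * dquin c x := by
  simp [dquin]
  ring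

lemma redFun_inner (μ a b : ℝ) {x : ℝ} (hx : 0 < x) :
    quin (coefInner μ a b) x = (1 + x) ^ 5 * redFun μ a b (-x / (1 + x)) := by
  have : (1 + x) ≠ 0 := by positivity
  rw [quin_coefInner, redFun]
  field_simp
  ring

lemma redFun_inner' (μ a b : ℝ) {x : ℝ} (hx : 0 < x) :
    dquin (coefInner μ a b) x = 5 * (1 + x) ^ 4 * redFun μ a b (-x / (1 + x)) -
      (1 + x) ^ 3 * redFun' μ a b (-x / (1 + x)) := by
  have : (1 + x) ≠ 0 := by positivity
  simp [dquin, coefInner]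
  rw [redFun, redFun']
  field_simp
  ring

/-- The chart of `I₁` is the reciprocal of the chart of `I₂`, and `u ↦ 1 / u` exchanges the two
parameters; hence the same quintic with arguments swapped. -/
lemma redFun_outer (μ a b : ℝ) {x : ℝ} (hx : 0 < x) :
    quin (coefInner μ b a) x = x ^ 5 * redFun μ a b (-(1 + x) / x) := by
  rw [quin_coefInner, redFun]
  field_simp
  ring

lemma redFun_outer' (μ a b : ℝ) {x : ℝ} (hx : 0 < x) :
    dquin (coefInner μ b a) x = 5 * x ^ 4 * redFun μ a b (-(1 + x) / x) +
      x ^ 3 * redFun' μ a b (-(1 + x) / x) := by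
  simp [dquin, coefInner]
  rw [redFun, redFun']
  field_simp
  ring

lemma eval_f₁ (μ u : ℝ) :
    (f₁ ![μ, μ, 1]).eval u = μ * (u ^ 2 * (1 + u) ^ 2 * (μ + (μ + 1) * u)) := by
  simp [f₁]
  ring

lemma eval_f₂ (μ u : ℝ) :
    (f₂ ![μ, μ, 1]).eval u = -μ * ((1 + u) ^ 2 * (μ + 1 + μ * u)) := by
  simp [f₂]
  ring

lemma eval_f₃ (μ u : ℝ) : (f₃ ![μ, μ, 1]).eval u = μ * (u ^ 2 * (u - 1)) := by
  simp [f₃]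
  ring

lemma eval_f₁' (μ u : ℝ) : (derivative (f₁ ![μ, μ, 1])).eval u =
    μ * (2 * u * (1 + u) ^ 2 * (μ + (μ + 1) * u) + u ^ 2 * (2 * (1 + u)) * (μ + (μ + 1) * u) +
    u ^ 2 * (1 + u) ^ 2 * (μ + 1)) := by
  simp [f₁, derivative_pow]
  ring

lemma eval_f₂' (μ u : ℝ) : (derivative (f₂ ![μ, μ, 1])).eval u =
    -μ * (2 * (1 + u) * (μ + 1 + μ * u) + (1 + u) ^ 2 * μ) := by
  simp [f₂, derivative_pow]
  ring

lemma eval_f₃' (μ u : ℝ) : (derivative (f₃ ![μ, μ, 1])).eval u =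
    μ * (3 * u ^ 2 - 2 * u) := by
  simp [f₃]
  ring

lemma eval_redPoly (μ a b u : ℝ) :
    (redPoly ![μ, μ, 1] ![a, b, 1]).eval u = μ * redFun μ a b u := by
  simp only [redPoly, eval_add, eval_mul, eval_C, eval_f₁, eval_f₂, eval_f₃, redFun]
  simp
  ring

/-- The charts from the positive half line to the three intervals. -/
def chart : Fin 3 → ℝ → ℝ := ![fun x => -(1 + x) / x, fun x => -x / (1 + x), fun x => x]

lemma injOn_chart (i : Fin 3) : Set.InjOn (chart i) (Set.Ioi 0) := by
  intro x hx y hy h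
  have hx' : 0 < x := hx
  have hy' : 0 < y := hy
  fin_cases i
  · simp only [chart] at h
    simp at h
    field_simp at h
    linarith
  · simp only [chart] at h
    simp at h
    field_simp at h
    linarith
  · exact h

lemma numRoots_eq {μ : ℝ} (hμ : 0 < μ) (a b : ℝ) (i : Fin 3) :
    numRoots ![μ, μ, 1] ![a, b, 1] i =
      (posZeros (![coefInner μ b a, coefInner μ a b, coefMiddle μ a b] i)).encard := by
  have hset : {u : ℝ | u ∈ interval i ∧ (redPoly ![μ, μ, 1] ![a, b, 1]).eval u = 0} =
      chart i '' posZeros (![coefInner μ b a, coefInner μ a b, coefMiddle μ a b] i) := by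
    ext u
    rw [Set.mem_ofPred_eq, eval_redPoly, mul_eq_zero, or_iff_right hμ.ne']
    constructor
    · rintro ⟨hu, h0⟩
      fin_cases i
      · have hu : u < -1 := hu
        have hx : 0 < -1 / (1 + u) := div_pos_of_neg_of_neg (by norm_num) (by linarith)
        have hne : 1 + u ≠ 0 := by linarith
        have he : -(1 + -1 / (1 + u)) / (-1 / (1 + u)) = u := by field_simp; ring
        refine ⟨-1 / (1 + u), ⟨hx, ?_⟩, he⟩
        simp only [Fin.zero_eta, Matrix.cons_val_zero]
        rw [redFun_outer μ a b hx, he, h0, mul_zero]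
      · have hu : -1 < u ∧ u < 0 := hu
        have hne : 1 + u ≠ 0 := by linarith
        have hx : 0 < -u / (1 + u) := div_pos (by linarith) (by linarith)
        have he : -(-u / (1 + u)) / (1 + -u / (1 + u)) = u := by field_simp; ring
        refine ⟨-u / (1 + u), ⟨hx, ?_⟩, he⟩
        simp only [Fin.mk_one, Matrix.cons_val_one, Matrix.cons_val_zero]
        rw [redFun_inner μ a b hx, he, h0, mul_zero]
      · have hu : 0 < u := hu
        refine ⟨u, ⟨hu, ?_⟩, rfl⟩
        have := quin_coefMiddle μ a b u
        rw [h0] at this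
        exact this
    · rintro ⟨x, ⟨hx, h0⟩, rfl⟩
      fin_cases i
      · simp only [Fin.zero_eta, Matrix.cons_val_zero] at h0
        rw [redFun_outer μ a b hx] at h0
        refine ⟨?_, (mul_eq_zero.1 h0).resolve_left (by positivity)⟩
        change -(1 + x) / x < -1
        rw [div_lt_iff₀ hx]; linarith
      · simp only [Fin.mk_one, Matrix.cons_val_one, Matrix.cons_val_zero] at h0
        rw [redFun_inner μ a b hx] at h0
        refine ⟨?_, (mul_eq_zero.1 h0).resolve_left (by positivity)⟩
        change -1 < -x / (1 + x) ∧ -x / (1 + x) < 0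
        constructor
        · rw [lt_div_iff₀ (by linarith)]; linarith
        · exact div_neg_of_neg_of_pos (by linarith) (by linarith)
      · exact ⟨hx, (quin_coefMiddle μ a b x).symm.trans h0⟩
  rw [numRoots, hset]
  exact ((injOn_chart i).mono fun x hx => hx.1).encard_image

lemma posZeros_smul {s : ℝ} (hs : s ≠ 0) (c : Fin 6 → ℝ) : posZeros (s • c) = posZeros c := by
  ext x
  simp [posZeros, quin_smul, hs]

lemma numRoots_eq_coefs {μ : ℝ} (hμ : 0 < μ) {p : ℝ × ℝ} (hp : p.1 ≠ 0) (i : Fin 3) :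
    numRoots ![μ, μ, 1] ![p.1, p.2, 1] i = (posZeros (coefs μ p i)).encard := by
  rw [numRoots_eq hμ]
  fin_cases i
  · rfl
  · rfl
  · exact congrArg Set.encard (posZeros_smul (neg_ne_zero.2 hp) _).symm

/-- On `I₃` the factor `-α₁` makes the top coefficients negative multiples of `α₁²`, whatever the
sign of `α₁`; the constant term becomes `(μ + 1) α₁ α₂`. -/
lemma endPattern_coefs {μ : ℝ} (hμ : 0 < μ) {p : ℝ × ℝ} (h1 : p.1 ≠ 0) (h2 : p.2 ≠ 0)
    (i : Fin 3) : EndPattern (coefs μ p i) := by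
  have h1' : 0 < p.1 ^ 2 := by positivity
  have h2' : 0 < p.2 ^ 2 := by positivity
  fin_cases i
  · refine ⟨by simp [coefs, coefInner], by simp [coefs, coefInner], ?_⟩
    simp [coefs, coefInner]
    have : 0 < (μ + 1) * (2 * μ + 3) * p.1 ^ 2 := by positivity
    linarith
  · refine ⟨by simp [coefs, coefInner], by simp [coefs, coefInner], ?_⟩
    simp [coefs, coefInner]
    have : 0 < (μ + 1) * (2 * μ + 3) * p.2 ^ 2 := by positivity
    linarith
  · refine ⟨?_, ?_, ?_⟩
    · simp [coefs, coefMiddle]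
      have : 0 < (μ + 1) * p.1 ^ 2 := by positivity
      linarith
    · simp [coefs, coefMiddle]
      have : 0 < (3 * μ + 2) * p.1 ^ 2 := by positivity
      linarith
    · simp [coefs, coefMiddle]
      have : 0 < (μ + 1) * (3 * μ + 2) * (p.1 ^ 2 * p.2 ^ 2) := by positivity
      linarith

/-! ### The curve `Γ` and multiple zeros -/

/-- The denominator of the parameterization. -/
lemma eval_wronskian (μ u : ℝ) :
    (f₂ ![μ, μ, 1] * derivative (f₁ ![μ, μ, 1]) -
      f₁ ![μ, μ, 1] * derivative (f₂ ![μ, μ, 1])).eval u =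
    -μ ^ 2 * (1 + u) ^ 4 * u *
      (2 * μ * (μ + 1) * (1 + u ^ 2) + (4 * μ ^ 2 + 6 * μ + 3) * u) := by
  simp only [eval_sub, eval_mul, eval_f₁, eval_f₂, eval_f₁', eval_f₂']
  ring

lemma wronskian_ne_zero {μ : ℝ} (hμ : 0 < μ) :
    f₂ ![μ, μ, 1] * derivative (f₁ ![μ, μ, 1]) -
      f₁ ![μ, μ, 1] * derivative (f₂ ![μ, μ, 1]) ≠ 0 := by
  intro h
  have := eval_wronskian μ 1
  rw [h] at this
  have h2 : 0 < μ ^ 2 * (1 + 1) ^ 4 * 1 *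
      (2 * μ * (μ + 1) * (1 + 1 ^ 2) + (4 * μ ^ 2 + 6 * μ + 3) * 1) := by positivity
  simp at this
  simp at h2
  rcases this with h' | h'
  · exact hμ.ne' h'
  · have : 0 < 2 * μ * (μ + 1) * (1 + 1) + (4 * μ ^ 2 + 6 * μ + 3) := by positivity
    linarith

lemma eventually_wronskian_ne {μ : ℝ} (hμ : 0 < μ) :
    ∀ᶠ v in cofinite, (f₂ ![μ, μ, 1] * derivative (f₁ ![μ, μ, 1]) -
      f₁ ![μ, μ, 1] * derivative (f₂ ![μ, μ, 1])).eval v ≠ 0 := by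
  have := (f₂ ![μ, μ, 1] * derivative (f₁ ![μ, μ, 1]) -
      f₁ ![μ, μ, 1] * derivative (f₂ ![μ, μ, 1])).finite_setOfPred_isRoot (wronskian_ne_zero hμ)
  filter_upwards [this.compl_mem_cofinite] with v hv using hv

/-- Cramer's rule: the parameterization solves the linear system `f = f' = 0` for `(α₁, α₂)`. -/
lemma redFun_gammaParam {μ : ℝ} {v : ℝ}
    (hv : (f₂ ![μ, μ, 1] * derivative (f₁ ![μ, μ, 1]) -
      f₁ ![μ, μ, 1] * derivative (f₂ ![μ, μ, 1])).eval v ≠ 0) :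
    redFun μ (gammaParam ![μ, μ, 1] v).1 (gammaParam ![μ, μ, 1] v).2 v = 0 ∧
    redFun' μ (gammaParam ![μ, μ, 1] v).1 (gammaParam ![μ, μ, 1] v).2 v = 0 := by
  set W := (f₂ ![μ, μ, 1] * derivative (f₁ ![μ, μ, 1]) -
      f₁ ![μ, μ, 1] * derivative (f₂ ![μ, μ, 1])).eval v with hW
  have hW' := eval_wronskian μ v
  rw [← hW] at hW'
  have h1 : (gammaParam ![μ, μ, 1] v).1 * W =
      (f₃ ![μ, μ, 1] * derivative (f₂ ![μ, μ, 1]) -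
        f₂ ![μ, μ, 1] * derivative (f₃ ![μ, μ, 1])).eval v := div_mul_cancel₀ _ hv
  have h2 : (gammaParam ![μ, μ, 1] v).2 * W =
      (f₁ ![μ, μ, 1] * derivative (f₃ ![μ, μ, 1]) -
        f₃ ![μ, μ, 1] * derivative (f₁ ![μ, μ, 1])).eval v := div_mul_cancel₀ _ hv
  simp only [eval_sub, eval_mul, eval_f₁, eval_f₂, eval_f₁', eval_f₂', eval_f₃, eval_f₃'] at h1 h2
  set a := (gammaParam ![μ, μ, 1] v).1
  set b := (gammaParam ![μ, μ, 1] v).2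
  constructor
  · have : W * redFun μ a b v = 0 := by
      rw [redFun]
      linear_combination (v ^ 2 * (1 + v) ^ 2 * (μ + (μ + 1) * v)) * h1 -
        ((1 + v) ^ 2 * (μ + 1 + μ * v)) * h2 + v ^ 2 * (v - 1) * hW'
    exact (mul_eq_zero.1 this).resolve_left hv
  · have : W * redFun' μ a b v = 0 := by
      rw [redFun']
      linear_combination (2 * v * (1 + v) ^ 2 * (μ + (μ + 1) * v) +
        v ^ 2 * (2 * (1 + v)) * (μ + (μ + 1) * v) + v ^ 2 * (1 + v) ^ 2 * (μ + 1)) * h1 -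
        (2 * (1 + v) * (μ + 1 + μ * v) + (1 + v) ^ 2 * μ) * h2 + (3 * v ^ 2 - 2 * v) * hW'
    exact (mul_eq_zero.1 this).resolve_left hv

lemma continuous_redFun (μ : ℝ) : Continuous fun q : (ℝ × ℝ) × ℝ => redFun μ q.1.1 q.1.2 q.2 := by
  unfold redFun; fun_prop

lemma continuous_redFun' (μ : ℝ) : Continuous fun q : (ℝ × ℝ) × ℝ => redFun' μ q.1.1 q.1.2 q.2 := by
  unfold redFun'; fun_prop

lemma exists_double_of_mem_gammaCurve {μ : ℝ} (hμ : 0 < μ) {p : ℝ × ℝ} (h1 : p.1 ≠ 0)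
    (h2 : p.2 ≠ 0) (hp : p ∈ gammaCurve ![μ, μ, 1]) :
    ∃ u, u ≠ 0 ∧ u ≠ -1 ∧ redFun μ p.1 p.2 u = 0 ∧ redFun' μ p.1 p.2 u = 0 := by
  have hev := eventually_wronskian_ne hμ
  rcases hp with ⟨u, hu⟩ | hu
  · have hev' := hev.filter_mono (nhdsNE_le_cofinite u)
    have hpair : Tendsto (fun v => (gammaParam ![μ, μ, 1] v, v)) (𝓝[≠] u) (𝓝 (p, u)) :=
      hu.prodMk_nhds (tendsto_id.mono_left nhdsWithin_le_nhds)
    have t0 := ((continuous_redFun μ).tendsto (p, u)).comp hpair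
    have t1 := ((continuous_redFun' μ).tendsto (p, u)).comp hpair
    have e0 : redFun μ p.1 p.2 u = 0 := by
      refine tendsto_nhds_unique t0 (tendsto_const_nhds.congr' ?_)
      filter_upwards [hev'] with v hv
      exact (redFun_gammaParam hv).1.symm
    have e1 : redFun' μ p.1 p.2 u = 0 := by
      refine tendsto_nhds_unique t1 (tendsto_const_nhds.congr' ?_)
      filter_upwards [hev'] with v hv
      exact (redFun_gammaParam hv).2.symm
    -- The values of `redFun` at `0` and `-1` are `-(μ + 1) α₂` and `-2`, both nonzero.
    refine ⟨u, ?_, ?_, e0, e1⟩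
    · rintro rfl
      have : p.2 * (μ + 1) = 0 := by simpa [redFun] using e0
      rcases mul_eq_zero.1 this with h | h
      · exact h2 h
      · linarith
    · rintro rfl
      norm_num [redFun] at e0
  · exfalso
    have hev' := hev.filter_mono (cocompact_le_cofinite)
    have hinv : Tendsto (fun v : ℝ => v⁻¹) (cocompact ℝ) (𝓝 0) := by
      rw [← Metric.cobounded_eq_cocompact]; exact tendsto_inv₀_cobounded
    have hpair : Tendsto (fun v => (gammaParam ![μ, μ, 1] v, v⁻¹)) (cocompact ℝ) (𝓝 (p, 0)) :=
      hu.prodMk_nhds hinv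
    -- This is `v⁻⁵ redFun` as a polynomial in `v⁻¹`. Its limit at infinity is `(μ + 1) α₁`, so a
    -- finite point of `Γ` for `u = ∞` lies on an axis.
    have hc : Continuous fun q : (ℝ × ℝ) × ℝ => q.1.1 * ((1 + q.2) ^ 2 * (μ * q.2 + (μ + 1))) -
      q.1.2 * (q.2 ^ 2 * (1 + q.2) ^ 2 * ((μ + 1) * q.2 + μ)) + q.2 ^ 2 * (1 - q.2) := by fun_prop
    have t0 := (hc.tendsto (p, 0)).comp hpair
    have e0 := tendsto_nhds_unique t0 (tendsto_const_nhds.congr' (f₁ := fun _ => (0 : ℝ)) ?_)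
    · have : p.1 * (μ + 1) = 0 := by simpa using e0
      rcases mul_eq_zero.1 this with h | h
      · exact h1 h
      · linarith
    · have h0 : ∀ᶠ v : ℝ in cocompact ℝ, v ≠ 0 := by
        refine Filter.Eventually.filter_mono cocompact_le_cofinite ?_
        exact (Set.finite_singleton (0 : ℝ)).compl_mem_cofinite
      filter_upwards [hev', h0] with v hv hv0
      have := (redFun_gammaParam hv).1
      rw [redFun] at this
      simp only [Function.comp]
      have h5 : v ^ 5 ≠ 0 := by positivity
      symm
      refine (mul_eq_zero.1 (?_ : v ^ 5 * _ = 0)).resolve_left h5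
      rw [← this]
      field_simp
      ring

lemma mem_gammaCurve_of_double {μ : ℝ} (hμ : 0 < μ) {p : ℝ × ℝ} {u : ℝ} (hu : u ≠ 0)
    (hu1 : u ≠ -1) (e0 : redFun μ p.1 p.2 u = 0) (e1 : redFun' μ p.1 p.2 u = 0) :
    p ∈ gammaCurve ![μ, μ, 1] := by
  have hW := eval_wronskian μ u
  set W := (f₂ ![μ, μ, 1] * derivative (f₁ ![μ, μ, 1]) -
      f₁ ![μ, μ, 1] * derivative (f₂ ![μ, μ, 1])).eval u with hWd
  have n1 : (f₃ ![μ, μ, 1] * derivative (f₂ ![μ, μ, 1]) -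
        f₂ ![μ, μ, 1] * derivative (f₃ ![μ, μ, 1])).eval u = p.1 * W := by
    rw [hW]
    simp only [eval_sub, eval_mul, eval_f₂, eval_f₂', eval_f₃, eval_f₃']
    rw [redFun] at e0
    rw [redFun'] at e1
    linear_combination (-μ ^ 2 * (2 * (1 + u) * (μ + 1 + μ * u) + (1 + u) ^ 2 * μ)) * e0 +
      μ ^ 2 * ((1 + u) ^ 2 * (μ + 1 + μ * u)) * e1
  have n2 : (f₁ ![μ, μ, 1] * derivative (f₃ ![μ, μ, 1]) -
        f₃ ![μ, μ, 1] * derivative (f₁ ![μ, μ, 1])).eval u = p.2 * W := by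
    rw [hW]
    simp only [eval_sub, eval_mul, eval_f₁, eval_f₁', eval_f₃, eval_f₃']
    rw [redFun] at e0
    rw [redFun'] at e1
    linear_combination (-μ ^ 2 * (2 * u * (1 + u) ^ 2 * (μ + (μ + 1) * u) +
      u ^ 2 * (2 * (1 + u)) * (μ + (μ + 1) * u) + u ^ 2 * (1 + u) ^ 2 * (μ + 1))) * e0 +
      μ ^ 2 * (u ^ 2 * (1 + u) ^ 2 * (μ + (μ + 1) * u)) * e1
  have hu1' : 1 + u ≠ 0 := fun h => hu1 (by linarith)
  have hW0 : W ≠ 0 := by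
    intro h0
    rw [h0, mul_zero] at n1 n2
    simp only [eval_sub, eval_mul, eval_f₁, eval_f₂, eval_f₁', eval_f₂', eval_f₃, eval_f₃'] at n1 n2
    -- If the denominator vanished, so would both numerators. Their quadratic factors have reversed
    -- coefficients; the difference gives `u = ±1`, and neither value is possible.
    have q1 : (4 * μ + 1) * u ^ 2 + (2 * μ + 3) * u - 2 * (μ + 1) = 0 := by
      have : (μ ^ 2 * u * (1 + u)) *
          ((4 * μ + 1) * u ^ 2 + (2 * μ + 3) * u - 2 * (μ + 1)) = 0 := by
        linear_combination n1
      exact (mul_eq_zero.1 this).resolve_left (by positivity)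
    have q2 : -2 * (μ + 1) * u ^ 2 + (2 * μ + 3) * u + 4 * μ + 1 = 0 := by
      have : (μ ^ 2 * u ^ 4 * (1 + u)) *
          (-2 * (μ + 1) * u ^ 2 + (2 * μ + 3) * u + 4 * μ + 1) = 0 := by
        linear_combination n2
      exact (mul_eq_zero.1 this).resolve_left (by positivity)
    have hsq : u = 1 := by
      have : (6 * μ + 3) * ((u - 1) * (1 + u)) = 0 := by linear_combination q1 - q2
      have h3 := (mul_eq_zero.1 this).resolve_left (by positivity)
      have := (mul_eq_zero.1 h3).resolve_right hu1'
      linarith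
    rw [hsq] at q1
    linarith
  have hval : gammaParam ![μ, μ, 1] u = p := by
    unfold gammaParam
    rw [n1, n2, ← hWd, mul_div_cancel_right₀ _ hW0, mul_div_cancel_right₀ _ hW0]
  refine Or.inl ⟨u, ?_⟩
  rw [← hval]
  have hcont : ContinuousAt (gammaParam ![μ, μ, 1]) u :=
    ((Polynomial.continuousAt _).div (Polynomial.continuousAt _) hW0).prodMk
      ((Polynomial.continuousAt _).div (Polynomial.continuousAt _) hW0)
  exact hcont.tendsto.mono_left nhdsWithin_le_nhds

lemma mem_gammaCurve_iff {μ : ℝ} (hμ : 0 < μ) {p : ℝ × ℝ} (h1 : p.1 ≠ 0) (h2 : p.2 ≠ 0) :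
    p ∈ gammaCurve ![μ, μ, 1] ↔ ∃ i, HasDouble (coefs μ p i) := by
  constructor
  · intro hp
    obtain ⟨u, hu0, hu1, e0, e1⟩ := exists_double_of_mem_gammaCurve hμ h1 h2 hp
    rcases lt_or_gt_of_ne hu1 with hu | hu
    · have hx : 0 < -1 / (1 + u) := div_pos_of_neg_of_neg (by norm_num) (by linarith)
      have hne : 1 + u ≠ 0 := by linarith
      have he : -(1 + -1 / (1 + u)) / (-1 / (1 + u)) = u := by field_simp; ring
      refine ⟨0, -1 / (1 + u), hx, ?_, ?_⟩
      · change quin (coefInner μ p.2 p.1) _ = 0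
        rw [redFun_outer μ _ _ hx, he, e0, mul_zero]
      · change dquin (coefInner μ p.2 p.1) _ = 0
        rw [redFun_outer' μ _ _ hx, he, e0, e1, mul_zero, mul_zero, add_zero]
    rcases lt_or_gt_of_ne hu0 with hu' | hu'
    · have hne : 1 + u ≠ 0 := by linarith
      have hx : 0 < -u / (1 + u) := div_pos (by linarith) (by linarith)
      have he : -(-u / (1 + u)) / (1 + -u / (1 + u)) = u := by field_simp; ring
      refine ⟨1, -u / (1 + u), hx, ?_, ?_⟩
      · change quin (coefInner μ p.1 p.2) _ = 0
        rw [redFun_inner μ _ _ hx, he, e0, mul_zero]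
      · change dquin (coefInner μ p.1 p.2) _ = 0
        rw [redFun_inner' μ _ _ hx, he, e0, e1, mul_zero, mul_zero, sub_zero]
    · refine ⟨2, u, hu', ?_, ?_⟩
      · change quin ((-p.1) • coefMiddle μ p.1 p.2) _ = 0
        rw [quin_smul, quin_coefMiddle, e0, mul_zero]
      · change dquin ((-p.1) • coefMiddle μ p.1 p.2) _ = 0
        rw [dquin_smul, dquin_coefMiddle, e1, mul_zero]
  · rintro ⟨i, x, hx, h0, h0'⟩
    fin_cases i
    · change quin (coefInner μ p.2 p.1) _ = 0 at h0
      change dquin (coefInner μ p.2 p.1) _ = 0 at h0'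
      rw [redFun_outer μ _ _ hx] at h0
      have e0 := (mul_eq_zero.1 h0).resolve_left (by positivity)
      rw [redFun_outer' μ _ _ hx, e0, mul_zero, zero_add] at h0'
      have e1 := (mul_eq_zero.1 h0').resolve_left (by positivity)
      have hlt : -(1 + x) / x < -1 := by rw [div_lt_iff₀ hx]; linarith
      exact mem_gammaCurve_of_double hμ (by linarith) hlt.ne e0 e1
    · change quin (coefInner μ p.1 p.2) _ = 0 at h0
      change dquin (coefInner μ p.1 p.2) _ = 0 at h0'
      rw [redFun_inner μ _ _ hx] at h0
      have e0 := (mul_eq_zero.1 h0).resolve_left (by positivity)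
      rw [redFun_inner' μ _ _ hx, e0, mul_zero, zero_sub, neg_eq_zero] at h0'
      have e1 := (mul_eq_zero.1 h0').resolve_left (by positivity)
      have hlt : -1 < -x / (1 + x) := by rw [lt_div_iff₀ (by linarith)]; linarith
      have hlt' : -x / (1 + x) < 0 := div_neg_of_neg_of_pos (by linarith) (by linarith)
      exact mem_gammaCurve_of_double hμ hlt'.ne hlt.ne' e0 e1
    · change quin ((-p.1) • coefMiddle μ p.1 p.2) _ = 0 at h0
      change dquin ((-p.1) • coefMiddle μ p.1 p.2) _ = 0 at h0'
      rw [quin_smul, quin_coefMiddle] at h0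
      rw [dquin_smul, dquin_coefMiddle] at h0'
      exact mem_gammaCurve_of_double hμ hx.ne' (by linarith)
        ((mul_eq_zero.1 h0).resolve_left (neg_ne_zero.2 h1))
        ((mul_eq_zero.1 h0').resolve_left (neg_ne_zero.2 h1))

/-! ### Sign conditions in the quadrants -/

lemma exists_nonneg_of_not_allDown {c : Fin 6 → ℝ} (h : ¬ AllDown c) :
    ∃ x, 0 < x ∧ 0 ≤ quin c x := by
  unfold AllDown at h
  push Not at h
  obtain ⟨x, hx, h0, -⟩ := h
  exact ⟨x, hx, h0.ge⟩

lemma endPattern_coefInner {μ a b : ℝ} (hμ : 0 < μ) (ha : a ≠ 0) (hb : b ≠ 0) :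
    EndPattern (coefInner μ a b) := endPattern_coefs hμ (p := (a, b)) ha hb 1

/-- The two inequalities of `coeff_signs` would require both `μ b > (3μ + 1) a + 1` and `μ a > (3μ +
1) b + 1`. -/
lemma allDown_middle_of_pos_pos {μ a b : ℝ} (hμ : 0 < μ) (ha : 0 < a) (hb : 0 < b) :
    AllDown (coefs μ (a, b) 2) := by
  by_contra h
  have hab : 0 < a * b := mul_pos ha hb
  have h0 : 0 < coefs μ (a, b) 2 0 := by
    simp [coefs, coefMiddle]
    have : 0 < (μ + 1) * (a * b) := by positivity
    linarith
  obtain ⟨h3, h2⟩ := (endPattern_coefs hμ (p := (a, b)) ha.ne' hb.ne' 2).coeff_signs h0 h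
  simp [coefs, coefMiddle] at h2 h3
  have h3' := neg_of_mul_neg_right h3 ha.le
  have h2' := pos_of_mul_pos_right h2 ha.le
  have : 0 < μ * a := by positivity
  have : 0 < μ * b := by positivity
  linarith

lemma allDown_inner_of_pos_neg {μ a b : ℝ} (hμ : 0 < μ) (ha : 0 < a) (hb : b < 0) :
    AllDown (coefInner μ a b) := by
  by_contra h
  have h0 : 0 < coefInner μ a b 0 := by
    simp [coefInner]
    nlinarith
  obtain ⟨h3, h2⟩ := (endPattern_coefInner hμ ha.ne' hb.ne).coeff_signs h0 h
  simp [coefInner] at h2 h3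
  have : 0 < μ * a := by positivity
  have : 0 < μ * -b := mul_pos hμ (by linarith)
  linarith

/-- If `a ≤ b` the quintic is negative throughout. Since the mirrored equation needs `a < b`, the
intervals `I₁` and `I₂` cannot both carry an additional pair. -/
lemma lt_of_inner_pos_pos {μ a b : ℝ} (hμ : 0 < μ) (ha : 0 < a) (hb : 0 < b)
    (h : ¬ AllDown (coefInner μ a b)) : b < a := by
  obtain ⟨x, hx, h0⟩ := exists_nonneg_of_not_allDown h
  rw [quin_coefInner] at h0
  by_contra hab
  push Not at hab
  have h1 : a * (x ^ 2 * (μ - x)) ≤ b * (x ^ 2 * μ) := by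
    have e1 : 0 ≤ a * (x ^ 2 * x) := by positivity
    have e2 : 0 ≤ (b - a) * (x ^ 2 * μ) := mul_nonneg (by linarith) (by positivity)
    linarith
  have h2 : 0 < b * (μ * (1 + 2 * x) + (1 + x) ^ 3) := by positivity
  have h3 : 0 < x ^ 2 * (1 + 2 * x) * (1 + x) ^ 2 := by positivity
  linarith

/-- If `-1 ≤ a` the term `-a x³` is dominated by the parameter-free part. The threshold `-1`
separates this case from `neg_one_lt_of_middle`, so `I₂` and `I₃` exclude each other. -/
lemma lt_neg_one_of_inner {μ a b : ℝ} (hμ : 0 < μ) (ha : a < 0) (hb : 0 < b)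
    (h : ¬ AllDown (coefInner μ a b)) : a < -1 := by
  obtain ⟨x, hx, h0⟩ := exists_nonneg_of_not_allDown h
  rw [quin_coefInner] at h0
  by_contra hab
  push Not at hab
  have e1 : 0 ≤ (-a) * (x ^ 2 * μ) := mul_nonneg (by linarith) (by positivity)
  have e2 : 0 ≤ (1 + a) * x ^ 3 := mul_nonneg (by linarith) (by positivity)
  have e3 : 0 < b * ((1 + x) ^ 2 * (μ + 1 + x)) := by positivity
  have e4 : 0 < x ^ 2 * (1 + 2 * x) * (1 + x) ^ 2 - x ^ 3 := by
    have : x ^ 2 * (1 + 2 * x) * (1 + x) ^ 2 - x ^ 3 =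
      x ^ 2 + 3 * x ^ 3 + 5 * x ^ 4 + 2 * x ^ 5 := by ring
    rw [this]; positivity
  linarith

lemma quin_middle (μ : ℝ) (p : ℝ × ℝ) (x : ℝ) :
    quin (coefs μ p 2) x = -p.1 * redFun μ p.1 p.2 x := by
  change quin ((-p.1) • coefMiddle μ p.1 p.2) x = _
  rw [quin_smul, quin_coefMiddle]

lemma dquin_middle (μ : ℝ) (p : ℝ × ℝ) (x : ℝ) :
    dquin (coefs μ p 2) x = -p.1 * redFun' μ p.1 p.2 x := by
  change dquin ((-p.1) • coefMiddle μ p.1 p.2) x = _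
  rw [dquin_smul, dquin_coefMiddle]

lemma neg_one_lt_of_middle {μ a b : ℝ} (hμ : 0 < μ) (ha : a < 0) (hb : 0 < b)
    (h : ¬ AllDown (coefs μ (a, b) 2)) : -1 < a := by
  obtain ⟨x, hx, h0⟩ := exists_nonneg_of_not_allDown h
  rw [quin_middle] at h0
  have h0' := nonneg_of_mul_nonneg_right h0 (by simpa using ha : 0 < -(a, b).1)
  simp only [redFun] at h0'
  by_contra hab
  push Not at hab
  have e1 : 0 ≤ (-1 - a) * (x ^ 2 * (1 + x) ^ 2 * (μ + (μ + 1) * x)) :=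
    mul_nonneg (by linarith) (by positivity)
  have e3 : 0 < b * ((1 + x) ^ 2 * (μ + 1 + μ * x)) := by positivity
  have e4 : 0 < x ^ 2 * (1 + x) ^ 2 * (μ + (μ + 1) * x) - x ^ 2 * (x - 1) := by
    have : x ^ 2 * (1 + x) ^ 2 * (μ + (μ + 1) * x) - x ^ 2 * (x - 1) =
      x ^ 2 * ((1 + x) ^ 2 * μ * (1 + x) + (2 * x ^ 2 + x ^ 3) + 1) := by ring
    rw [this]; positivity
  linarith

/-- Both conclusions serve to separate: `a < b` excludes an additional pair in `I₁`, and `a + b <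
-4` excludes one in `I₃` by `lt_of_middle_neg_neg`. -/
lemma lt_of_inner_neg_neg {μ a b : ℝ} (hμ : 0 < μ) (ha : a < 0) (hb : b < 0)
    (h : ¬ AllDown (coefInner μ a b)) : a + b < -4 ∧ a < b := by
  have h0 : 0 < coefInner μ a b 0 := by
    simp [coefInner]
    nlinarith
  obtain ⟨h3, h2⟩ := (endPattern_coefInner hμ ha.ne hb.ne).coeff_signs h0 h
  simp [coefInner] at h2 h3
  refine ⟨by linarith, ?_⟩
  by_contra hab
  push Not at hab
  have : 0 ≤ μ * (a - b) := mul_nonneg hμ.le (by linarith)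
  linarith

lemma lt_of_middle_neg_neg {μ a b : ℝ} (hμ : 0 < μ) (ha : a < 0) (hb : b < 0)
    (h : ¬ AllDown (coefs μ (a, b) 2)) : -2 < a + b := by
  have hab : 0 < a * b := mul_pos_of_neg_of_neg ha hb
  have h0 : 0 < coefs μ (a, b) 2 0 := by
    simp [coefs, coefMiddle]
    have : 0 < (μ + 1) * (a * b) := by positivity
    linarith
  obtain ⟨h3, h2⟩ := (endPattern_coefs hμ (p := (a, b)) ha.ne hb.ne 2).coeff_signs h0 h
  simp [coefs, coefMiddle] at h2 h3
  have h3' : 0 < (3 * μ + 1) * a - μ * b + 1 := by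
    by_contra hc; nlinarith
  have h2' : μ * a - (3 * μ + 1) * b - 1 < 0 := by
    by_contra hc; nlinarith
  by_contra hc
  push Not at hc
  have : 0 ≤ (2 * μ) * (-2 - (a + b)) := mul_nonneg (by linarith) (by linarith)
  linarith

/-! ### The regions as sign cells -/

/-- The zero set with the additional pair of zeros in region `k + 1`. -/
def upTable : Fin 13 → Option (Fin 3) :=
  ![none, some 1, none, some 0, some 0, none, some 1, some 1, none, some 0, some 2, some 2, some 2]

/-- The parameters with signs `s` for which the interval `e` has an additional pair of zeros. -/
def cell (μ : ℝ) (s : SignType × SignType) (e : Option (Fin 3)) : Set (ℝ × ℝ) :=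
  {p | (SignType.sign p.1, SignType.sign p.2) = s ∧
    ∀ i, (e = some i → HasUp (coefs μ p i)) ∧ (e ≠ some i → AllDown (coefs μ p i))}

/-- Whether the number of zeros in the interval `i` is odd. -/
def oddEnd (s : SignType × SignType) : Fin 3 → Prop := ![s.1 = -1, s.2 = -1, s.1 * s.2 = 1]

instance (s : SignType × SignType) (i : Fin 3) : Decidable (oddEnd s i) := by
  unfold oddEnd
  exact match i with
  | 0 => inferInstanceAs (Decidable (s.1 = -1))
  | 1 => inferInstanceAs (Decidable (s.2 = -1))
  | 2 => inferInstanceAs (Decidable (s.1 * s.2 = 1))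

lemma coefs_zero_pos_iff {μ : ℝ} (hμ : 0 < μ) (p : ℝ × ℝ) (i : Fin 3) :
    0 < coefs μ p i 0 ↔ oddEnd (SignType.sign p.1, SignType.sign p.2) i := by
  fin_cases i
  · simp only [oddEnd, Fin.zero_eta, Matrix.cons_val_zero, sign_eq_neg_one_iff]
    simp [coefs, coefInner]
    constructor <;> intro h <;> nlinarith
  · simp only [oddEnd, Fin.mk_one, Matrix.cons_val_one, Matrix.cons_val_zero, sign_eq_neg_one_iff]
    simp [coefs, coefInner]
    constructor <;> intro h <;> nlinarith
  · simp only [oddEnd, Fin.reduceFinMk, Matrix.cons_val, ← sign_mul, sign_eq_one_iff]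
    simp [coefs, coefMiddle]
    constructor <;> intro h <;> nlinarith

lemma quadrantTable_ne (k : Fin 13) : (quadrantTable k).1 ≠ 0 ∧ (quadrantTable k).2 ≠ 0 := by
  revert k; decide

lemma table_injective : ∀ k k' : Fin 13, quadrantTable k = quadrantTable k' →
    upTable k = upTable k' → k = k' := by decide

lemma zerosTable_eq : ∀ (k : Fin 13) (i : Fin 3), zerosTable k i =
    if upTable k = some i then (if oddEnd (quadrantTable k) i then 3 else 2)
    else (if oddEnd (quadrantTable k) i then 1 else 0) := by decide

lemma cell_ne_zero {μ : ℝ} {k : Fin 13} {e : Option (Fin 3)} {p : ℝ × ℝ}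
    (hp : p ∈ cell μ (quadrantTable k) e) : p.1 ≠ 0 ∧ p.2 ≠ 0 := by
  have h := hp.1
  have hk := quadrantTable_ne k
  rw [← h] at hk
  simpa [sign_eq_zero_iff] using hk

lemma numRoots_cell {μ : ℝ} (hμ : 0 < μ) {k : Fin 13} {p : ℝ × ℝ}
    (hp : p ∈ cell μ (quadrantTable k) (upTable k)) (i : Fin 3) :
    numRoots ![μ, μ, 1] ![p.1, p.2, 1] i = zerosTable k i := by
  obtain ⟨h1, h2⟩ := cell_ne_zero hp
  rw [numRoots_eq_coefs hμ h1, zerosTable_eq]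
  have hE := endPattern_coefs hμ h1 h2 i
  have ho := coefs_zero_pos_iff hμ p i
  rw [hp.1] at ho
  by_cases hi : upTable k = some i
  · rw [if_pos hi, hE.encard_of_hasUp ((hp.2 i).1 hi)]
    simp only [ho]
    split_ifs <;> rfl
  · rw [if_neg hi, hE.encard_of_allDown ((hp.2 i).2 hi)]
    simp only [ho]
    split_ifs <;> rfl

lemma cell_subset {μ : ℝ} (hμ : 0 < μ) (k : Fin 13) :
    cell μ (quadrantTable k) (upTable k) ⊆ planeMinusCurves ![μ, μ, 1] := by
  intro p hp
  obtain ⟨h1, h2⟩ := cell_ne_zero hp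
  refine ⟨h1, h2, ?_⟩
  rw [mem_gammaCurve_iff hμ h1 h2]
  rintro ⟨i, hi⟩
  by_cases h : upTable k = some i
  · exact (endPattern_coefs hμ h1 h2 i).not_hasDouble ((hp.2 i).1 h) hi
  · exact ((hp.2 i).2 h).not_hasDouble hi

lemma cell_eq_of_mem {μ : ℝ} {k k' : Fin 13} {p : ℝ × ℝ}
    (hp : p ∈ cell μ (quadrantTable k) (upTable k))
    (hp' : p ∈ cell μ (quadrantTable k') (upTable k')) : k = k' := by
  refine table_injective k k' (hp.1.symm.trans hp'.1) ?_
  ext i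
  constructor
  · intro h
    by_contra h'
    exact ((hp'.2 i).2 h').not_hasUp ((hp.2 i).1 h)
  · intro h
    by_contra h'
    exact ((hp.2 i).2 h').not_hasUp ((hp'.2 i).1 h)

lemma mem_cell_none {μ : ℝ} {p : ℝ × ℝ} {s : SignType × SignType}
    (h : (SignType.sign p.1, SignType.sign p.2) = s) (h0 : AllDown (coefInner μ p.2 p.1))
    (h1 : AllDown (coefInner μ p.1 p.2)) (h2 : AllDown (coefs μ p 2)) : p ∈ cell μ s none := by
  refine ⟨h, fun i => ⟨nofun, fun _ => ?_⟩⟩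
  fin_cases i
  exacts [h0, h1, h2]

lemma mem_cell_zero {μ : ℝ} {p : ℝ × ℝ} {s : SignType × SignType}
    (h : (SignType.sign p.1, SignType.sign p.2) = s) (h0 : HasUp (coefInner μ p.2 p.1))
    (h1 : AllDown (coefInner μ p.1 p.2)) (h2 : AllDown (coefs μ p 2)) :
    p ∈ cell μ s (some 0) := by
  refine ⟨h, fun i => ?_⟩
  fin_cases i
  exacts [⟨fun _ => h0, fun h => absurd rfl h⟩, ⟨fun h => by simp at h, fun _ => h1⟩,
    ⟨fun h => by simp at h, fun _ => h2⟩]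

lemma mem_cell_one {μ : ℝ} {p : ℝ × ℝ} {s : SignType × SignType}
    (h : (SignType.sign p.1, SignType.sign p.2) = s) (h0 : AllDown (coefInner μ p.2 p.1))
    (h1 : HasUp (coefInner μ p.1 p.2)) (h2 : AllDown (coefs μ p 2)) : p ∈ cell μ s (some 1) := by
  refine ⟨h, fun i => ?_⟩
  fin_cases i
  exacts [⟨fun h => by simp at h, fun _ => h0⟩, ⟨fun _ => h1, fun h => absurd rfl h⟩,
    ⟨fun h => by simp at h, fun _ => h2⟩]

lemma mem_cell_two {μ : ℝ} {p : ℝ × ℝ} {s : SignType × SignType}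
    (h : (SignType.sign p.1, SignType.sign p.2) = s) (h0 : AllDown (coefInner μ p.2 p.1))
    (h1 : AllDown (coefInner μ p.1 p.2)) (h2 : HasUp (coefs μ p 2)) : p ∈ cell μ s (some 2) := by
  refine ⟨h, fun i => ?_⟩
  fin_cases i
  exacts [⟨fun h => by simp at h, fun _ => h0⟩, ⟨fun h => by simp at h, fun _ => h1⟩,
    ⟨fun _ => h2, fun h => absurd rfl h⟩]

/-! ### Reflection in the diagonal -/

lemma redFun_inv (μ a b : ℝ) {x : ℝ} (hx : x ≠ 0) :
    redFun μ b a x⁻¹ * x ^ 5 = -redFun μ a b x := by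
  simp only [redFun]
  field_simp
  ring

lemma redFun'_inv (μ a b : ℝ) {x : ℝ} (hx : x ≠ 0) :
    redFun' μ b a x⁻¹ * x ^ 5 = x ^ 2 * redFun' μ a b x - 5 * x * redFun μ a b x := by
  simp only [redFun, redFun']
  field_simp
  ring

/-- The map `x ↦ 1 / x` exchanges the parameters, but the normalizing factor changes from `-a` to
`-b`. If `ab > 0` an upward crossing goes to an upward one. If `ab < 0` its direction is reversed,
so a positive value is transported instead, which suffices by `hasUp_iff_even`. -/
lemma HasUp.middle_swap {μ a b : ℝ} (hμ : 0 < μ) (ha : a ≠ 0) (hb : b ≠ 0)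
    (h : HasUp (coefs μ (a, b) 2)) : HasUp (coefs μ (b, a) 2) := by
  rcases lt_or_gt_of_ne (mul_ne_zero ha hb) with hab | hab
  · have h0 : ∀ p : ℝ × ℝ, p.1 * p.2 < 0 → coefs μ p 2 0 < 0 := by
      intro p hp
      simp [coefs, coefMiddle]
      nlinarith
    rw [(endPattern_coefs hμ (p := (a, b)) ha hb 2).hasUp_iff_even (h0 _ hab)] at h
    rw [(endPattern_coefs hμ (p := (b, a)) hb ha 2).hasUp_iff_even (h0 _ (by simpa [mul_comm]))]
    obtain ⟨x, hx, hx0⟩ := h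
    refine ⟨x⁻¹, inv_pos.2 hx, ?_⟩
    rw [quin_middle] at hx0 ⊢
    simp only at hx0 ⊢
    have h1 := redFun_inv μ a b hx.ne'
    have hx5 : 0 < x ^ 5 := by positivity
    have h2 : (-b * redFun μ b a x⁻¹) * x ^ 5 = b * redFun μ a b x := by linear_combination -b * h1
    refine pos_of_mul_pos_left (b := x ^ 5) ?_ hx5.le
    rw [h2]
    by_contra hcon
    have e1 : b * redFun μ a b x ≤ 0 := not_lt.1 hcon
    have e2 : 0 ≤ (b * redFun μ a b x) * (-a * redFun μ a b x) := by
      have : 0 ≤ -(a * b) * (redFun μ a b x) ^ 2 := mul_nonneg (by linarith) (sq_nonneg _)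
      linarith
    have e3 : b * redFun μ a b x ≠ 0 := by
      intro h0
      rcases mul_eq_zero.1 h0 with h' | h'
      · exact hb h'
      · rw [h', mul_zero] at hx0; exact lt_irrefl _ hx0
    nlinarith [lt_of_le_of_ne e1 e3]
  · obtain ⟨x, hx, hx0, hx1⟩ := h
    rw [quin_middle] at hx0
    rw [dquin_middle] at hx1
    simp only at hx0 hx1
    have h0 : redFun μ a b x = 0 := (mul_eq_zero.1 hx0).resolve_left (neg_ne_zero.2 ha)
    have h1 := redFun_inv μ a b hx.ne'
    have h2 := redFun'_inv μ a b hx.ne'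
    rw [h0, neg_zero] at h1
    have hx5 : 0 < x ^ 5 := by positivity
    refine ⟨x⁻¹, inv_pos.2 hx, ?_, ?_⟩
    · rw [quin_middle, (mul_eq_zero.1 h1).resolve_right hx5.ne', mul_zero]
    · rw [dquin_middle]
      simp only
      refine pos_of_mul_pos_left (b := x ^ 5) ?_ hx5.le
      have e : (-b * redFun' μ b a x⁻¹) * x ^ 5 = x ^ 2 * (-b * redFun' μ a b x) := by
        rw [h0] at h2
        linear_combination -b * h2
      rw [e]
      refine mul_pos (by positivity) ?_
      have e2 : 0 < (a * b) * (-a * redFun' μ a b x) := mul_pos hab hx1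
      have e3 : (a * b) * (-a * redFun' μ a b x) = a ^ 2 * (-b * redFun' μ a b x) := by ring
      rw [e3] at e2
      exact pos_of_mul_pos_right e2 (sq_nonneg a)

lemma HasDouble.middle_swap {μ a b : ℝ} (ha : a ≠ 0) (h : HasDouble (coefs μ (a, b) 2)) :
    HasDouble (coefs μ (b, a) 2) := by
  obtain ⟨x, hx, hx0, hx1⟩ := h
  rw [quin_middle] at hx0
  rw [dquin_middle] at hx1
  have h0 : redFun μ a b x = 0 := (mul_eq_zero.1 hx0).resolve_left (neg_ne_zero.2 ha)
  have h0' : redFun' μ a b x = 0 := (mul_eq_zero.1 hx1).resolve_left (neg_ne_zero.2 ha)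
  have h1 := redFun_inv μ a b hx.ne'
  have h2 := redFun'_inv μ a b hx.ne'
  have hx5 : x ^ 5 ≠ 0 := by positivity
  rw [h0, neg_zero] at h1
  rw [h0, h0', mul_zero, mul_zero, sub_zero] at h2
  refine ⟨x⁻¹, inv_pos.2 hx, ?_, ?_⟩
  · rw [quin_middle, (mul_eq_zero.1 h1).resolve_right hx5, mul_zero]
  · rw [dquin_middle, (mul_eq_zero.1 h2).resolve_right hx5, mul_zero]

lemma AllDown.middle_swap {μ a b : ℝ} (hμ : 0 < μ) (ha : a ≠ 0) (hb : b ≠ 0)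
    (h : AllDown (coefs μ (a, b) 2)) : AllDown (coefs μ (b, a) 2) := by
  rcases hasUp_or_allDown_or_hasDouble (coefs μ (b, a) 2) with h1 | h1 | h1
  · exact absurd (h1.middle_swap hμ hb ha) h.not_hasUp
  · exact h1
  · exact absurd (h1.middle_swap hb) h.not_hasDouble

/-- Exchange of the first two intervals. -/
def swapIdx : Fin 3 → Fin 3 := ![1, 0, 2]

lemma swapIdx_swapIdx (i : Fin 3) : swapIdx (swapIdx i) = i := by revert i; decide

lemma swap_mem_cell {μ : ℝ} (hμ : 0 < μ) {s : SignType × SignType} {e : Option (Fin 3)}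
    {p : ℝ × ℝ} (h1 : p.1 ≠ 0) (h2 : p.2 ≠ 0) (hp : p ∈ cell μ s e) :
    p.swap ∈ cell μ s.swap (e.map swapIdx) := by
  obtain ⟨a, b⟩ := p
  refine ⟨?_, fun i => ?_⟩
  · rw [← hp.1]; rfl
  have hmap : e.map swapIdx = some i ↔ e = some (swapIdx i) := by
    cases e with
    | none => simp
    | some j =>
      simp only [Option.map_some, Option.some.injEq]
      constructor
      · rintro rfl; rw [swapIdx_swapIdx]
      · rintro rfl; rw [swapIdx_swapIdx]
  have hU : HasUp (coefs μ (a, b) (swapIdx i)) → HasUp (coefs μ (a, b).swap i) := by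
    fin_cases i
    · exact fun h => h
    · exact fun h => h
    · exact fun h => h.middle_swap hμ h1 h2
  have hD : AllDown (coefs μ (a, b) (swapIdx i)) → AllDown (coefs μ (a, b).swap i) := by
    fin_cases i
    · exact fun h => h
    · exact fun h => h
    · exact fun h => h.middle_swap hμ h1 h2
  exact ⟨fun h => hU ((hp.2 _).1 (hmap.1 h)), fun h => hD ((hp.2 _).2 fun h' => h (hmap.2 h'))⟩

/-! ### Every parameter off the curves lies in a cell -/

lemma exists_cell {μ : ℝ} (hμ : 0 < μ) {p : ℝ × ℝ} (hp : p ∈ planeMinusCurves ![μ, μ, 1]) :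
    ∃ k, p ∈ cell μ (quadrantTable k) (upTable k) := by
  obtain ⟨h1, h2, h3⟩ := hp
  rw [mem_gammaCurve_iff hμ h1 h2] at h3
  push Not at h3
  have hor : ∀ i, HasUp (coefs μ p i) ∨ AllDown (coefs μ p i) := fun i => by
    rcases hasUp_or_allDown_or_hasDouble (coefs μ p i) with h | h | h
    · exact Or.inl h
    · exact Or.inr h
    · exact absurd h (h3 i)
  have c0 : HasUp (coefInner μ p.2 p.1) ∨ AllDown (coefInner μ p.2 p.1) := hor 0
  have c1 : HasUp (coefInner μ p.1 p.2) ∨ AllDown (coefInner μ p.1 p.2) := hor 1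
  have c2 : HasUp (coefs μ p 2) ∨ AllDown (coefs μ p 2) := hor 2
  have nd : ∀ {c}, HasUp c → ¬ AllDown c := fun h h' => h'.not_hasUp h
  obtain ⟨a, b⟩ := p
  simp only at h1 h2 c0 c1 c2
  rcases lt_or_gt_of_ne h1 with ha | ha <;> rcases lt_or_gt_of_ne h2 with hb | hb
  · have hs : (SignType.sign a, SignType.sign b) = (-1, -1) := by rw [sign_neg ha, sign_neg hb]
    rcases c0 with c0 | c0
    · have e0 := lt_of_inner_neg_neg hμ hb ha (nd c0)
      rcases c1 with c1 | c1
      · linarith [(lt_of_inner_neg_neg hμ ha hb (nd c1)).2]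
      rcases c2 with c2 | c2
      · linarith [lt_of_middle_neg_neg hμ ha hb (nd c2)]
      exact ⟨4, mem_cell_zero hs c0 c1 c2⟩
    rcases c1 with c1 | c1
    · have e1 := lt_of_inner_neg_neg hμ ha hb (nd c1)
      rcases c2 with c2 | c2
      · linarith [lt_of_middle_neg_neg hμ ha hb (nd c2)]
      exact ⟨6, mem_cell_one hs c0 c1 c2⟩
    rcases c2 with c2 | c2
    · exact ⟨12, mem_cell_two hs c0 c1 c2⟩
    · exact ⟨5, mem_cell_none hs c0 c1 c2⟩
  · have hs : (SignType.sign a, SignType.sign b) = (-1, 1) := by rw [sign_neg ha, sign_pos hb]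
    have c0 := allDown_inner_of_pos_neg hμ hb ha
    rcases c1 with c1 | c1
    · rcases c2 with c2 | c2
      · linarith [lt_neg_one_of_inner hμ ha hb (nd c1), neg_one_lt_of_middle hμ ha hb (nd c2)]
      · exact ⟨7, mem_cell_one hs c0 c1 c2⟩
    · rcases c2 with c2 | c2
      · exact ⟨10, mem_cell_two hs c0 c1 c2⟩
      · exact ⟨8, mem_cell_none hs c0 c1 c2⟩
  · have hs : (SignType.sign a, SignType.sign b) = (1, -1) := by rw [sign_pos ha, sign_neg hb]
    have c1 := allDown_inner_of_pos_neg hμ ha hb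
    rcases c0 with c0 | c0
    · rcases c2 with c2 | c2
      · linarith [lt_neg_one_of_inner hμ hb ha (nd c0),
          neg_one_lt_of_middle hμ hb ha (nd (c2.middle_swap hμ h1 h2))]
      · exact ⟨3, mem_cell_zero hs c0 c1 c2⟩
    · rcases c2 with c2 | c2
      · exact ⟨11, mem_cell_two hs c0 c1 c2⟩
      · exact ⟨2, mem_cell_none hs c0 c1 c2⟩
  · have hs : (SignType.sign a, SignType.sign b) = (1, 1) := by rw [sign_pos ha, sign_pos hb]
    have c2 := allDown_middle_of_pos_pos hμ ha hb
    rcases c0 with c0 | c0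
    · have e0 := lt_of_inner_pos_pos hμ hb ha (nd c0)
      rcases c1 with c1 | c1
      · linarith [lt_of_inner_pos_pos hμ ha hb (nd c1)]
      exact ⟨9, mem_cell_zero hs c0 c1 c2⟩
    · rcases c1 with c1 | c1
      · exact ⟨1, mem_cell_one hs c0 c1 c2⟩
      · exact ⟨0, mem_cell_none hs c0 c1 c2⟩

/-! ### Openness of the cells -/

lemma continuous_coefs (μ : ℝ) (i : Fin 3) : Continuous fun p : ℝ × ℝ => coefs μ p i := by
  refine continuous_pi fun j => ?_
  fin_cases i <;> fin_cases j <;> simp [coefs, coefInner, coefMiddle] <;> fun_prop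

lemma isOpen_sign (s : SignType) (hs : s ≠ 0) : IsOpen {x : ℝ | SignType.sign x = s} := by
  rcases s with _ | _ | _
  · exact absurd rfl hs
  · convert isOpen_Iio (a := (0 : ℝ)) using 1
    ext x; exact sign_eq_neg_one_iff
  · convert isOpen_Ioi (a := (0 : ℝ)) using 1
    ext x; exact sign_eq_one_iff

lemma isOpen_cell {μ : ℝ} (hμ : 0 < μ) {s : SignType × SignType} (h1 : s.1 ≠ 0) (h2 : s.2 ≠ 0)
    (e : Option (Fin 3)) : IsOpen (cell μ s e) := by
  have h : cell μ s e = ({p : ℝ × ℝ | SignType.sign p.1 = s.1} ∩ {p | SignType.sign p.2 = s.2}) ∩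
      ⋂ i, {p | (e = some i → coefs μ p i ∈ {c : Fin 6 → ℝ | HasUp c}) ∧
        (e ≠ some i → coefs μ p i ∈ {c : Fin 6 → ℝ | (c 0 ≠ 0 ∧ c 5 ≠ 0) ∧ AllDown c})} := by
    ext p
    simp only [cell, Set.mem_ofPred_eq, Set.mem_inter_iff, Set.mem_iInter, Prod.ext_iff]
    refine and_congr_right fun hp => forall_congr' fun i => and_congr_right fun _ =>
      imp_congr_right fun _ => ?_
    have hE := endPattern_coefs hμ (p := p) (by rw [← sign_ne_zero, hp.1]; exact h1)
      (by rw [← sign_ne_zero, hp.2]; exact h2) i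
    exact ⟨fun h => ⟨⟨hE.zero_ne, hE.five.ne⟩, h⟩, fun h => h.2⟩
  rw [h]
  refine (((isOpen_sign _ h1).preimage continuous_fst).inter
    ((isOpen_sign _ h2).preimage continuous_snd)).inter (isOpen_iInter_of_finite fun i => ?_)
  by_cases he : e = some i
  · simp only [he, forall_const, ne_eq, not_true_eq_false, false_imp_iff, and_true]
    exact isOpen_hasUp.preimage (continuous_coefs μ i)
  · simp only [he, ne_eq, not_false_eq_true, forall_const, false_imp_iff, true_and]
    exact isOpen_allDown.preimage (continuous_coefs μ i)

/-! ### Connectedness of the cells -/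

/-- Projections of open sets are open, so those of the two parts of a separation overlap in the
connected base. The fibre over a common point then meets both parts, and connectedness of the fibre
gives a common point. -/
lemma IsOpen.isPreconnected_of_fibers {U : Set (ℝ × ℝ)} (hU : IsOpen U)
    (hf : ∀ x, IsPreconnected {y | (x, y) ∈ U}) (hp : IsPreconnected (Prod.fst '' U)) :
    IsPreconnected U := by
  rintro V W hV hW hUVW ⟨p, hpU, hpV⟩ ⟨q, hqU, hqW⟩
  have hsub : Prod.fst '' U ⊆ Prod.fst '' (U ∩ V) ∪ Prod.fst '' (U ∩ W) := by
    rintro _ ⟨r, hr, rfl⟩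
    rcases hUVW hr with h | h
    · exact Or.inl ⟨r, ⟨hr, h⟩, rfl⟩
    · exact Or.inr ⟨r, ⟨hr, h⟩, rfl⟩
  obtain ⟨t, -, ⟨⟨t1, y1⟩, ⟨h1, h1'⟩, e1⟩, ⟨⟨t2, y2⟩, ⟨h2, h2'⟩, e2⟩⟩ := hp _ _
    (isOpenMap_fst _ (hU.inter hV)) (isOpenMap_fst _ (hU.inter hW)) hsub
    ⟨p.1, ⟨p, hpU, rfl⟩, ⟨p, ⟨hpU, hpV⟩, rfl⟩⟩ ⟨q.1, ⟨q, hqU, rfl⟩, ⟨q, ⟨hqU, hqW⟩, rfl⟩⟩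
  simp only at e1 e2
  subst e1 e2
  obtain ⟨y, hy, hyV, hyW⟩ := hf t2 ((fun y => (t2, y)) ⁻¹' V) ((fun y => (t2, y)) ⁻¹' W)
    (hV.preimage (by fun_prop)) (hW.preimage (by fun_prop)) (fun y hy => hUVW hy)
    ⟨y1, h1, h1'⟩ ⟨y2, h2, h2'⟩
  exact ⟨(t2, y), hy, hyV, hyW⟩

lemma coefInner_zero_neg {μ a b : ℝ} (hμ : 0 < μ) (hb : 0 < b) : coefInner μ a b 0 < 0 := by
  simp [coefInner]
  nlinarith

lemma quin_coefInner_zero_neg {μ b x : ℝ} (hμ : 0 < μ) (hb : 0 < b) (hx : 0 < x) :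
    quin (coefInner μ 0 b) x < 0 := by
  rw [quin_coefInner]
  have h1 : 0 < b * ((1 + x) ^ 2 * (μ + 1 + x)) := by positivity
  have h2 : 0 < x ^ 2 * (1 + 2 * x) * (1 + x) ^ 2 := by positivity
  linarith

lemma quin_coefInner_smul (μ a b θ x : ℝ) : quin (coefInner μ (θ * a) b) x =
    θ * quin (coefInner μ a b) x + (1 - θ) * quin (coefInner μ 0 b) x := by
  simp only [quin_coefInner]
  ring

lemma AllDown.inner_of_le {μ a b b' : ℝ} (hμ : 0 < μ) (hb : 0 < b) (hbb : b ≤ b')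
    (h : AllDown (coefInner μ a b)) : AllDown (coefInner μ a b') := by
  refine allDown_of_neg fun x hx => ?_
  have h1 := h.neg_of_even (coefInner_zero_neg hμ hb) hx
  rw [quin_coefInner] at h1 ⊢
  have : 0 ≤ (b' - b) * ((1 + x) ^ 2 * (μ + 1 + x)) := mul_nonneg (by linarith) (by positivity)
  linarith

lemma HasUp.inner_of_le {μ a b b' : ℝ} (hμ : 0 < μ) (ha : a ≠ 0) (hb : 0 < b) (hbb : b ≤ b')
    (h : HasUp (coefInner μ a b')) : HasUp (coefInner μ a b) := by
  rw [(endPattern_coefInner hμ ha (hb.trans_le hbb).ne').hasUp_iff_even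
    (coefInner_zero_neg hμ (hb.trans_le hbb))] at h
  rw [(endPattern_coefInner hμ ha hb.ne').hasUp_iff_even (coefInner_zero_neg hμ hb)]
  obtain ⟨x, hx, h1⟩ := h
  refine ⟨x, hx, ?_⟩
  rw [quin_coefInner] at h1 ⊢
  have : 0 ≤ (b' - b) * ((1 + x) ^ 2 * (μ + 1 + x)) := mul_nonneg (by linarith) (by positivity)
  linarith

/-- The quintic is affine in `a` and negative at `a = 0`, so scaling `a` towards `0` preserves
negativity. The same convexity gives `HasUp.inner_smul` in the opposite direction. -/
lemma AllDown.inner_smul {μ a b θ : ℝ} (hμ : 0 < μ) (hb : 0 < b) (h0 : 0 ≤ θ) (h1 : θ ≤ 1)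
    (h : AllDown (coefInner μ a b)) : AllDown (coefInner μ (θ * a) b) := by
  refine allDown_of_neg fun x hx => ?_
  have e1 := h.neg_of_even (coefInner_zero_neg hμ hb) hx
  have e2 := quin_coefInner_zero_neg hμ hb hx
  rw [quin_coefInner_smul]
  rcases h0.eq_or_lt with rfl | h0
  · simpa using e2
  · linarith [mul_neg_of_pos_of_neg h0 e1, mul_nonneg (sub_nonneg.2 h1) (neg_nonneg.2 e2.le)]

lemma HasUp.inner_smul {μ a b θ : ℝ} (hμ : 0 < μ) (ha : a ≠ 0) (hb : 0 < b) (h0 : 0 < θ)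
    (h1 : θ ≤ 1) (h : HasUp (coefInner μ (θ * a) b)) : HasUp (coefInner μ a b) := by
  rw [(endPattern_coefInner hμ (mul_ne_zero h0.ne' ha) hb.ne').hasUp_iff_even
    (coefInner_zero_neg hμ hb)] at h
  rw [(endPattern_coefInner hμ ha hb.ne').hasUp_iff_even (coefInner_zero_neg hμ hb)]
  obtain ⟨x, hx, e1⟩ := h
  refine ⟨x, hx, ?_⟩
  have e2 := quin_coefInner_zero_neg hμ hb hx
  rw [quin_coefInner_smul] at e1
  by_contra hcon
  nlinarith

lemma mem_cell_none_iff {μ : ℝ} {p : ℝ × ℝ} {s : SignType × SignType} : p ∈ cell μ s none ↔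
    (SignType.sign p.1, SignType.sign p.2) = s ∧ AllDown (coefInner μ p.2 p.1) ∧
      AllDown (coefInner μ p.1 p.2) ∧ AllDown (coefs μ p 2) :=
  ⟨fun h => ⟨h.1, (h.2 0).2 nofun, (h.2 1).2 nofun, (h.2 2).2 nofun⟩,
    fun h => mem_cell_none h.1 h.2.1 h.2.2.1 h.2.2.2⟩

lemma sign_pair_eq_iff {a b : ℝ} {s t : SignType} :
    (SignType.sign a, SignType.sign b) = (s, t) ↔ SignType.sign a = s ∧ SignType.sign b = t :=
  Prod.ext_iff

/-- For fixed `a`, the condition on `I₂` is preserved by increasing `b` and the one on `I₁` by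
decreasing it, so fibres are intervals. The diagonal lies in the cell, so the projection is the
whole half line. -/
lemma isPreconnected_cell_pos_pos_none {μ : ℝ} (hμ : 0 < μ) :
    IsPreconnected (cell μ (1, 1) none) := by
  refine (isOpen_cell hμ (by decide) (by decide) _).isPreconnected_of_fibers (fun a => ?_) ?_
  · refine Set.OrdConnected.isPreconnected ⟨fun b₁ h₁ b₂ h₂ b hb => ?_⟩
    simp only [Set.mem_ofPred_eq, mem_cell_none_iff, sign_pair_eq_iff, sign_eq_one_iff]
      at h₁ h₂ ⊢
    obtain ⟨⟨ha, hb₁⟩, -, h₁, -⟩ := h₁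
    obtain ⟨⟨-, hb₂⟩, h₂, -, -⟩ := h₂
    have hb0 : 0 < b := hb₁.trans_le hb.1
    refine ⟨⟨ha, hb0⟩, ?_, h₁.inner_of_le hμ hb₁ hb.1, allDown_middle_of_pos_pos hμ ha hb0⟩
    have := h₂.inner_smul (θ := b / b₂) hμ ha (by positivity) (div_le_one_of_le₀ hb.2 hb₂.le)
    rwa [div_mul_cancel₀ _ hb₂.ne'] at this
  · have : Prod.fst '' cell μ (1, 1) none = Set.Ioi 0 := by
      ext a
      constructor
      · rintro ⟨p, hp, rfl⟩
        exact sign_eq_one_iff.1 (sign_pair_eq_iff.1 hp.1).1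
      · intro ha
        have ha : 0 < a := ha
        have h : AllDown (coefInner μ a a) := by
          by_contra h
          exact lt_irrefl _ (lt_of_inner_pos_pos hμ ha ha h)
        exact ⟨(a, a), mem_cell_none (by simp [sign_pos ha]) h h
          (allDown_middle_of_pos_pos hμ ha ha), rfl⟩
    rw [this]
    exact isPreconnected_Ioi

lemma mem_cell_one_iff_of_pos {μ : ℝ} (hμ : 0 < μ) {s : SignType} (hs : s ≠ 0) {p : ℝ × ℝ} :
    p ∈ cell μ (s, 1) (some 1) ↔ SignType.sign p.1 = s ∧ 0 < p.2 ∧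
      HasUp (coefInner μ p.1 p.2) := by
  obtain ⟨a, b⟩ := p
  constructor
  · intro h
    have h1 := sign_pair_eq_iff.1 h.1
    exact ⟨h1.1, sign_eq_one_iff.1 h1.2, (h.2 1).1 rfl⟩
  · rintro ⟨h1, h2, h3⟩
    simp only at h1 h2 h3
    have hn : ¬ AllDown (coefInner μ a b) := fun h => h.not_hasUp h3
    have hsgn : (SignType.sign a, SignType.sign b) = (s, 1) := by rw [h1, sign_pos h2]
    rcases s with _ | _ | _
    · exact absurd rfl hs
    · have ha : a < 0 := sign_eq_neg_one_iff.1 h1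
      refine mem_cell_one hsgn (allDown_inner_of_pos_neg hμ h2 ha) h3 ?_
      by_contra hm
      linarith [lt_neg_one_of_inner hμ ha h2 hn, neg_one_lt_of_middle hμ ha h2 hm]
    · have ha : 0 < a := sign_eq_one_iff.1 h1
      refine mem_cell_one hsgn ?_ h3 (allDown_middle_of_pos_pos hμ ha h2)
      by_contra hm
      linarith [lt_of_inner_pos_pos hμ ha h2 hn, lt_of_inner_pos_pos hμ h2 ha hm]

/-- A positive value persists when `b > 0` decreases and when `|a|` grows, so fibres and projection
are intervals. -/
lemma isPreconnected_cell_one_of_pos {μ : ℝ} (hμ : 0 < μ) {s : SignType} (hs : s ≠ 0) :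
    IsPreconnected (cell μ (s, 1) (some 1)) := by
  refine (isOpen_cell hμ hs one_ne_zero _).isPreconnected_of_fibers (fun a => ?_) ?_
  · refine Set.OrdConnected.isPreconnected ⟨fun b₁ h₁ b₂ h₂ b hb => ?_⟩
    simp only [Set.mem_ofPred_eq, mem_cell_one_iff_of_pos hμ hs] at h₁ h₂ ⊢
    have hb0 : 0 < b := h₁.2.1.trans_le hb.1
    exact ⟨h₁.1, hb0, h₂.2.2.inner_of_le hμ (by rw [← sign_ne_zero, h₁.1]; exact hs) hb0 hb.2⟩
  · refine Set.OrdConnected.isPreconnected ⟨?_⟩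
    rintro _ ⟨⟨a₁, b₁⟩, h₁, rfl⟩ _ ⟨⟨a₂, b₂⟩, h₂, rfl⟩ a ha
    rw [mem_cell_one_iff_of_pos hμ hs] at h₁ h₂
    simp only at h₁ h₂ ha
    rcases s with _ | _ | _
    · exact absurd rfl hs
    · have hn : a₂ < 0 := sign_eq_neg_one_iff.1 h₂.1
      have ha0 : a < 0 := ha.2.trans_lt hn
      refine ⟨(a, b₂), (mem_cell_one_iff_of_pos hμ hs).2 ⟨sign_neg ha0, h₂.2.1, ?_⟩, rfl⟩
      refine HasUp.inner_smul (θ := a₂ / a) hμ ha0.ne h₂.2.1 (div_pos_of_neg_of_neg hn ha0) ?_ ?_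
      · rw [div_le_one_of_neg ha0]; exact ha.2
      · rw [div_mul_cancel₀ _ ha0.ne]; exact h₂.2.2
    · have hn : 0 < a₁ := sign_eq_one_iff.1 h₁.1
      have ha0 : 0 < a := hn.trans_le ha.1
      refine ⟨(a, b₁), (mem_cell_one_iff_of_pos hμ hs).2 ⟨sign_pos ha0, h₁.2.1, ?_⟩, rfl⟩
      refine HasUp.inner_smul (θ := a₁ / a) hμ ha0.ne' h₁.2.1 (div_pos hn ha0) ?_ ?_
      · rw [div_le_one ha0]; exact ha.1
      · rw [div_mul_cancel₀ _ ha0.ne']; exact h₁.2.2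

lemma middle_zero_neg {μ a b : ℝ} (hμ : 0 < μ) (ha : a < 0) (hb : 0 < b) :
    coefs μ (a, b) 2 0 < 0 := by
  simp [coefs, coefMiddle]
  have : 0 < (μ + 1) * (-a * b) := mul_pos (by linarith) (mul_pos (by linarith) hb)
  linarith

lemma hasUp_middle_iff {μ a b : ℝ} (hμ : 0 < μ) (ha : a < 0) (hb : 0 < b) :
    HasUp (coefs μ (a, b) 2) ↔ ∃ x, 0 < x ∧ 0 < redFun μ a b x := by
  rw [(endPattern_coefs hμ (p := (a, b)) ha.ne hb.ne' 2).hasUp_iff_even (middle_zero_neg hμ ha hb)]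
  refine exists_congr fun x => and_congr_right fun _ => ?_
  rw [quin_middle]
  exact mul_pos_iff_of_pos_left (neg_pos.2 ha)

lemma allDown_middle_iff {μ a b : ℝ} (hμ : 0 < μ) (ha : a < 0) (hb : 0 < b) :
    AllDown (coefs μ (a, b) 2) ↔ ∀ x, 0 < x → redFun μ a b x < 0 := by
  constructor
  · intro h x hx
    have := h.neg_of_even (middle_zero_neg hμ ha hb) hx
    rw [quin_middle] at this
    by_contra hcon
    have h2 : 0 ≤ -a * redFun μ a b x := mul_nonneg (by linarith) (not_lt.1 hcon)
    exact absurd this (not_lt.2 h2)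
  · intro h
    refine allDown_of_neg fun x hx => ?_
    rw [quin_middle]
    exact mul_neg_of_pos_of_neg (neg_pos.2 ha) (h x hx)

lemma redFun_le {μ a b a' b' x : ℝ} (hμ : 0 < μ) (hx : 0 < x) (ha : a ≤ a') (hb : b' ≤ b) :
    redFun μ a b x ≤ redFun μ a' b' x := by
  simp only [redFun]
  have e1 : 0 ≤ (a' - a) * (x ^ 2 * (1 + x) ^ 2 * (μ + (μ + 1) * x)) :=
    mul_nonneg (by linarith) (by positivity)
  have e2 : 0 ≤ (b - b') * ((1 + x) ^ 2 * (μ + 1 + μ * x)) :=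
    mul_nonneg (by linarith) (by positivity)
  linarith

lemma mem_cell_neg_pos_two_iff {μ : ℝ} (hμ : 0 < μ) {p : ℝ × ℝ} :
    p ∈ cell μ (-1, 1) (some 2) ↔ p.1 < 0 ∧ 0 < p.2 ∧ ∃ x, 0 < x ∧ 0 < redFun μ p.1 p.2 x := by
  obtain ⟨a, b⟩ := p
  constructor
  · intro h
    have h1 := sign_pair_eq_iff.1 h.1
    have ha := sign_eq_neg_one_iff.1 h1.1
    have hb := sign_eq_one_iff.1 h1.2
    exact ⟨ha, hb, (hasUp_middle_iff hμ ha hb).1 ((h.2 2).1 rfl)⟩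
  · rintro ⟨ha, hb, h⟩
    have h := (hasUp_middle_iff hμ ha hb).2 h
    refine mem_cell_two (by rw [sign_neg ha, sign_pos hb]) (allDown_inner_of_pos_neg hμ hb ha) ?_ h
    by_contra hm
    linarith [lt_neg_one_of_inner hμ ha hb hm,
      neg_one_lt_of_middle hμ ha hb fun h' => h'.not_hasUp h]

lemma isPreconnected_cell_neg_pos_two {μ : ℝ} (hμ : 0 < μ) :
    IsPreconnected (cell μ (-1, 1) (some 2)) := by
  refine (isOpen_cell hμ (by decide) (by decide) _).isPreconnected_of_fibers (fun a => ?_) ?_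
  · refine Set.OrdConnected.isPreconnected ⟨fun b₁ h₁ b₂ h₂ b hb => ?_⟩
    simp only [Set.mem_ofPred_eq, mem_cell_neg_pos_two_iff hμ] at h₁ h₂ ⊢
    obtain ⟨x, hx, hx0⟩ := h₂.2.2
    exact ⟨h₁.1, h₁.2.1.trans_le hb.1, x, hx, hx0.trans_le (redFun_le hμ hx le_rfl hb.2)⟩
  · refine Set.OrdConnected.isPreconnected ⟨?_⟩
    rintro a₁ ⟨⟨_, b₁⟩, h₁, rfl⟩ a₂ ⟨⟨_, b₂⟩, h₂, rfl⟩ a ha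
    rw [mem_cell_neg_pos_two_iff hμ] at h₁ h₂
    obtain ⟨x, hx, hx0⟩ := h₁.2.2
    exact ⟨(a, b₁), (mem_cell_neg_pos_two_iff hμ).2 ⟨ha.2.trans_lt h₂.1, h₁.2.1, x, hx,
      hx0.trans_le (redFun_le hμ hx ha.1 le_rfl)⟩, rfl⟩

/-- A crude sufficient condition: each nonnegative part of either equation is absorbed by a term
with factor `b`. It shows that every `a < 0` occurs in the projection of the cell. -/
lemma mem_cell_neg_pos_none {μ a b : ℝ} (hμ : 0 < μ) (ha : a < 0) (hb : -a ≤ b)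
    (hb' : 1 ≤ b * μ) : (a, b) ∈ cell μ (-1, 1) none := by
  have hb0 : 0 < b := by linarith
  refine mem_cell_none (by simp [sign_neg ha, sign_pos hb0]) (allDown_inner_of_pos_neg hμ hb0 ha)
    (allDown_of_neg fun x hx => ?_) ((allDown_middle_iff hμ ha hb0).2 fun x hx => ?_)
  · rw [quin_coefInner]
    simp only
    have e1 : 0 ≤ (-a) * (x ^ 2 * μ) := mul_nonneg (by linarith) (by positivity)
    have e2 : 0 ≤ (b + a) * x ^ 3 := mul_nonneg (by linarith) (by positivity)
    have e3 : 0 < b * ((1 + x) ^ 2 * (μ + 1) + (x + 2 * x ^ 2)) := by positivity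
    have e4 : 0 < x ^ 2 * (1 + 2 * x) * (1 + x) ^ 2 := by positivity
    linarith
  · simp only [redFun]
    have e1 : 0 ≤ (-a) * (x ^ 2 * (1 + x) ^ 2 * (μ + (μ + 1) * x)) :=
      mul_nonneg (by linarith) (by positivity)
    have e2 : 0 ≤ (b * μ - 1) * x ^ 3 := mul_nonneg (by linarith) (by positivity)
    have e3 : 0 < b * ((1 + x) ^ 2 * (μ + 1) + μ * (x + 2 * x ^ 2)) := by positivity
    have e4 : 0 < x ^ 2 := by positivity
    linarith

lemma isPreconnected_cell_neg_pos_none {μ : ℝ} (hμ : 0 < μ) :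
    IsPreconnected (cell μ (-1, 1) none) := by
  refine (isOpen_cell hμ (by decide) (by decide) _).isPreconnected_of_fibers (fun a => ?_) ?_
  · refine Set.OrdConnected.isPreconnected ⟨fun b₁ h₁ b₂ h₂ b hb => ?_⟩
    simp only [Set.mem_ofPred_eq, mem_cell_none_iff, sign_pair_eq_iff, sign_eq_one_iff,
      sign_eq_neg_one_iff] at h₁ h₂ ⊢
    obtain ⟨⟨ha, hb₁⟩, -, h1, h2⟩ := h₁
    have hb0 : 0 < b := hb₁.trans_le hb.1
    refine ⟨⟨ha, hb0⟩, allDown_inner_of_pos_neg hμ hb0 ha, h1.inner_of_le hμ hb₁ hb.1, ?_⟩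
    rw [allDown_middle_iff hμ ha hb₁] at h2
    rw [allDown_middle_iff hμ ha hb0]
    exact fun x hx => (redFun_le hμ hx le_rfl hb.1).trans_lt (h2 x hx)
  · have : Prod.fst '' cell μ (-1, 1) none = Set.Iio 0 := by
      ext a
      constructor
      · rintro ⟨p, hp, rfl⟩
        exact sign_eq_neg_one_iff.1 (sign_pair_eq_iff.1 hp.1).1
      · intro ha
        have ha : a < 0 := ha
        have h1 : 0 < 1 / μ := by positivity
        refine ⟨(a, -a + 1 / μ), mem_cell_neg_pos_none hμ ha (by linarith) ?_, rfl⟩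
        have : (-a + 1 / μ) * μ = -a * μ + 1 := by field_simp
        rw [this]
        nlinarith
    rw [this]
    exact isPreconnected_Iio

/-! ### The cells with three zeros in an interval -/

/-- The sign of the derivative of the level function on `I₂`. -/
def innerSlope (μ a x : ℝ) : ℝ :=
  a * (2 * μ * (μ + 1) - (2 * μ + 3) * (x + x ^ 2)) -
    (1 + x) ^ 3 * (2 * (μ + 1) + (6 * μ + 7) * x + 4 * x ^ 2)

/-- The quintic equals `(1 + x)² (μ + 1 + x)` times the difference of a level function of `(a, x)`
and `b`. Hence at a zero its slope has the sign of the derivative of the level function, which does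
not involve `b`. The analogue on `I₃` is `redFun'_mul`. -/
lemma dquin_coefInner (μ a b x : ℝ) :
    dquin (coefInner μ a b) x * ((1 + x) * (μ + 1 + x)) =
      (2 * (μ + 1 + x) + (1 + x)) * quin (coefInner μ a b) x + x * innerSlope μ a x := by
  simp [dquin, quin, coefInner, innerSlope]
  ring

/-- The sign of the derivative of the level function on `I₃`. -/
def middleSlope (μ a x : ℝ) : ℝ :=
  a * ((2 * μ * (μ + 1) * (1 + x ^ 2) + (4 * μ ^ 2 + 6 * μ + 3) * x) * (1 + x) ^ 3) +
    ((4 * μ + 1) * x ^ 2 + (2 * μ + 3) * x - 2 * (μ + 1))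

lemma redFun'_mul (μ a b x : ℝ) : redFun' μ a b x * ((1 + x) * (μ + 1 + μ * x)) =
    (2 * (μ + 1 + μ * x) + μ * (1 + x)) * redFun μ a b x + x * middleSlope μ a x := by
  simp only [redFun, redFun', middleSlope]
  ring

lemma affine_pos {s t a a₁ a₂ : ℝ} (h1 : 0 < a₁ * s + t) (h2 : 0 < a₂ * s + t)
    (ha1 : a₁ ≤ a) (ha2 : a ≤ a₂) : 0 < a * s + t := by
  rcases le_total 0 s with hs | hs <;> nlinarith

lemma dquin_pos_iff_innerSlope {μ a b x : ℝ} (hμ : 0 < μ) (hx : 0 < x)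
    (h : quin (coefInner μ a b) x = 0) :
    0 < dquin (coefInner μ a b) x ↔ 0 < innerSlope μ a x := by
  have h1 := dquin_coefInner μ a b x
  rw [h, mul_zero, zero_add] at h1
  have h2 : 0 < (1 + x) * (μ + 1 + x) := by positivity
  rw [← mul_pos_iff_of_pos_right h2, h1, mul_pos_iff_of_pos_left hx]

lemma dquin_neg_iff_innerSlope {μ a b x : ℝ} (hμ : 0 < μ) (hx : 0 < x)
    (h : quin (coefInner μ a b) x = 0) :
    dquin (coefInner μ a b) x < 0 ↔ innerSlope μ a x < 0 := by
  have h1 := dquin_coefInner μ a b x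
  rw [h, mul_zero, zero_add] at h1
  have h2 : 0 < (1 + x) * (μ + 1 + x) := by positivity
  constructor
  · intro h3
    by_contra h4
    nlinarith [mul_neg_of_neg_of_pos h3 h2, mul_nonneg hx.le (not_lt.1 h4)]
  · intro h3
    by_contra h4
    nlinarith [mul_neg_of_pos_of_neg hx h3, mul_nonneg (not_lt.1 h4) h2.le]

/-- The parameter domain of the cell with three zeros in `I₂`: a zero and the first parameter. -/
def innerDomain (μ : ℝ) : Set (ℝ × ℝ) :=
  {q | 0 < q.1 ∧ q.2 < 0 ∧ 0 < innerSlope μ q.2 q.1 ∧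
    q.2 * (μ - q.1) - (1 + 2 * q.1) * (1 + q.1) ^ 2 < 0}

lemma isOpen_innerDomain (μ : ℝ) : IsOpen (innerDomain μ) := by
  refine (isOpen_lt continuous_const continuous_fst).and
    ((isOpen_lt continuous_snd continuous_const).and
    ((isOpen_lt continuous_const ?_).and (isOpen_lt ?_ continuous_const)))
  · unfold innerSlope; fun_prop
  · fun_prop

/-- Elimination of `a`: one condition bounds `-a` from below; the other bounds it from above if `x >
μ` and holds automatically if `x ≤ μ`. Both can be met exactly under the stated inequalities in `x`.
-/
lemma fst_image_innerDomain {μ : ℝ} (hμ : 0 < μ) : Prod.fst '' innerDomain μ =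
    {x | 0 < x ∧ 2 * μ * (μ + 1) < (2 * μ + 3) * (x + x ^ 2) ∧
      x * (4 * x - (6 * μ - 1)) < 4 * μ + 1} := by
  ext x
  constructor
  · rintro ⟨⟨x, a⟩, ⟨hx, ha, h1, h2⟩, rfl⟩
    simp only at hx ha h1 h2 ⊢
    unfold innerSlope at h1
    have hC : 0 < (1 + x) ^ 3 * (2 * (μ + 1) + (6 * μ + 7) * x + 4 * x ^ 2) := by positivity
    have hD : 2 * μ * (μ + 1) < (2 * μ + 3) * (x + x ^ 2) := by
      by_contra hc
      nlinarith
    refine ⟨hx, hD, ?_⟩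
    rcases le_or_gt x μ with hxm | hxm
    · nlinarith
    · have e1 : 0 < (x - μ) := by linarith
      have e2 : 0 < (2 * μ + 3) * (x + x ^ 2) - 2 * μ * (μ + 1) := by linarith
      have e3 : (1 + x) ^ 3 * (2 * (μ + 1) + (6 * μ + 7) * x + 4 * x ^ 2) * (x - μ) <
          (-a) * ((2 * μ + 3) * (x + x ^ 2) - 2 * μ * (μ + 1)) * (x - μ) :=
        mul_lt_mul_of_pos_right (by linarith) e1
      have e4 : (-a) * (x - μ) * ((2 * μ + 3) * (x + x ^ 2) - 2 * μ * (μ + 1)) <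
          (1 + 2 * x) * (1 + x) ^ 2 * ((2 * μ + 3) * (x + x ^ 2) - 2 * μ * (μ + 1)) :=
        mul_lt_mul_of_pos_right (by linarith) e2
      -- Cross multiplying the two bounds for `-a` leaves a difference that factors in this way.
      have e5 : 0 < ((1 + x) ^ 2 * (x * (μ + 1 + x))) *
          (4 * μ + 1 - x * (4 * x - (6 * μ - 1))) := by linarith
      have := pos_of_mul_pos_right e5 (by positivity)
      linarith
  · rintro ⟨hx, hD, hQ⟩
    have e2 : 0 < (2 * μ + 3) * (x + x ^ 2) - 2 * μ * (μ + 1) := by linarith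
    have hC : 0 < (1 + x) ^ 3 * (2 * (μ + 1) + (6 * μ + 7) * x + 4 * x ^ 2) := by positivity
    have hS : 0 < (1 + 2 * x) * (1 + x) ^ 2 := by positivity
    suffices h : ∃ t, 0 < t ∧ (1 + x) ^ 3 * (2 * (μ + 1) + (6 * μ + 7) * x + 4 * x ^ 2) <
        t * ((2 * μ + 3) * (x + x ^ 2) - 2 * μ * (μ + 1)) ∧
        t * (x - μ) < (1 + 2 * x) * (1 + x) ^ 2 by
      obtain ⟨t, ht, h1, h2⟩ := h
      refine ⟨(x, -t), ⟨hx, by simpa using ht, ?_, ?_⟩, rfl⟩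
      · simp only [innerSlope]; linarith
      · simp only; linarith
    rcases le_or_gt x μ with hxm | hxm
    · refine ⟨((1 + x) ^ 3 * (2 * (μ + 1) + (6 * μ + 7) * x + 4 * x ^ 2) + 1) /
        ((2 * μ + 3) * (x + x ^ 2) - 2 * μ * (μ + 1)), by positivity, ?_, ?_⟩
      · rw [div_mul_cancel₀ _ e2.ne']; linarith
      · refine lt_of_le_of_lt (mul_nonpos_of_nonneg_of_nonpos ?_ (by linarith)) hS
        positivity
    · have e1 : 0 < (x - μ) := by linarith
      have hlt : (1 + x) ^ 3 * (2 * (μ + 1) + (6 * μ + 7) * x + 4 * x ^ 2) /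
          ((2 * μ + 3) * (x + x ^ 2) - 2 * μ * (μ + 1)) <
          (1 + 2 * x) * (1 + x) ^ 2 / (x - μ) := by
        rw [div_lt_div_iff₀ e2 e1]
        have e5 : 0 < ((1 + x) ^ 2 * (x * (μ + 1 + x))) *
          (4 * μ + 1 - x * (4 * x - (6 * μ - 1))) := mul_pos (by positivity) (by linarith)
        linarith
      obtain ⟨t, ht1, ht2⟩ := exists_between hlt
      refine ⟨t, lt_trans (by positivity) ht1, ?_, ?_⟩
      · rwa [div_lt_iff₀ e2] at ht1
      · rwa [lt_div_iff₀ e1] at ht2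

lemma isPreconnected_innerDomain {μ : ℝ} (hμ : 0 < μ) : IsPreconnected (innerDomain μ) := by
  refine (isOpen_innerDomain μ).isPreconnected_of_fibers (fun x => ?_) ?_
  · refine Set.OrdConnected.isPreconnected ⟨fun a₁ h₁ a₂ h₂ a ha => ?_⟩
    obtain ⟨hx, h1, h1', h1''⟩ := h₁
    obtain ⟨-, h2, h2', h2''⟩ := h₂
    refine ⟨hx, ha.2.trans_lt h2, ?_, ?_⟩
    · simp only [innerSlope, sub_eq_add_neg _ ((1 + x) ^ 3 * _)] at h1' h2' ⊢
      exact affine_pos h1' h2' ha.1 ha.2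
    · simp only at h1'' h2'' ⊢
      have := affine_pos (s := -(μ - x)) (t := (1 + 2 * x) * (1 + x) ^ 2)
        (by linarith : 0 < a₁ * -(μ - x) + _) (by linarith : 0 < a₂ * -(μ - x) + _) ha.1 ha.2
      linarith
  · rw [fst_image_innerDomain hμ]
    refine Set.OrdConnected.isPreconnected ⟨?_⟩
    rintro x₁ ⟨h1, h1', -⟩ x₂ ⟨h2, -, h2'⟩ x hx
    have hx0 : 0 < x := h1.trans_le hx.1
    refine ⟨hx0, ?_, ?_⟩
    · refine h1'.trans_le (mul_le_mul_of_nonneg_left ?_ (by linarith))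
      nlinarith [hx.1]
    · rcases le_or_gt (4 * x - (6 * μ - 1)) 0 with h | h
      · nlinarith
      · have := mul_le_mul hx.2 (by linarith [hx.2] : 4 * x - (6 * μ - 1) ≤ 4 * x₂ - (6 * μ - 1))
          h.le h2.le
        linarith

/-- The equation is linear in `b`, so an upward zero `x` and `a` determine `b`. The last inequality
of the domain says `b < 0`; the remaining conditions of the cell follow from the separation
inequalities. -/
lemma cell_neg_neg_one_eq_image {μ : ℝ} (hμ : 0 < μ) :
    cell μ (-1, -1) (some 1) = (fun q : ℝ × ℝ =>
      (q.2, q.1 ^ 2 * (q.2 * (μ - q.1) - (1 + 2 * q.1) * (1 + q.1) ^ 2) /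
        ((1 + q.1) ^ 2 * (μ + 1 + q.1)))) '' innerDomain μ := by
  ext ⟨a, b⟩
  constructor
  · intro h
    have h1 := sign_pair_eq_iff.1 h.1
    have ha : a < 0 := sign_eq_neg_one_iff.1 h1.1
    have hb : b < 0 := sign_eq_neg_one_iff.1 h1.2
    obtain ⟨x, hx, hx0, hx1⟩ : HasUp (coefInner μ a b) := (h.2 1).1 rfl
    rw [dquin_pos_iff_innerSlope hμ hx hx0] at hx1
    rw [quin_coefInner] at hx0
    have hk : 0 < (1 + x) ^ 2 * (μ + 1 + x) := by positivity
    have he : x ^ 2 * (a * (μ - x) - (1 + 2 * x) * (1 + x) ^ 2) =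
      b * ((1 + x) ^ 2 * (μ + 1 + x)) := by linear_combination hx0
    refine ⟨(x, a), ⟨hx, ha, hx1, ?_⟩, ?_⟩
    · simp only
      by_contra hc
      have e1 : 0 ≤ x ^ 2 * (a * (μ - x) - (1 + 2 * x) * (1 + x) ^ 2) :=
        mul_nonneg (by positivity) (not_lt.1 hc)
      rw [he] at e1
      linarith [mul_neg_of_neg_of_pos hb hk]
    · simp only [he, mul_div_cancel_right₀ _ hk.ne']
  · rintro ⟨⟨x, a⟩, ⟨hx, ha, h1, h2⟩, he⟩
    simp only [Prod.mk.injEq] at hx ha h1 h2 he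
    obtain ⟨rfl, hb⟩ := he
    have hk : 0 < (1 + x) ^ 2 * (μ + 1 + x) := by positivity
    have hb0 : b < 0 := by
      rw [← hb]
      exact div_neg_of_neg_of_pos (mul_neg_of_pos_of_neg (by positivity) h2) hk
    rw [div_eq_iff hk.ne'] at hb
    have hq : quin (coefInner μ a b) x = 0 := by
      rw [quin_coefInner]; linear_combination hb
    have hU : HasUp (coefInner μ a b) := ⟨x, hx, hq, (dquin_pos_iff_innerSlope hμ hx hq).2 h1⟩
    have hi := lt_of_inner_neg_neg hμ ha hb0 fun h => h.not_hasUp hU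
    refine mem_cell_one (by simp [sign_neg ha, sign_neg hb0]) ?_ hU ?_
    · by_contra hc
      linarith [(lt_of_inner_neg_neg hμ hb0 ha hc).2]
    · by_contra hc
      linarith [lt_of_middle_neg_neg hμ ha hb0 hc]

lemma isPreconnected_cell_neg_neg_one {μ : ℝ} (hμ : 0 < μ) :
    IsPreconnected (cell μ (-1, -1) (some 1)) := by
  rw [cell_neg_neg_one_eq_image hμ]
  refine (isPreconnected_innerDomain hμ).image _ ?_
  refine continuousOn_snd.prodMk (ContinuousOn.div (by fun_prop) (by fun_prop) ?_)
  rintro ⟨x, a⟩ ⟨hx, -⟩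
  simp only at hx
  simp only
  positivity

/-- The parameter domain of the cell with three zeros in `I₃`: a zero and the first parameter. -/
def middleDomain (μ : ℝ) : Set (ℝ × ℝ) :=
  {q | 0 < q.1 ∧ q.2 < 0 ∧ 0 < middleSlope μ q.2 q.1 ∧
    q.2 * ((1 + q.1) ^ 2 * (μ + (μ + 1) * q.1)) + (q.1 - 1) < 0}

lemma isOpen_middleDomain (μ : ℝ) : IsOpen (middleDomain μ) := by
  refine (isOpen_lt continuous_const continuous_fst).and
    ((isOpen_lt continuous_snd continuous_const).and
    ((isOpen_lt continuous_const ?_).and (isOpen_lt ?_ continuous_const)))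
  · unfold middleSlope; fun_prop
  · fun_prop

lemma fst_image_middleDomain {μ : ℝ} (hμ : 0 < μ) : Prod.fst '' middleDomain μ =
    {x | 0 < x ∧ 0 < (4 * μ + 1) * x ^ 2 + (2 * μ + 3) * x - 2 * (μ + 1) ∧
      x * (2 * (μ + 1) * x - (2 * μ + 3)) < 4 * μ + 1} := by
  ext x
  constructor
  · rintro ⟨⟨x, a⟩, ⟨hx, ha, h1, h2⟩, rfl⟩
    simp only at hx ha h1 h2 ⊢
    unfold middleSlope at h1
    have hq : 0 < (2 * μ * (μ + 1) * (1 + x ^ 2) + (4 * μ ^ 2 + 6 * μ + 3) * x) * (1 + x) ^ 3 := by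
      positivity
    have hm : 0 < (1 + x) ^ 2 * (μ + (μ + 1) * x) := by positivity
    have hs : 0 < (4 * μ + 1) * x ^ 2 + (2 * μ + 3) * x - 2 * (μ + 1) := by nlinarith
    refine ⟨hx, hs, ?_⟩
    have e3 : (x - 1) * ((2 * μ * (μ + 1) * (1 + x ^ 2) + (4 * μ ^ 2 + 6 * μ + 3) * x) *
        (1 + x) ^ 3) < (-a) * ((1 + x) ^ 2 * (μ + (μ + 1) * x)) *
        ((2 * μ * (μ + 1) * (1 + x ^ 2) + (4 * μ ^ 2 + 6 * μ + 3) * x) * (1 + x) ^ 3) :=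
      mul_lt_mul_of_pos_right (by linarith) hq
    have e4 : (-a) * ((2 * μ * (μ + 1) * (1 + x ^ 2) + (4 * μ ^ 2 + 6 * μ + 3) * x) *
        (1 + x) ^ 3) * ((1 + x) ^ 2 * (μ + (μ + 1) * x)) <
        ((4 * μ + 1) * x ^ 2 + (2 * μ + 3) * x - 2 * (μ + 1)) *
          ((1 + x) ^ 2 * (μ + (μ + 1) * x)) :=
      mul_lt_mul_of_pos_right (by linarith) hm
    have e5 : 0 < ((1 + x) ^ 2 * (x * (μ + 1 + μ * x))) *
        (4 * μ + 1 - x * (2 * (μ + 1) * x - (2 * μ + 3))) := by linarith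
    have := pos_of_mul_pos_right e5 (by positivity)
    linarith
  · rintro ⟨hx, hs, hQ⟩
    have hq : 0 < (2 * μ * (μ + 1) * (1 + x ^ 2) + (4 * μ ^ 2 + 6 * μ + 3) * x) * (1 + x) ^ 3 := by
      positivity
    have hm : 0 < (1 + x) ^ 2 * (μ + (μ + 1) * x) := by positivity
    -- The number `t = -a` has to be positive as well as above the bound that makes `b` negative.
    have hlt : max 0 ((x - 1) / ((1 + x) ^ 2 * (μ + (μ + 1) * x))) <
        ((4 * μ + 1) * x ^ 2 + (2 * μ + 3) * x - 2 * (μ + 1)) /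
        ((2 * μ * (μ + 1) * (1 + x ^ 2) + (4 * μ ^ 2 + 6 * μ + 3) * x) * (1 + x) ^ 3) := by
      refine max_lt (by positivity) ?_
      rw [div_lt_div_iff₀ hm hq]
      have e5 : 0 < ((1 + x) ^ 2 * (x * (μ + 1 + μ * x))) *
        (4 * μ + 1 - x * (2 * (μ + 1) * x - (2 * μ + 3))) := mul_pos (by positivity) (by linarith)
      linarith
    obtain ⟨t, ht1, ht2⟩ := exists_between hlt
    have ht0 : 0 < t := (le_max_left _ _).trans_lt ht1
    have ht3 := (le_max_right _ _).trans_lt ht1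
    rw [div_lt_iff₀ hm] at ht3
    rw [lt_div_iff₀ hq] at ht2
    refine ⟨(x, -t), ⟨hx, by simpa using ht0, ?_, ?_⟩, rfl⟩
    · simp only [middleSlope]; linarith
    · simp only; linarith

lemma isPreconnected_middleDomain {μ : ℝ} (hμ : 0 < μ) : IsPreconnected (middleDomain μ) := by
  refine (isOpen_middleDomain μ).isPreconnected_of_fibers (fun x => ?_) ?_
  · refine Set.OrdConnected.isPreconnected ⟨fun a₁ h₁ a₂ h₂ a ha => ?_⟩
    obtain ⟨hx, h1, h1', h1''⟩ := h₁
    obtain ⟨-, h2, h2', h2''⟩ := h₂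
    refine ⟨hx, ha.2.trans_lt h2, affine_pos h1' h2' ha.1 ha.2, ?_⟩
    simp only at h1'' h2'' ⊢
    have := affine_pos (s := -((1 + x) ^ 2 * (μ + (μ + 1) * x))) (t := -(x - 1))
      (by linarith : 0 < a₁ * _ + _) (by linarith : 0 < a₂ * _ + _) ha.1 ha.2
    linarith
  · rw [fst_image_middleDomain hμ]
    refine Set.OrdConnected.isPreconnected ⟨?_⟩
    rintro x₁ ⟨h1, h1', -⟩ x₂ ⟨h2, -, h2'⟩ x hx
    have hx0 : 0 < x := h1.trans_le hx.1
    refine ⟨hx0, ?_, ?_⟩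
    · have e : 0 ≤ (x - x₁) * ((4 * μ + 1) * (x + x₁) + (2 * μ + 3)) :=
        mul_nonneg (by linarith [hx.1]) (by positivity)
      linarith
    · rcases le_or_gt (2 * (μ + 1) * x - (2 * μ + 3)) 0 with h | h
      · nlinarith
      · have e : 0 ≤ (μ + 1) * (x₂ - x) := mul_nonneg (by linarith) (by linarith [hx.2])
        have := mul_le_mul hx.2 (by linarith :
          2 * (μ + 1) * x - (2 * μ + 3) ≤ 2 * (μ + 1) * x₂ - (2 * μ + 3)) h.le h2.le
        linarith

lemma hasUp_middle_of_neg {μ a b x : ℝ} (hμ : 0 < μ) (ha : a < 0) (hx : 0 < x)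
    (h0 : redFun μ a b x = 0) (h1 : 0 < middleSlope μ a x) : HasUp (coefs μ (a, b) 2) := by
  refine ⟨x, hx, by rw [quin_middle, h0, mul_zero], ?_⟩
  rw [dquin_middle]
  refine mul_pos (neg_pos.2 ha) ?_
  have h2 := redFun'_mul μ a b x
  rw [h0, mul_zero, zero_add] at h2
  refine pos_of_mul_pos_left (b := (1 + x) * (μ + 1 + μ * x)) ?_ (by positivity)
  rw [h2]
  positivity

lemma cell_neg_neg_two_eq_image {μ : ℝ} (hμ : 0 < μ) :
    cell μ (-1, -1) (some 2) = (fun q : ℝ × ℝ =>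
      (q.2, q.1 ^ 2 * (q.2 * ((1 + q.1) ^ 2 * (μ + (μ + 1) * q.1)) + (q.1 - 1)) /
        ((1 + q.1) ^ 2 * (μ + 1 + μ * q.1)))) '' middleDomain μ := by
  ext ⟨a, b⟩
  constructor
  · intro h
    have h1 := sign_pair_eq_iff.1 h.1
    have ha : a < 0 := sign_eq_neg_one_iff.1 h1.1
    have hb : b < 0 := sign_eq_neg_one_iff.1 h1.2
    obtain ⟨x, hx, hx0, hx1⟩ : HasUp (coefs μ (a, b) 2) := (h.2 2).1 rfl
    rw [quin_middle] at hx0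
    rw [dquin_middle] at hx1
    have hx0 : redFun μ a b x = 0 := (mul_eq_zero.1 hx0).resolve_left (neg_ne_zero.2 ha.ne)
    have hx1 : 0 < redFun' μ a b x := pos_of_mul_pos_right hx1 (neg_pos.2 ha).le
    have hx2 : 0 < middleSlope μ a x := by
      have h2 := redFun'_mul μ a b x
      rw [hx0, mul_zero, zero_add] at h2
      refine pos_of_mul_pos_right (a := x) ?_ hx.le
      rw [← h2]
      positivity
    have hk : 0 < (1 + x) ^ 2 * (μ + 1 + μ * x) := by positivity
    have he : x ^ 2 * (a * ((1 + x) ^ 2 * (μ + (μ + 1) * x)) + (x - 1)) =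
      b * ((1 + x) ^ 2 * (μ + 1 + μ * x)) := by
      rw [redFun] at hx0
      linear_combination hx0
    refine ⟨(x, a), ⟨hx, ha, hx2, ?_⟩, ?_⟩
    · simp only
      by_contra hc
      have e1 := mul_nonneg (sq_nonneg x) (not_lt.1 hc)
      rw [he] at e1
      linarith [mul_neg_of_neg_of_pos hb hk]
    · simp only [he, mul_div_cancel_right₀ _ hk.ne']
  · rintro ⟨⟨x, a⟩, ⟨hx, ha, h1, h2⟩, he⟩
    simp only [Prod.mk.injEq] at hx ha h1 h2 he
    obtain ⟨rfl, hb⟩ := he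
    have hk : 0 < (1 + x) ^ 2 * (μ + 1 + μ * x) := by positivity
    have hb0 : b < 0 := by
      rw [← hb]
      exact div_neg_of_neg_of_pos (mul_neg_of_pos_of_neg (by positivity) h2) hk
    rw [div_eq_iff hk.ne'] at hb
    have hq : redFun μ a b x = 0 := by
      rw [redFun]; linear_combination hb
    have hU := hasUp_middle_of_neg hμ ha hx hq h1
    have hi := lt_of_middle_neg_neg hμ ha hb0 fun h => h.not_hasUp hU
    refine mem_cell_two (by simp [sign_neg ha, sign_neg hb0]) ?_ ?_ hU
    · by_contra hc
      linarith [(lt_of_inner_neg_neg hμ hb0 ha hc).1]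
    · by_contra hc
      linarith [(lt_of_inner_neg_neg hμ ha hb0 hc).1]

lemma isPreconnected_cell_neg_neg_two {μ : ℝ} (hμ : 0 < μ) :
    IsPreconnected (cell μ (-1, -1) (some 2)) := by
  rw [cell_neg_neg_two_eq_image hμ]
  refine (isPreconnected_middleDomain hμ).image _ ?_
  refine continuousOn_snd.prodMk (ContinuousOn.div (by fun_prop) (by fun_prop) ?_)
  rintro ⟨x, a⟩ ⟨hx, -⟩
  simp only at hx
  simp only
  positivity

/-! ### The cell with one zero in each interval -/

lemma innerSlope_eq (μ a x : ℝ) : innerSlope μ a x =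
    -(2 * (μ + 1) - 2 * μ * (μ + 1) * a) + (-(2 * μ + 3) * a - (12 * μ + 13)) * x +
      (-(2 * μ + 3) * a - (24 * μ + 31)) * x ^ 2 - (20 * μ + 35) * x ^ 3 - (6 * μ + 19) * x ^ 4 -
      4 * x ^ 5 := by
  simp only [innerSlope]
  ring

lemma convexOn_slope {c d e : ℝ} (hc : 0 ≤ c) (hd : 0 ≤ d) (he : 0 ≤ e) :
    ConvexOn ℝ (Set.Ioi (0 : ℝ)) fun x => c * x⁻¹ + d * x ^ 2 + e * x ^ 3 + 4 * x ^ 4 := by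
  have hinv : ConvexOn ℝ (Set.Ioi (0 : ℝ)) fun x => x⁻¹ := by
    simpa using convexOn_zpow (𝕜 := ℝ) (-1)
  have hpow : ∀ n : ℕ, ConvexOn ℝ (Set.Ioi (0 : ℝ)) fun x => x ^ n := fun n =>
    (convexOn_pow n).subset Set.Ioi_subset_Ici_self (convex_Ioi 0)
  exact (((hinv.smul hc).add ((hpow 2).smul hd)).add ((hpow 3).smul he)).add
    ((hpow 4).smul (by norm_num : (0 : ℝ) ≤ 4))

/-- For `a < 0` the quotient `innerSlope / x` is an affine function minus a convex one, hence
concave on `x > 0`. So the set where the slope is nonnegative is an interval. -/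
lemma innerSlope_nonneg_between {μ a x₁ x₂ r : ℝ} (hμ : 0 < μ) (ha : a < 0) (h0 : 0 < x₁)
    (h1 : x₁ ≤ r) (h2 : r ≤ x₂) (e1 : 0 ≤ innerSlope μ a x₁) (e2 : 0 ≤ innerSlope μ a x₂) :
    0 ≤ innerSlope μ a r := by
  have hC : 0 ≤ 2 * (μ + 1) - 2 * μ * (μ + 1) * a := by
    have : 0 ≤ 2 * μ * (μ + 1) * (-a) := mul_nonneg (by positivity) (by linarith)
    linarith
  have hconv := convexOn_slope hC (by positivity : 0 ≤ 20 * μ + 35) (by positivity : 0 ≤ 6 * μ + 19)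
  set B := -(2 * μ + 3) * a - (12 * μ + 13)
  set D := -(2 * μ + 3) * a - (24 * μ + 31)
  have key : ∀ x : ℝ, 0 < x → innerSlope μ a x = x * (B + D * x -
      ((2 * (μ + 1) - 2 * μ * (μ + 1) * a) * x⁻¹ + (20 * μ + 35) * x ^ 2 + (6 * μ + 19) * x ^ 3 +
        4 * x ^ 4)) := by
    intro x hx
    rw [innerSlope_eq]
    field_simp
    ring
  have hr : 0 < r := h0.trans_le h1
  have hx2 : 0 < x₂ := hr.trans_le h2
  have hseg : r ∈ segment ℝ x₁ x₂ := by rw [segment_eq_Icc (h1.trans h2)]; exact ⟨h1, h2⟩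
  obtain ⟨s, t, hs, ht, hst, rfl⟩ := hseg
  have hle := hconv.2 (show x₁ ∈ Set.Ioi 0 from h0) (show x₂ ∈ Set.Ioi 0 from hx2) hs ht hst
  rw [key _ h0] at e1
  rw [key _ hx2] at e2
  rw [key _ hr]
  have e1' := mul_nonneg hs (nonneg_of_mul_nonneg_right e1 h0)
  have e2' := mul_nonneg ht (nonneg_of_mul_nonneg_right e2 hx2)
  refine mul_nonneg hr.le ?_
  simp only [smul_eq_mul] at hle e1' e2' ⊢
  have hB : B = s * B + t * B := by rw [← add_mul, hst, one_mul]
  linarith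

lemma quin_pos_of_lt_root {c : Fin 6 → ℝ} (h0 : 0 < c 0) {r x : ℝ}
    (hu : ∀ y, 0 < y → quin c y = 0 → y = r) (hx : 0 < x) (hxr : x < r) : 0 < quin c x := by
  by_contra hcon
  rcases (not_lt.1 hcon).eq_or_lt with h | h
  · exact hxr.ne (hu x hx h)
  · obtain ⟨z, hz, hz0⟩ := exists_root_between (continuous_quin c) hx
      (by rw [quin_zero]; exact mul_neg_of_pos_of_neg h0 h)
    exact (hz.2.trans hxr).ne (hu z hz.1 hz0)

lemma quin_neg_of_root_lt {c : Fin 6 → ℝ} (h5 : c 5 < 0) {r x : ℝ} (hr : 0 < r)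
    (hu : ∀ y, 0 < y → quin c y = 0 → y = r) (hxr : r < x) : quin c x < 0 := by
  by_contra hcon
  rcases (not_lt.1 hcon).eq_or_lt with h | h
  · exact hxr.ne' (hu x (hr.trans hxr) h.symm)
  · obtain ⟨R, hR, hR'⟩ := exists_quin_neg h5 x
    obtain ⟨z, hz, hz0⟩ := exists_root_between (continuous_quin c) hR (mul_neg_of_pos_of_neg h hR')
    exact (hxr.trans hz.1).ne' (hu z ((hr.trans hxr).trans hz.1) hz0)

lemma coefInner_zero_pos {μ a b : ℝ} (hμ : 0 < μ) (hb : b < 0) : 0 < coefInner μ a b 0 := by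
  simp [coefInner]
  nlinarith

lemma coefInner_five (μ a b : ℝ) : coefInner μ a b 5 < 0 := by simp [coefInner]

/-- Below a parameter whose only zero lies above all critical points there is again
only one zero. -/
lemma allDown_of_slope_above {μ a b b' r : ℝ} (hμ : 0 < μ) (hb : b < 0) (hbb : b' ≤ b) (hr : 0 < r)
    (hr0 : quin (coefInner μ a b) r = 0) (h : AllDown (coefInner μ a b))
    (hs : ∀ x, r ≤ x → innerSlope μ a x < 0) : AllDown (coefInner μ a b') := by
  intro x hx hx0
  rw [dquin_neg_iff_innerSlope hμ hx hx0]
  refine hs x ?_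
  by_contra hxr
  have h1 := quin_pos_of_lt_root (coefInner_zero_pos hμ hb) (fun y hy hy0 => h.unique hy hr hy0 hr0)
    hx (not_le.1 hxr)
  rw [quin_coefInner] at h1 hx0
  have : 0 ≤ (b - b') * ((1 + x) ^ 2 * (μ + 1 + x)) := mul_nonneg (by linarith) (by positivity)
  linarith

/-- The level of the second parameter at which `r` is a zero when the first one vanishes. -/
def baseLevel (μ r : ℝ) : ℝ := -(r ^ 2 * (1 + 2 * r) / (μ + 1 + r))

lemma baseLevel_neg {μ r : ℝ} (hμ : 0 < μ) (hr : 0 < r) : baseLevel μ r < 0 := by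
  unfold baseLevel
  rw [neg_lt_zero]
  positivity

lemma quin_baseLevel_neg {μ r x : ℝ} (hμ : 0 < μ) (hr : 0 < r) (hx : r < x) :
    quin (coefInner μ 0 (baseLevel μ r)) x < 0 := by
  have hm : 0 < μ + 1 + r := by positivity
  have h1 : r ^ 2 * (1 + 2 * r) * (μ + 1 + x) < x ^ 2 * (1 + 2 * x) * (μ + 1 + r) := by
    have e1 : r ^ 2 < x ^ 2 := by nlinarith
    have e2 : (1 + 2 * r) * (μ + 1 + x) ≤ (1 + 2 * x) * (μ + 1 + r) := by nlinarith
    have e3 : 0 < (1 + 2 * r) * (μ + 1 + x) := by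
      have : 0 < x := hr.trans hx
      positivity
    calc r ^ 2 * (1 + 2 * r) * (μ + 1 + x) = r ^ 2 * ((1 + 2 * r) * (μ + 1 + x)) := by ring
      _ < x ^ 2 * ((1 + 2 * r) * (μ + 1 + x)) := mul_lt_mul_of_pos_right e1 e3
      _ ≤ x ^ 2 * ((1 + 2 * x) * (μ + 1 + r)) := mul_le_mul_of_nonneg_left e2 (sq_nonneg x)
      _ = _ := by ring
  have h2 : quin (coefInner μ 0 (baseLevel μ r)) x * (μ + 1 + r) =
      (1 + x) ^ 2 * (r ^ 2 * (1 + 2 * r) * (μ + 1 + x) - x ^ 2 * (1 + 2 * x) * (μ + 1 + r)) := by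
    rw [quin_coefInner, baseLevel]
    field_simp
    ring
  have h3 : 0 < (1 + x) ^ 2 := by
    have : 0 < x := hr.trans hx
    positivity
  by_contra hc
  have := mul_nonneg (not_lt.1 hc) hm.le
  rw [h2] at this
  linarith [mul_neg_of_pos_of_neg h3 (sub_neg.2 h1)]

/-- Along the segment from `(a, b)` towards `(0, baseLevel μ r)` the number `r` remains a zero.
Beyond `r` the quintic is a convex combination of negative values; up to `r` so is the slope. -/
lemma allDown_of_slope_below {μ a b r θ : ℝ} (hμ : 0 < μ) (hr : 0 < r) (h0 : 0 < θ) (h1 : θ ≤ 1)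
    (hr0 : quin (coefInner μ a b) r = 0) (h : AllDown (coefInner μ a b))
    (hs : ∀ x, 0 < x → x ≤ r → innerSlope μ a x < 0) :
    AllDown (coefInner μ (θ * a) (θ * b + (1 - θ) * baseLevel μ r)) := by
  intro x hx hx0
  rw [dquin_neg_iff_innerSlope hμ hx hx0]
  have hxr : x ≤ r := by
    by_contra hxr
    have e1 := quin_neg_of_root_lt (coefInner_five μ a b) hr
      (fun y hy hy0 => h.unique hy hr hy0 hr0) (not_le.1 hxr)
    have e2 := quin_baseLevel_neg hμ hr (not_le.1 hxr)
    have e3 : quin (coefInner μ (θ * a) (θ * b + (1 - θ) * baseLevel μ r)) x =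
      θ * quin (coefInner μ a b) x + (1 - θ) * quin (coefInner μ 0 (baseLevel μ r)) x := by
      simp only [quin_coefInner]; ring
    rw [e3] at hx0
    linarith [mul_neg_of_pos_of_neg h0 e1, mul_nonneg (sub_nonneg.2 h1) (neg_nonneg.2 e2.le)]
  have e1 := hs x hx hxr
  have e2 : 0 < (1 + x) ^ 3 * (2 * (μ + 1) + (6 * μ + 7) * x + 4 * x ^ 2) := by positivity
  have e3 : innerSlope μ (θ * a) x = θ * innerSlope μ a x +
      (1 - θ) * -((1 + x) ^ 3 * (2 * (μ + 1) + (6 * μ + 7) * x + 4 * x ^ 2)) := by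
    simp only [innerSlope]; ring
  rw [e3]
  linarith [mul_neg_of_pos_of_neg h0 e1, mul_nonneg (sub_nonneg.2 h1) e2.le]

/-- On `(0, 1)` all zeros of the middle equation are downward crossings if `a ≤ b < 0`. -/
lemma redFun'_neg_of_lt_one {μ a b x : ℝ} (hμ : 0 < μ) (hab : a ≤ b) (hb : b < 0) (hx : 0 < x)
    (hx1 : x < 1) (h : redFun μ a b x = 0) : redFun' μ a b x < 0 := by
  -- Differentiating `redFun / (x² (x - 1))` removes the parameter-free term. What remains is split
  -- into the contribution of the diagonal `a = b` and a multiple of `b - a`.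
  have key : redFun' μ a b x * (x * (x - 1)) = (3 * x - 2) * redFun μ a b x +
      (b * ((x - 1) ^ 2 * (1 + x) * (2 * (μ + 1) * (x ^ 3 - 1) + (2 * μ + 1) * x * (x - 1))) +
      (b - a) * (x ^ 3 * ((2 * (1 + x) * (μ + (μ + 1) * x) + (1 + x) ^ 2 * (μ + 1)) * (1 - x) +
        (1 + x) ^ 2 * (μ + (μ + 1) * x)))) := by
    simp only [redFun, redFun']
    ring
  rw [h, mul_zero, zero_add] at key
  have e0 : 0 < 1 - x := by linarith
  have e1 : 0 < (1 - x) ^ 2 * (1 + x) * (2 * (μ + 1) * ((1 - x) * (1 + x + x ^ 2)) +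
    (2 * μ + 1) * x * (1 - x)) := by positivity
  have e2 : 0 < (-b) * ((1 - x) ^ 2 * (1 + x) * (2 * (μ + 1) * ((1 - x) * (1 + x + x ^ 2)) +
    (2 * μ + 1) * x * (1 - x))) := mul_pos (by linarith) e1
  have e3 : 0 ≤ (b - a) * (x ^ 3 * ((2 * (1 + x) * (μ + (μ + 1) * x) +
    (1 + x) ^ 2 * (μ + 1)) * (1 - x) + (1 + x) ^ 2 * (μ + (μ + 1) * x))) :=
    mul_nonneg (by linarith) (by positivity)
  have e4 : 0 < redFun' μ a b x * (x * (x - 1)) := by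
    rw [key]; linarith
  by_contra hc
  have : 0 ≤ redFun' μ a b x * (x * (1 - x)) := mul_nonneg (not_lt.1 hc) (by positivity)
  linarith

lemma allDown_middle_iff_of_neg {μ a b : ℝ} (ha : a < 0) : AllDown (coefs μ (a, b) 2) ↔
    ∀ x, 0 < x → redFun μ a b x = 0 → redFun' μ a b x < 0 := by
  refine forall_congr' fun x => imp_congr_right fun _ => ?_
  rw [quin_middle, dquin_middle]
  simp only [mul_eq_zero, neg_eq_zero, ha.ne, false_or]
  refine imp_congr_right fun _ => ?_
  constructor
  · intro h
    by_contra hc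
    have := mul_nonneg (neg_pos.2 ha).le (not_lt.1 hc)
    linarith
  · exact fun h => mul_neg_of_pos_of_neg (neg_pos.2 ha) h

lemma hasDerivAt_redFun (μ a b x : ℝ) : HasDerivAt (redFun μ a b) (redFun' μ a b x) x := by
  have h := hasDerivAt_quin (coefMiddle μ a b) x
  rw [dquin_coefMiddle] at h
  exact h.congr_of_eventuallyEq (Eventually.of_forall fun y => (quin_coefMiddle μ a b y).symm)

/-- Zeros below `1` are downward by `redFun'_neg_of_lt_one`. A zero `x ≥ 1` for the smaller `a'`
would make the function for `a` positive at `x`, while its value at `1` is `4 (2μ + 1) (a - b) ≤ 0`;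
in between it would have to cross upwards. -/
lemma AllDown.middle_of_le {μ a a' b : ℝ} (hμ : 0 < μ) (haa : a' ≤ a) (hab : a ≤ b) (hb : b < 0)
    (h : AllDown (coefs μ (a, b) 2)) : AllDown (coefs μ (a', b) 2) := by
  rcases haa.eq_or_lt with rfl | haa
  · exact h
  have ha : a < 0 := hab.trans_lt hb
  rw [allDown_middle_iff_of_neg ha] at h
  rw [allDown_middle_iff_of_neg (haa.trans ha)]
  intro x hx hx0
  rcases lt_or_ge x 1 with hx1 | hx1
  · exact redFun'_neg_of_lt_one hμ (haa.le.trans hab) hb hx hx1 hx0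
  exfalso
  have e1 : 0 < redFun μ a b x := by
    have : redFun μ a b x = redFun μ a' b x + (a - a') *
      (x ^ 2 * (1 + x) ^ 2 * (μ + (μ + 1) * x)) := by simp only [redFun]; ring
    rw [this, hx0, zero_add]
    exact mul_pos (by linarith) (by positivity)
  have e2 : redFun μ a b 1 = 4 * (2 * μ + 1) * (a - b) := by simp only [redFun]; ring
  have e3 : redFun μ a b 1 ≤ 0 := by
    rw [e2]; exact mul_nonpos_of_nonneg_of_nonpos (by positivity) (by linarith)
  have hx1' : 1 < x := lt_of_le_of_ne hx1 fun h1 => by rw [← h1] at e1; linarith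
  obtain ⟨s, hs1, hs2, hs3⟩ : ∃ s, 1 ≤ s ∧ s < x ∧ redFun μ a b s < 0 := by
    rcases e3.eq_or_lt with e3 | e3
    · obtain ⟨-, t, -, ht, -, h2⟩ := exists_near_down (hasDerivAt_redFun μ a b 1) e3
        (h 1 one_pos e3) zero_lt_one hx1'
      exact ⟨t, ht.1.le, ht.2, h2⟩
    · exact ⟨1, le_rfl, hx1', e3⟩
  obtain ⟨z, hz, hz0, hz1⟩ := exists_root_up (hasDerivAt_redFun μ a b) hs2 hs3 e1
  have := h z (by linarith [hz.1]) hz0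
  linarith

lemma mem_cell_neg_neg_none {μ a b : ℝ} (hμ : 0 < μ) (hab : a ≤ b) (hb : b < 0)
    (h1 : AllDown (coefInner μ a b)) (h2 : AllDown (coefs μ (a, b) 2)) :
    (a, b) ∈ cell μ (-1, -1) none := by
  have ha : a < 0 := hab.trans_lt hb
  refine mem_cell_none (by simp [sign_neg ha, sign_neg hb]) ?_ h1 h2
  by_contra hc
  linarith [(lt_of_inner_neg_neg hμ hb ha hc).2]

lemma allDown_middle_of_add_le {μ a b : ℝ} (hμ : 0 < μ) (ha : a < 0) (hb : b < 0)
    (h : a + b ≤ -2) : AllDown (coefs μ (a, b) 2) := by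
  by_contra hc
  linarith [lt_of_middle_neg_neg hμ ha hb hc]

lemma allDown_inner_of_le_add {μ a b : ℝ} (hμ : 0 < μ) (ha : a < 0) (hb : b < 0)
    (h : -4 ≤ a + b) : AllDown (coefInner μ a b) := by
  by_contra hc
  linarith [(lt_of_inner_neg_neg hμ ha hb hc).1]

lemma diagonal_mem_cell {μ t : ℝ} (hμ : 0 < μ) (ht : t ≤ -1) : (t, t) ∈ cell μ (-1, -1) none := by
  have ht0 : t < 0 := by linarith
  refine mem_cell_neg_neg_none hμ le_rfl ht0 ?_ (allDown_middle_of_add_le hμ ht0 ht0 (by linarith))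
  by_contra hc
  exact lt_irrefl _ (lt_of_inner_neg_neg hμ ht0 ht0 hc).2

lemma mem_connectedComponentIn_of_segment {S : Set (ℝ × ℝ)} {p q : ℝ × ℝ}
    (h : segment ℝ p q ⊆ S) : q ∈ connectedComponentIn S p :=
  (convex_segment p q).isPreconnected.subset_connectedComponentIn (left_mem_segment ℝ p q) h
    (right_mem_segment ℝ p q)

lemma segment_prod_subset {S : Set (ℝ × ℝ)} {a b a' b' : ℝ}
    (h : ∀ θ : ℝ, 0 ≤ θ → θ ≤ 1 → (a + θ * (a' - a), b + θ * (b' - b)) ∈ S) :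
    segment ℝ (a, b) (a', b') ⊆ S := by
  rw [segment_eq_image']
  rintro _ ⟨θ, ⟨h0, h1⟩, rfl⟩
  exact h θ h0 h1

lemma mem_connectedComponentIn_trans {S : Set (ℝ × ℝ)} {p q r : ℝ × ℝ}
    (h1 : q ∈ connectedComponentIn S p) (h2 : r ∈ connectedComponentIn S q) :
    r ∈ connectedComponentIn S p := by
  rwa [connectedComponentIn_eq h1]

lemma hub_of_diagonal {μ t : ℝ} (hμ : 0 < μ) (ht : t ≤ -2) :
    ((-2, -2) : ℝ × ℝ) ∈ connectedComponentIn (cell μ (-1, -1) none) (t, t) := by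
  refine mem_connectedComponentIn_of_segment (segment_prod_subset fun θ h0 h1 => ?_)
  exact diagonal_mem_cell hμ (by nlinarith)

/-- The path lowers `a` to `-2` and then `b` to `-2`. As `a + b ≥ -4` throughout, the inner
equations impose nothing; on the second leg `a + b ≤ -2` also settles the middle one. -/
lemma hub_of_ge {μ a b : ℝ} (hμ : 0 < μ) (ha : -2 ≤ a) (hab : a ≤ b) (hb : b < 0)
    (h : AllDown (coefs μ (a, b) 2)) :
    ((-2, -2) : ℝ × ℝ) ∈ connectedComponentIn (cell μ (-1, -1) none) (a, b) := by
  refine mem_connectedComponentIn_trans (q := (-2, b)) ?_ ?_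
  · refine mem_connectedComponentIn_of_segment (segment_prod_subset fun θ h0 h1 => ?_)
    have e1 : a + θ * (-2 - a) ≤ a := by nlinarith
    have e2 : -2 ≤ a + θ * (-2 - a) := by nlinarith
    have e3 : b + θ * (b - b) = b := by ring
    rw [e3]
    exact mem_cell_neg_neg_none hμ (e1.trans hab) hb
      (allDown_inner_of_le_add hμ (by linarith) hb (by linarith)) (h.middle_of_le hμ e1 hab hb)
  · refine mem_connectedComponentIn_of_segment (segment_prod_subset fun θ h0 h1 => ?_)
    have e1 : b + θ * (-2 - b) ≤ b := by nlinarith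
    have e2 : -2 ≤ b + θ * (-2 - b) := by nlinarith
    have e3 : (-2 : ℝ) + θ * (-2 - -2) = -2 := by ring
    rw [e3]
    exact mem_cell_neg_neg_none hμ e2 (by linarith)
      (allDown_inner_of_le_add hμ (by norm_num) (by linarith) (by linarith))
      (allDown_middle_of_add_le hμ (by norm_num) (by linarith) (by linarith))

/-- Here `a + b < -2` settles the middle equation and `a ≤ b` the one on `I₁`. Only the equation on
`I₂` matters; its unique zero `r` lies above or below the interval where the slope is nonnegative,
and each case has its own path. -/
lemma hub_of_lt {μ a b : ℝ} (hμ : 0 < μ) (ha : a < -2) (hab : a ≤ b) (hb : b < 0)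
    (h : AllDown (coefInner μ a b)) :
    ((-2, -2) : ℝ × ℝ) ∈ connectedComponentIn (cell μ (-1, -1) none) (a, b) := by
  have ha0 : a < 0 := by linarith
  obtain ⟨r, hr, hr0⟩ := (endPattern_coefInner hμ ha0.ne hb.ne).exists_root
    (coefInner_zero_pos hμ hb)
  have hrs := (dquin_neg_iff_innerSlope hμ hr hr0).1 (h r hr hr0)
  -- If the slope is negative from `r` on, lowering `b` to the diagonal moves the zero to the right
  -- and keeps it simple. Otherwise the slope is negative on all of `(0, r]`.
  by_cases hbig : ∀ x, r ≤ x → innerSlope μ a x < 0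
  · refine mem_connectedComponentIn_trans (q := (a, a)) ?_ (hub_of_diagonal hμ ha.le)
    refine mem_connectedComponentIn_of_segment (segment_prod_subset fun θ h0 h1 => ?_)
    have e1 : b + θ * (a - b) ≤ b := by nlinarith
    have e2 : a ≤ b + θ * (a - b) := by nlinarith
    have e3 : a + θ * (a - a) = a := by ring
    rw [e3]
    exact mem_cell_neg_neg_none hμ e2 (by linarith)
      (allDown_of_slope_above hμ hb e1 hr hr0 h hbig)
      (allDown_middle_of_add_le hμ ha0 (by linarith) (by linarith))
  push Not at hbig
  obtain ⟨x₂, hx₂, hx₂'⟩ := hbig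
  have hsmall : ∀ x, 0 < x → x ≤ r → innerSlope μ a x < 0 := by
    intro x hx hxr
    by_contra hc
    linarith [innerSlope_nonneg_between hμ ha0 hx hxr hx₂ (not_lt.1 hc) hx₂']
  have hL := baseLevel_neg hμ hr
  set L := baseLevel μ r
  have hpath : ∀ η : ℝ, 0 < η → η ≤ 1 → η * a ≤ -2 → η * a ≤ η * b + (1 - η) * L →
      (η * a, η * b + (1 - η) * L) ∈ connectedComponentIn (cell μ (-1, -1) none) (a, b) := by
    intro η hη hη1 h2 h3
    refine mem_connectedComponentIn_of_segment (segment_prod_subset fun θ h0 h1 => ?_)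
    -- Position `θ` on the segment to the point with scale `η` has scale `1 - θ (1 - η)` on the ray
    -- towards `(0, L)`.
    have hτ : η ≤ 1 - θ * (1 - η) := by nlinarith
    have hτ1 : 1 - θ * (1 - η) ≤ 1 := by nlinarith
    have e1 : a + θ * (η * a - a) = (1 - θ * (1 - η)) * a := by ring
    have e2 : b + θ * (η * b + (1 - η) * L - b) =
      (1 - θ * (1 - η)) * b + (1 - (1 - θ * (1 - η))) * L := by ring
    have hneg : b + θ * (η * b + (1 - η) * L - b) < 0 := by
      rw [e2]
      linarith [mul_neg_of_pos_of_neg (hη.trans_le hτ) hb,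
        mul_nonneg (sub_nonneg.2 hτ1) (neg_nonneg.2 hL.le)]
    have hle : a + θ * (η * a - a) ≤ -2 := by nlinarith
    refine mem_cell_neg_neg_none hμ ?_ hneg ?_
      (allDown_middle_of_add_le hμ (by linarith) hneg (by linarith))
    · have f1 := mul_nonneg h0 (sub_nonneg.2 h3)
      have f2 := mul_nonneg (sub_nonneg.2 h1) (sub_nonneg.2 hab)
      linarith
    · rw [e1, e2]
      exact allDown_of_slope_below hμ hr (hη.trans_le hτ) hτ1 hr0 h hsmall
  have hη0 : 0 < -2 / a := div_pos_of_neg_of_neg (by norm_num) ha0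
  have hη1 : -2 / a ≤ 1 := by rw [div_le_one_of_neg ha0]; exact ha.le
  have hηa : -2 / a * a = -2 := div_mul_cancel₀ _ ha0.ne
  -- The scale `-2 / a` brings the first coordinate to `-2`. Either the path is still on or above
  -- the diagonal there, or it has met the diagonal earlier and continues along it.
  rcases le_or_gt (-2) (-2 / a * b + (1 - -2 / a) * L) with hge | hlt
  · have := hpath (-2 / a) hη0 hη1 hηa.le (hηa.le.trans hge)
    rw [hηa] at this
    refine mem_connectedComponentIn_trans this (hub_of_ge hμ le_rfl hge ?_ ?_)
    · linarith [mul_neg_of_pos_of_neg hη0 hb,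
        mul_nonneg (sub_nonneg.2 hη1) (neg_nonneg.2 hL.le)]
    · have hneg : -2 / a * b + (1 - -2 / a) * L < 0 := by
        linarith [mul_neg_of_pos_of_neg hη0 hb,
          mul_nonneg (sub_nonneg.2 hη1) (neg_nonneg.2 hL.le)]
      exact allDown_middle_of_add_le hμ (by norm_num) hneg (by linarith)
  · have hcont : ContinuousOn (fun η : ℝ => η * b + (1 - η) * L - η * a) (Set.Icc (-2 / a) 1) := by
      fun_prop
    obtain ⟨η, hη, hη'⟩ := intermediate_value_Icc hη1 hcont
      (show (0 : ℝ) ∈ Set.Icc _ _ from ⟨by rw [hηa]; linarith, by linarith⟩)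
    have heq : η * b + (1 - η) * L = η * a := by linarith
    have hle : η * a ≤ -2 := by
      have := mul_nonneg (sub_nonneg.2 hη.1) (neg_nonneg.2 ha0.le)
      linarith
    have := hpath η (hη0.trans_le hη.1) hη.2 hle heq.ge
    rw [heq] at this
    exact mem_connectedComponentIn_trans this (hub_of_diagonal hμ hle)

lemma hub_of_le {μ a b : ℝ} (hμ : 0 < μ) (hab : a ≤ b) (h : (a, b) ∈ cell μ (-1, -1) none) :
    ((-2, -2) : ℝ × ℝ) ∈ connectedComponentIn (cell μ (-1, -1) none) (a, b) := by
  rw [mem_cell_none_iff] at h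
  have hb : b < 0 := sign_eq_neg_one_iff.1 (sign_pair_eq_iff.1 h.1).2
  rcases le_or_gt (-2) a with ha | ha
  · exact hub_of_ge hμ ha hab hb h.2.2.2
  · exact hub_of_lt hμ ha hab hb h.2.2.1

lemma isPreconnected_cell_neg_neg_none {μ : ℝ} (hμ : 0 < μ) :
    IsPreconnected (cell μ (-1, -1) none) := by
  refine isPreconnected_of_forall (-2, -2) fun p hp => ?_
  obtain ⟨a, b⟩ := p
  rcases le_total a b with hab | hab
  · exact ⟨_, connectedComponentIn_subset _ _, hub_of_le hμ hab hp, mem_connectedComponentIn hp,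
      isPreconnected_connectedComponentIn⟩
  · have hsw : ∀ q ∈ cell μ (-1, -1) none, q.swap ∈ cell μ (-1, -1) none := fun q hq =>
      have h1 := sign_pair_eq_iff.1 hq.1
      swap_mem_cell hμ (sign_eq_neg_one_iff.1 h1.1).ne (sign_eq_neg_one_iff.1 h1.2).ne hq
    have hp' := hsw _ hp
    refine ⟨Prod.swap '' connectedComponentIn (cell μ (-1, -1) none) (b, a), ?_,
      ⟨_, hub_of_le hμ hab hp', rfl⟩, ⟨_, mem_connectedComponentIn hp', rfl⟩,
      isPreconnected_connectedComponentIn.image _ continuous_swap.continuousOn⟩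
    rintro _ ⟨q, hq, rfl⟩
    exact hsw q (connectedComponentIn_subset _ _ hq)

/-! ### The thirteen regions -/

lemma cell_swap {μ : ℝ} (hμ : 0 < μ) {s : SignType × SignType} (h1 : s.1 ≠ 0) (h2 : s.2 ≠ 0)
    (e : Option (Fin 3)) : cell μ s.swap (e.map swapIdx) = Prod.swap '' cell μ s e := by
  have hne : ∀ {s : SignType × SignType} {e : Option (Fin 3)} {p : ℝ × ℝ}, s.1 ≠ 0 → s.2 ≠ 0 →
      p ∈ cell μ s e → p.1 ≠ 0 ∧ p.2 ≠ 0 := by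
    intro s e p h1 h2 hp
    rw [← sign_ne_zero, ← sign_ne_zero (a := p.2), (sign_pair_eq_iff.1 hp.1).1,
      (sign_pair_eq_iff.1 hp.1).2]
    exact ⟨h1, h2⟩
  ext p
  constructor
  · intro hp
    have h := hne (s := s.swap) h2 h1 hp
    have := swap_mem_cell hμ h.1 h.2 hp
    have he : (e.map swapIdx).map swapIdx = e := by
      cases e with
      | none => rfl
      | some i => simp [swapIdx_swapIdx]
    rw [he, Prod.swap_swap] at this
    exact ⟨p.swap, this, p.swap_swap⟩
  · rintro ⟨q, hq, rfl⟩
    have h := hne h1 h2 hq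
    exact swap_mem_cell hμ h.1 h.2 hq

lemma isPreconnected_cell_swap {μ : ℝ} (hμ : 0 < μ) {s : SignType × SignType} (h1 : s.1 ≠ 0)
    (h2 : s.2 ≠ 0) {e : Option (Fin 3)} (h : IsPreconnected (cell μ s e)) :
    IsPreconnected (cell μ s.swap (e.map swapIdx)) := by
  rw [cell_swap hμ h1 h2]
  exact h.image _ continuous_swap.continuousOn

lemma nonempty_cell_swap {μ : ℝ} (hμ : 0 < μ) {s : SignType × SignType} (h1 : s.1 ≠ 0)
    (h2 : s.2 ≠ 0) {e : Option (Fin 3)} (h : (cell μ s e).Nonempty) :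
    (cell μ s.swap (e.map swapIdx)).Nonempty := by
  rw [cell_swap hμ h1 h2]
  exact h.image _

lemma isPreconnected_region {μ : ℝ} (hμ : 0 < μ) (k : Fin 13) :
    IsPreconnected (cell μ (quadrantTable k) (upTable k)) := by
  have h1 : IsPreconnected (cell μ (1, 1) (some 1)) :=
    isPreconnected_cell_one_of_pos hμ one_ne_zero
  have h7 : IsPreconnected (cell μ (-1, 1) (some 1)) :=
    isPreconnected_cell_one_of_pos hμ (by decide)
  have h6 := isPreconnected_cell_neg_neg_one hμ
  have h8 := isPreconnected_cell_neg_pos_none hμ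
  have h10 := isPreconnected_cell_neg_pos_two hμ
  fin_cases k
  · exact isPreconnected_cell_pos_pos_none hμ
  · exact h1
  · exact isPreconnected_cell_swap hμ (by decide) (by decide) h8
  · exact isPreconnected_cell_swap hμ (by decide) (by decide) h7
  · exact isPreconnected_cell_swap hμ (by decide) (by decide) h6
  · exact isPreconnected_cell_neg_neg_none hμ
  · exact h6
  · exact h7
  · exact h8
  · exact isPreconnected_cell_swap hμ (by decide) (by decide) h1
  · exact h10
  · exact isPreconnected_cell_swap hμ (by decide) (by decide) h10
  · exact isPreconnected_cell_neg_neg_two hμ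

lemma exists_hasUp_inner {μ x : ℝ} (hμ : 0 < μ) (hx : 0 < x) (hxm : x ≠ μ) :
    ∃ a, SignType.sign a = SignType.sign (μ - x) ∧ HasUp (coefInner μ a 1) := by
  -- `K` makes the value of the quintic at `x` equal to `1` when `b = 1` and `a x² (μ - x) = K`.
  set K := (1 + x) ^ 2 * (μ + 1 + x) + x ^ 2 * (1 + 2 * x) * (1 + x) ^ 2 + 1 with hK
  have hK0 : 0 < K / x ^ 2 := by positivity
  have hne : μ - x ≠ 0 := sub_ne_zero.2 hxm.symm
  have hsgn : SignType.sign (K / x ^ 2 / (μ - x)) = SignType.sign (μ - x) := by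
    rw [div_eq_mul_inv, sign_mul, sign_pos hK0, one_mul]
    rcases lt_or_gt_of_ne hne with h | h
    · rw [sign_neg h, sign_neg (inv_lt_zero.2 h)]
    · rw [sign_pos h, sign_pos (inv_pos.2 h)]
  refine ⟨K / x ^ 2 / (μ - x), hsgn, ?_⟩
  have hane : K / x ^ 2 / (μ - x) ≠ 0 := div_ne_zero hK0.ne' hne
  rw [(endPattern_coefInner hμ hane one_ne_zero).hasUp_iff_even
    (coefInner_zero_neg hμ one_pos)]
  refine ⟨x, hx, ?_⟩
  have e : K / x ^ 2 / (μ - x) * (x ^ 2 * (μ - x)) = K := by field_simp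
  rw [quin_coefInner, e, hK]
  linarith

lemma nonempty_region {μ : ℝ} (hμ : 0 < μ) (k : Fin 13) :
    (cell μ (quadrantTable k) (upTable k)).Nonempty := by
  have h1 : (cell μ (1, 1) (some 1)).Nonempty := by
    obtain ⟨a, ha, h⟩ := exists_hasUp_inner hμ (by positivity : 0 < μ / 2) (by linarith)
    rw [sign_pos (by linarith : 0 < μ - μ / 2)] at ha
    exact ⟨(a, 1), (mem_cell_one_iff_of_pos hμ one_ne_zero).2 ⟨ha, one_pos, h⟩⟩
  have h7 : (cell μ (-1, 1) (some 1)).Nonempty := by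
    obtain ⟨a, ha, h⟩ := exists_hasUp_inner hμ (by positivity : 0 < μ + 1) (by linarith)
    rw [sign_neg (by linarith : μ - (μ + 1) < 0)] at ha
    exact ⟨(a, 1), (mem_cell_one_iff_of_pos hμ (by decide)).2 ⟨ha, one_pos, h⟩⟩
  have h6 : (cell μ (-1, -1) (some 1)).Nonempty := by
    rw [cell_neg_neg_one_eq_image hμ]
    refine Set.Nonempty.image _ (Set.Nonempty.of_image (f := Prod.fst) ?_)
    rw [fst_image_innerDomain hμ]
    have : 0 < μ * (μ + 1) := by positivity
    exact ⟨μ, hμ, by nlinarith, by nlinarith⟩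
  have h8 : (cell μ (-1, 1) none).Nonempty := by
    have h0 : 0 < 1 / μ := by positivity
    refine ⟨(-1, 1 + 1 / μ), mem_cell_neg_pos_none hμ (by norm_num) (by linarith) ?_⟩
    have : (1 + 1 / μ) * μ = μ + 1 := by field_simp
    linarith
  have h10 : (cell μ (-1, 1) (some 2)).Nonempty := by
    have hK : 0 < 2 ^ 2 * (1 + 2) ^ 2 * (μ + (μ + 1) * 2) + (1 + 2) ^ 2 * (μ + 1 + μ * 2) := by
      positivity
    set K := 2 ^ 2 * (1 + 2) ^ 2 * (μ + (μ + 1) * 2) + (1 + 2) ^ 2 * (μ + 1 + μ * 2) with hKd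
    -- At `x = 2` the two parameter terms add up to `-1`, against `4` from the parameter-free term.
    refine ⟨(-(1 / K), 1 / K), (mem_cell_neg_pos_two_iff hμ).2
      ⟨by simpa using hK, by positivity, 2, two_pos, ?_⟩⟩
    have : redFun μ (-(1 / K)) (1 / K) 2 = -(1 / K * K) + 4 := by
      rw [redFun, hKd]; ring
    rw [this, one_div_mul_cancel hK.ne']
    norm_num
  fin_cases k
  · exact ⟨(1, 1), mem_cell_none (by simp [quadrantTable])
      (by by_contra h; exact lt_irrefl _ (lt_of_inner_pos_pos hμ one_pos one_pos h))
      (by by_contra h; exact lt_irrefl _ (lt_of_inner_pos_pos hμ one_pos one_pos h))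
      (allDown_middle_of_pos_pos hμ one_pos one_pos)⟩
  · exact h1
  · exact nonempty_cell_swap hμ (by decide) (by decide) h8
  · exact nonempty_cell_swap hμ (by decide) (by decide) h7
  · exact nonempty_cell_swap hμ (by decide) (by decide) h6
  · exact ⟨_, diagonal_mem_cell hμ le_rfl⟩
  · exact h6
  · exact h7
  · exact h8
  · exact nonempty_cell_swap hμ (by decide) (by decide) h1
  · exact h10
  · exact nonempty_cell_swap hμ (by decide) (by decide) h10
  · change (cell μ (-1, -1) (some 2)).Nonempty
    rw [cell_neg_neg_two_eq_image hμ]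
    refine Set.Nonempty.image _ (Set.Nonempty.of_image (f := Prod.fst) ?_)
    rw [fst_image_middleDomain hμ]
    exact ⟨1, one_pos, by linarith, by linarith⟩

/-- A component is connected and covered by the disjoint open cells, so it stays in one of them;
that cell is itself connected and contained in the complement of the curves. -/
lemma connectedComponentIn_eq_cell {μ : ℝ} (hμ : 0 < μ) {k : Fin 13} {p : ℝ × ℝ}
    (hp : p ∈ cell μ (quadrantTable k) (upTable k)) :
    connectedComponentIn (planeMinusCurves ![μ, μ, 1]) p =
      cell μ (quadrantTable k) (upTable k) := by
  have hopen : ∀ k, IsOpen (cell μ (quadrantTable k) (upTable k)) := fun k =>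
    isOpen_cell hμ (quadrantTable_ne k).1 (quadrantTable_ne k).2 _
  refine Set.Subset.antisymm ?_ ((isPreconnected_region hμ k).subset_connectedComponentIn hp
    (cell_subset hμ k))
  refine isPreconnected_connectedComponentIn.subset_left_of_subset_union (hopen k)
    (isOpen_iUnion fun j : {j : Fin 13 // j ≠ k} => hopen j) ?_ ?_
    ⟨p, mem_connectedComponentIn (cell_subset hμ k hp), hp⟩
  · rw [Set.disjoint_left]
    intro q hq hq'
    obtain ⟨⟨j, hj⟩, hqj⟩ := Set.mem_iUnion.1 hq'
    exact hj (cell_eq_of_mem hqj hq)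
  · intro q hq
    obtain ⟨j, hj⟩ := exists_cell hμ (connectedComponentIn_subset _ _ hq)
    by_cases hjk : j = k
    · exact Or.inl (hjk ▸ hj)
    · exact Or.inr (Set.mem_iUnion.2 ⟨⟨j, hjk⟩, hj⟩)

lemma range_cell_eq_regions {μ : ℝ} (hμ : 0 < μ) :
    Set.range (fun k => cell μ (quadrantTable k) (upTable k)) = regions ![μ, μ, 1] := by
  ext S
  constructor
  · rintro ⟨k, rfl⟩
    obtain ⟨p, hp⟩ := nonempty_region hμ k
    exact ⟨p, cell_subset hμ k hp, (connectedComponentIn_eq_cell hμ hp).symm⟩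
  · rintro ⟨p, hp, rfl⟩
    obtain ⟨k, hk⟩ := exists_cell hμ hp
    exact ⟨k, (connectedComponentIn_eq_cell hμ hk).symm⟩

lemma cell_injective {μ : ℝ} (hμ : 0 < μ) :
    Function.Injective (fun k => cell μ (quadrantTable k) (upTable k)) := by
  intro k k' h
  obtain ⟨p, hp⟩ := nonempty_region hμ k
  have h' : cell μ (quadrantTable k) (upTable k) = cell μ (quadrantTable k') (upTable k') := h
  exact cell_eq_of_mem hp (h' ▸ hp)

/-! ### The bound three for all parameters -/

/-- At most three positive zeros, on the axes as well. -/
lemma encard_posZeros_le_of_posCount {c : Fin 6 → ℝ} (hc : EndPattern c) :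
    (posZeros c).encard ≤ 3 := by
  have h3 : posCount c ≤ 3 := by
    rcases lt_or_gt_of_ne hc.zero_ne with h0 | h0
    · exact (hc.posCount_le_two h0).trans (by norm_num)
    · exact hc.posCount_le_three h0
  by_contra hcon
  push Not at hcon
  have h4 : (4 : ℕ∞) ≤ (posZeros c).encard := Order.add_one_le_of_lt hcon
  obtain ⟨t, ht, ht4⟩ := Set.exists_subset_encard_eq h4
  have hfin : t.Finite := Set.finite_of_encard_eq_coe (k := 4) ht4
  have hcard := card_le_posCount hc.five.ne hfin.toFinset
    fun x hx => ht (hfin.mem_toFinset.1 hx)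
  have : (hfin.toFinset.card : ℕ∞) = 4 := by rw [← ht4, hfin.encard_eq_coe_toFinset_card]
  have h5 : hfin.toFinset.card = 4 := by exact_mod_cast this
  omega

lemma encard_roots_le_of_cubic {d₀ d₁ d₂ d₃ : ℝ} (hd : d₀ ≠ 0 ∨ d₃ ≠ 0) {A : Set ℝ}
    (hA : ∀ x ∈ A, d₀ + d₁ * x + d₂ * x ^ 2 + d₃ * x ^ 3 = 0) : A.encard ≤ 3 := by
  set q : ℝ[X] := C d₀ + C d₁ * X + C d₂ * X ^ 2 + C d₃ * X ^ 3 with hqd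
  have hq : q ≠ 0 := by
    intro h
    have h0 := congrArg (fun q : ℝ[X] => q.coeff 0) h
    have h3 := congrArg (fun q : ℝ[X] => q.coeff 3) h
    simp [hqd, coeff_X, coeff_C] at h0 h3
    exact hd.elim (fun h => h h0) (fun h => h h3)
  have hdeg : q.natDegree ≤ 3 := by rw [hqd]; compute_degree
  have hsub : A ⊆ ↑q.roots.toFinset := by
    intro x hx
    simp only [Finset.mem_coe, Multiset.mem_toFinset]
    refine (mem_roots hq).2 ?_
    simpa [hqd, IsRoot] using hA x hx
  refine (Set.encard_le_encard hsub).trans ?_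
  rw [Set.encard_coe_eq_coe_finsetCard]
  have : q.roots.toFinset.card ≤ 3 :=
    (Multiset.toFinset_card_le _).trans ((card_roots' q).trans hdeg)
  exact_mod_cast this

/-- For `b = 0` a factor `x²` splits off and a cubic remains. For `a = 0` the end pattern still
holds if `b < 0`, and there is no zero if `b > 0`. -/
lemma encard_posZeros_coefInner_le {μ : ℝ} (hμ : 0 < μ) (a b : ℝ) :
    (posZeros (coefInner μ a b)).encard ≤ 3 := by
  by_cases hb : b = 0
  · subst hb
    refine encard_roots_le_of_cubic (d₀ := μ * a - 1) (d₁ := -(4 + a)) (d₂ := -5) (d₃ := -2)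
      (Or.inr (by norm_num)) ?_
    · rintro x ⟨hx, h0⟩
      have h1 : x ^ 2 * ((μ * a - 1) + -(4 + a) * x + -5 * x ^ 2 + -2 * x ^ 3) = 0 := by
        rw [← h0, quin_coefInner]; ring
      exact (mul_eq_zero.1 h1).resolve_left (by positivity)
  · by_cases ha : a = 0
    · subst ha
      rcases lt_or_gt_of_ne hb with hb | hb
      · refine encard_posZeros_le_of_posCount ⟨by simp [coefInner], by simp [coefInner], ?_⟩
        simp [coefInner]
        have : 0 < (μ + 1) * (2 * μ + 3) * (b * b) := by
          have := mul_pos_of_neg_of_neg hb hb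
          positivity
        linarith
      · have : posZeros (coefInner μ 0 b) = ∅ := by
          ext x
          simp only [posZeros, Set.mem_ofPred_eq, Set.mem_empty_iff_false, iff_false, not_and]
          exact fun hx => (quin_coefInner_zero_neg hμ hb hx).ne
        rw [this]
        simp
    · exact encard_posZeros_le_of_posCount (endPattern_coefInner hμ ha hb)

lemma encard_posZeros_coefMiddle_le {μ : ℝ} (hμ : 0 < μ) (a b : ℝ) :
    (posZeros (coefMiddle μ a b)).encard ≤ 3 := by
  by_cases ha : a = 0
  · subst ha
    refine encard_roots_le_of_cubic (d₀ := -(μ + 1) * b) (d₁ := -(3 * μ + 2) * b)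
      (d₂ := -(3 * μ + 1) * b - 1) (d₃ := 1 - μ * b) ?_ ?_
    · by_cases hb : b = 0
      · exact Or.inr (by simp [hb])
      · exact Or.inl (mul_ne_zero (by linarith) hb)
    · rintro x ⟨hx, h0⟩
      rw [← h0, quin_coefMiddle, redFun]
      ring
  · by_cases hb : b = 0
    · subst hb
      refine encard_roots_le_of_cubic (d₀ := μ * a - 1) (d₁ := (3 * μ + 1) * a + 1)
        (d₂ := (3 * μ + 2) * a) (d₃ := (μ + 1) * a) (Or.inr (mul_ne_zero (by linarith) ha)) ?_
      · rintro x ⟨hx, h0⟩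
        have h1 : x ^ 2 * ((μ * a - 1) + ((3 * μ + 1) * a + 1) * x + (3 * μ + 2) * a * x ^ 2 +
            (μ + 1) * a * x ^ 3) = 0 := by
          rw [← h0, quin_coefMiddle, redFun]; ring
        exact (mul_eq_zero.1 h1).resolve_left (by positivity)
    · rw [← posZeros_smul (neg_ne_zero.2 ha)]
      exact encard_posZeros_le_of_posCount (endPattern_coefs hμ (p := (a, b)) ha hb 2)

lemma numRoots_le_three {μ : ℝ} (hμ : 0 < μ) (a b : ℝ) (i : Fin 3) :
    numRoots ![μ, μ, 1] ![a, b, 1] i ≤ 3 := by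
  rw [numRoots_eq hμ]
  fin_cases i
  · exact encard_posZeros_coefInner_le hμ b a
  · exact encard_posZeros_coefInner_le hμ a b
  · exact encard_posZeros_coefMiddle_le hμ a b

/-! ### Collinear central configurations -/

lemma hasGradientAt_inv_norm {c p : EuclideanSpace ℝ (Fin 3)} (h : p ≠ c) :
    HasGradientAt (fun x : EuclideanSpace ℝ (Fin 3) => ‖x - c‖⁻¹) (-(‖p - c‖ ^ 3)⁻¹ • (p - c)) p := by
  have h0 : ‖p - c‖ ≠ 0 := norm_ne_zero_iff.2 (sub_ne_zero.2 h)
  have h1 : HasFDerivAt (fun x : EuclideanSpace ℝ (Fin 3) => x - c) (ContinuousLinearMap.id ℝ (EuclideanSpace ℝ (Fin 3))) p :=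
    (hasFDerivAt_id p).sub_const c
  have h2 := (h1.norm_sq.sqrt (pow_ne_zero 2 h0))
  have h3 := (hasDerivAt_inv (x := √(‖p - c‖ ^ 2)) (by simpa using h0)).comp_hasFDerivAt p h2
  refine hasGradientAt_iff_hasFDerivAt.2 (HasFDerivAt.congr_fderiv (f := fun x : EuclideanSpace ℝ (Fin 3) => ‖x - c‖⁻¹)
    (h3.congr_of_eventuallyEq (.of_forall fun x => by simp)) ?_)
  ext x
  simp
  field_simp

lemma gradient_two_bodies {c d p : EuclideanSpace ℝ (Fin 3)} (hc : p ≠ c) (hd : p ≠ d) (K k l : ℝ) :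
    gradient (fun x : EuclideanSpace ℝ (Fin 3) => K - k / ‖x - c‖ - l / ‖x - d‖) p =
      (k / ‖p - c‖ ^ 3) • (p - c) + (l / ‖p - d‖ ^ 3) • (p - d) := by
  refine HasGradientAt.gradient ?_
  have h1 := hasGradientAt_iff_hasFDerivAt.1 (hasGradientAt_inv_norm hc)
  have h2 := hasGradientAt_iff_hasFDerivAt.1 (hasGradientAt_inv_norm hd)
  refine hasGradientAt_iff_hasFDerivAt.2 (HasFDerivAt.congr_fderiv
    (((h1.const_mul k).const_sub K).sub (h2.const_mul l)) ?_)
  ext x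
  simp
  ring

lemma gradient_potential {α : Fin 3 → ℝ} {q : Config} (hq : Function.Injective q) :
    gradient (fun x => potential α (Function.update q 0 x)) (q 0) =
      (α 2 / ‖q 0 - q 1‖ ^ 3) • (q 0 - q 1) + (α 1 / ‖q 0 - q 2‖ ^ 3) • (q 0 - q 2) ∧
    gradient (fun x => potential α (Function.update q 1 x)) (q 1) =
      (α 2 / ‖q 1 - q 0‖ ^ 3) • (q 1 - q 0) + (α 0 / ‖q 1 - q 2‖ ^ 3) • (q 1 - q 2) ∧
    gradient (fun x => potential α (Function.update q 2 x)) (q 2) =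
      (α 0 / ‖q 2 - q 1‖ ^ 3) • (q 2 - q 1) + (α 1 / ‖q 2 - q 0‖ ^ 3) • (q 2 - q 0) := by
  refine ⟨?_, ?_, ?_⟩
  · rw [← gradient_two_bodies (hq.ne (by decide)) (hq.ne (by decide)) (- α 0 / ‖q 1 - q 2‖)]
    congr 1
    ext x
    simp [potential, Function.update, norm_sub_rev (q 2) x]
    ring
  · rw [← gradient_two_bodies (hq.ne (by decide)) (hq.ne (by decide)) (- α 1 / ‖q 2 - q 0‖)]
    congr 1
    ext x
    simp [potential, Function.update, norm_sub_rev (q 0) x]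
    ring
  · rw [← gradient_two_bodies (hq.ne (by decide)) (hq.ne (by decide)) (- α 2 / ‖q 0 - q 1‖)]
    congr 1
    ext x
    simp [potential, Function.update, norm_sub_rev (q 1) x]

/-- The bodies lie on a line, in the position `q₃ - q₁ = u (q₂ - q₃)`, with `q₂ ≠ q₃`. -/
def HasRatio (q : Config) (u : ℝ) : Prop := q 1 ≠ q 2 ∧ q 2 - q 0 = u • (q 1 - q 2)

lemma HasRatio.injective {q : Config} {u : ℝ} (h : HasRatio q u) (h0 : u ≠ 0) (h1 : u ≠ -1) :
    Function.Injective q := by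
  obtain ⟨hv, hu⟩ := h
  have hv' := sub_ne_zero.2 hv
  have e20 : q 2 ≠ q 0 := by
    rw [← sub_ne_zero, hu]
    exact smul_ne_zero h0 hv'
  have e10 : q 1 ≠ q 0 := by
    have : q 1 - q 0 = (1 + u) • (q 1 - q 2) := by rw [add_smul, one_smul, ← hu]; abel
    rw [← sub_ne_zero, this]
    exact smul_ne_zero (fun h => h1 (by linarith)) hv'
  intro i j hij
  fin_cases i <;> fin_cases j <;> simp_all [eq_comm]

lemma smul_eq_smul_iff_of_ne {v : EuclideanSpace ℝ (Fin 3)} (hv : v ≠ 0) {a b : ℝ} : a • v = b • v ↔ a = b :=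
  (smul_left_injective ℝ hv).eq_iff

/-- In units of `q₂ - q₃` the three equations are scalar. The third is the difference of the first
two, as the forces sum to zero; eliminating the multiplier from those two leaves the displayed
equation. -/
lemma isCentral_iff {μ a b u : ℝ} (hμ : 0 < μ) {q : Config} (h : HasRatio q u) (h0 : u ≠ 0)
    (h1 : u ≠ -1) :
    IsCentral ![μ, μ, 1] ![a, b, 1] q ↔
      ((1 + u) / |1 + u| ^ 3 + b * (u / |u| ^ 3)) * (μ + 1 + μ * u) =
        ((1 + u) / |1 + u| ^ 3 + a) * (μ + (μ + 1) * u) := by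
  have hinj := h.injective h0 h1
  obtain ⟨g0, g1, g2⟩ := gradient_potential (α := ![a, b, 1]) hinj
  obtain ⟨hv, hu⟩ := h
  have hv' : q 1 - q 2 ≠ 0 := sub_ne_zero.2 hv
  have hn : ‖q 1 - q 2‖ ≠ 0 := norm_ne_zero_iff.2 hv'
  set v := q 1 - q 2 with hvdef
  have e1 : q 1 = q 2 + v := by rw [hvdef]; abel
  have e0 : q 0 = q 2 - u • v := by rw [← hu]; abel
  have d01 : q 0 - q 1 = (-(1 + u)) • v := by rw [e0, e1]; module
  have d10 : q 1 - q 0 = (1 + u) • v := by rw [e0, e1]; module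
  have d02 : q 0 - q 2 = (-u) • v := by rw [e0]; module
  have d21 : q 2 - q 1 = (-1 : ℝ) • v := by rw [e1]; module
  have hM : 2 * μ + 1 ≠ 0 := by positivity
  have hM' : μ + (μ + 1) ≠ 0 := by positivity
  have hQ : Finset.univ.centerMass ![μ, μ, 1] q =
      q 2 + ((μ * (1 - u)) / (2 * μ + 1)) • v := by
    have : ∑ i, (![μ, μ, 1] : Fin 3 → ℝ) i = 2 * μ + 1 := by simp [Fin.sum_univ_three]; ring
    rw [Finset.centerMass, this, inv_smul_eq_iff₀ hM, Fin.sum_univ_three]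
    simp only [Matrix.cons_val]
    rw [e0, e1, smul_add _ (q 2) (_ • v), smul_smul, mul_div_cancel₀ _ hM]
    module
  have hu' : |u| ≠ 0 := abs_ne_zero.2 h0
  have hu1 : |1 + u| ≠ 0 := abs_ne_zero.2 (fun h => h1 (by linarith))
  simp only [Matrix.cons_val, d01, d10, d02, d21, hu, norm_smul, Real.norm_eq_abs, abs_neg,
    abs_one] at g0 g1 g2
  set k1 := (1 + u) / |1 + u| ^ 3 with hk1
  set k0 := u / |u| ^ 3 with hk0
  set n := ‖v‖ ^ 3 with hn3
  have hn3' : n ≠ 0 := pow_ne_zero 3 hn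
  have G0 : gradient (fun x => potential ![a, b, 1] (Function.update q 0 x)) (q 0) =
      (-(k1 + b * k0) / n) • v := by
    rw [g0, smul_smul, smul_smul, ← add_smul, hk1, hk0, hn3]
    congr 1
    field_simp
    ring
  have G1 : gradient (fun x => potential ![a, b, 1] (Function.update q 1 x)) (q 1) =
      ((k1 + a) / n) • v := by
    rw [g1, smul_smul, ← add_smul, hk1, hn3]
    congr 1
    field_simp
  have G2 : gradient (fun x => potential ![a, b, 1] (Function.update q 2 x)) (q 2) =
      ((-a + b * k0) / n) • v := by
    rw [g2, smul_smul, smul_smul, ← add_smul, hk0, hn3]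
    congr 1
    field_simp
  have key : IsCentral ![μ, μ, 1] ![a, b, 1] q ↔ ∃ l : ℝ,
      k1 + b * k0 = l * (μ + (μ + 1) * u) ∧ k1 + a = l * (μ + 1 + μ * u) ∧
        -a + b * k0 = l * (u - 1) := by
    have c0 : q 0 - Finset.univ.centerMass ![μ, μ, 1] q =
        (-(μ + (μ + 1) * u) / (2 * μ + 1)) • v := by
      rw [hQ, e0]
      match_scalars <;> field_simp <;> ring
    have c1 : q 1 - Finset.univ.centerMass ![μ, μ, 1] q =
        ((μ + 1 + μ * u) / (2 * μ + 1)) • v := by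
      rw [hQ, e1]
      match_scalars <;> field_simp <;> ring
    have c2 : q 2 - Finset.univ.centerMass ![μ, μ, 1] q =
        (μ * (u - 1) / (2 * μ + 1)) • v := by
      rw [hQ]
      match_scalars <;> field_simp <;> ring
    simp only [IsCentral, hinj, true_and, Fin.forall_fin_succ, Fin.succ_zero_eq_one,
      Fin.succ_one_eq_two, IsEmpty.forall_iff, and_true]
    simp only [G0, G1, G2, c0, c1, c2, Matrix.cons_val, smul_smul, smul_eq_smul_iff_of_ne hv']
    constructor
    · rintro ⟨l, h2, h3, h4⟩
      refine ⟨l * μ * n / (2 * μ + 1), ?_, ?_, ?_⟩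
      · field_simp at h2 ⊢; linarith
      · field_simp at h3 ⊢; linarith
      · field_simp at h4 ⊢; linarith
    · rintro ⟨l, h2, h3, h4⟩
      refine ⟨l * (2 * μ + 1) / (μ * n), ?_, ?_, ?_⟩
      · rw [h2]; field_simp
      · rw [h3]; field_simp
      · rw [h4]; field_simp
  rw [key]
  constructor
  · rintro ⟨l, h2, h3, -⟩
    rw [h2, h3]; ring
  · intro h
    -- The multiplier is recovered by dividing by one of the two linear factors, which cannot vanish
    -- simultaneously.
    by_cases hP : μ + (μ + 1) * u = 0
    · have hP1 : μ + 1 + μ * u ≠ 0 := by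
        intro h'
        nlinarith
      refine ⟨(k1 + a) / (μ + 1 + μ * u), ?_, ?_, ?_⟩
      all_goals field_simp
      all_goals linarith
    · refine ⟨(k1 + b * k0) / (μ + (μ + 1) * u), ?_, ?_, ?_⟩
      all_goals field_simp
      all_goals linarith

lemma isCentral_iff_of_pos {μ a b u : ℝ} (hμ : 0 < μ) {q : Config} (h : HasRatio q u)
    (hu : 0 < u) :
    IsCentral ![μ, μ, 1] ![a, b, 1] q ↔ (redPoly ![μ, μ, 1] ![a, b, 1]).eval u = 0 := by
  have h1 : 0 < 1 + u := by linarith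
  rw [isCentral_iff hμ h hu.ne' (by linarith), eval_redPoly, mul_eq_zero, or_iff_right hμ.ne',
    abs_of_pos hu, abs_of_pos h1, redFun]
  constructor <;> intro h
  · field_simp at h; linarith
  · field_simp; linarith

lemma isCentral_iff_of_middle {μ a b u : ℝ} (hμ : 0 < μ) {q : Config} (h : HasRatio q u)
    (hu : u < 0) (h1 : -1 < u) :
    IsCentral ![μ, μ, 1] ![a, b, 1] q ↔ (redPoly ![μ, μ, 1] ![a, -b, 1]).eval u = 0 := by
  have h1' : 0 < 1 + u := by linarith
  rw [isCentral_iff hμ h hu.ne h1.ne', eval_redPoly, mul_eq_zero, or_iff_right hμ.ne',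
    abs_of_neg hu, abs_of_pos h1', redFun]
  have hu' := hu.ne
  have e : u / (-u) ^ 3 = -(1 / u ^ 2) := by field_simp
  rw [e]
  constructor <;> intro h
  · field_simp at h; linarith
  · field_simp; linarith

/-- Both `u` and `1 + u` are negative, so both fractions change sign; relative to them it is `a`
that changes sign. On `(-1, 0)` only `u / |u|³` does, and with it `b`. -/
lemma isCentral_iff_of_lt {μ a b u : ℝ} (hμ : 0 < μ) {q : Config} (h : HasRatio q u)
    (h1 : u < -1) :
    IsCentral ![μ, μ, 1] ![a, b, 1] q ↔ (redPoly ![μ, μ, 1] ![-a, b, 1]).eval u = 0 := by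
  have h1' : 1 + u < 0 := by linarith
  have hu : u < 0 := by linarith
  rw [isCentral_iff hμ h hu.ne h1.ne, eval_redPoly, mul_eq_zero, or_iff_right hμ.ne',
    abs_of_neg hu, abs_of_neg h1', redFun]
  have hu' := hu.ne
  have hu1 := h1'.ne
  have e : u / (-u) ^ 3 = -(1 / u ^ 2) := by field_simp
  have e' : (1 + u) / (-(1 + u)) ^ 3 = -(1 / (1 + u) ^ 2) := by field_simp
  rw [e, e']
  constructor <;> intro h
  · field_simp at h; linarith
  · field_simp; linarith

lemma ratio_ne {i : Fin 3} {u : ℝ} (hu : u ∈ interval i) : u ≠ 0 ∧ u ≠ -1 := by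
  fin_cases i <;> simp [interval] at hu <;> constructor <;> intro h <;> linarith

/-- Bodies 1, 2, 3 in the middle correspond to `I₂`, `I₁`, `I₃`; this is the same permutation that
the reflection in the diagonal induces on the intervals. -/
lemma collinearWithMiddle_iff (j : Fin 3) (q : Config) :
    CollinearWithMiddle j q ↔ ∃ u ∈ interval (swapIdx j), HasRatio q u := by
  rw [CollinearWithMiddle, sbtw_iff_mem_image_Ioo_and_ne]
  constructor
  · rintro ⟨⟨t, ⟨ht0, ht1⟩, ht⟩, hne⟩
    rw [AffineMap.lineMap_apply_module'] at ht
    have h1t : 1 - t ≠ 0 := by linarith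
    have ht0' := ht0.ne'
    fin_cases j <;> simp [swapIdx, interval, HasRatio] at ht hne ⊢
    · have e : q 2 - q 0 = (t - 1) • (q 1 - q 2) := by rw [← ht]; module
      exact ⟨t - 1, ⟨by linarith, by linarith⟩, hne, e⟩
    · have e1 : q 1 - q 2 = t • (q 0 - q 2) := by rw [← ht]; module
      refine ⟨-1 / t, ?_, ?_, ?_⟩
      · rw [div_lt_iff₀ ht0]; linarith
      · refine sub_ne_zero.1 ?_
        rw [e1]
        exact smul_ne_zero ht0' (sub_ne_zero.2 (Ne.symm hne))
      · rw [e1]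
        match_scalars <;> field_simp
    · have e1 : q 1 - q 2 = (1 - t) • (q 1 - q 0) := by rw [← ht]; module
      refine ⟨t / (1 - t), div_pos ht0 (by linarith), ?_, ?_⟩
      · refine sub_ne_zero.1 ?_
        rw [e1]
        exact smul_ne_zero h1t (sub_ne_zero.2 (Ne.symm hne))
      · rw [e1, ← ht]
        match_scalars <;> field_simp <;> ring
  · rintro ⟨u, hu, h⟩
    obtain ⟨hu0, hu1⟩ := ratio_ne hu
    have hinj := h.injective hu0 hu1
    have e0 : q 0 = q 2 - u • (q 1 - q 2) := by rw [← h.2]; abel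
    refine ⟨?_, hinj.ne ((by decide : ∀ j : Fin 3, j + 1 ≠ j + 2) j)⟩
    simp only [Set.mem_image, AffineMap.lineMap_apply_module']
    fin_cases j <;> simp [swapIdx, interval] at hu ⊢
    · exact ⟨u + 1, ⟨by linarith, by linarith⟩, by rw [e0]; module⟩
    · refine ⟨-1 / u, ⟨div_pos_of_neg_of_neg (by linarith) (by linarith), ?_⟩, ?_⟩
      · rw [div_lt_iff_of_neg (by linarith)]; linarith
      · rw [e0]
        match_scalars <;> field_simp <;> ring
    · have : 1 + u ≠ 0 := by linarith
      refine ⟨u / (1 + u), ⟨by positivity, ?_⟩, ?_⟩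
      · rw [div_lt_one (by linarith)]; linarith
      · rw [e0]
        match_scalars <;> field_simp <;> ring

lemma HasRatio.unique {q : Config} {u w : ℝ} (h : HasRatio q u) (h' : HasRatio q w) : u = w :=
  smul_left_injective ℝ (sub_ne_zero.2 h.1) (h.2.symm.trans h'.2)

lemma HasRatio.of_similar {q q' : Config} {u : ℝ} (h : HasRatio q u) (hs : SimilarConfig q q') :
    HasRatio q' u := by
  obtain ⟨t, A, c, ht, hq⟩ := hs
  refine ⟨?_, ?_⟩
  · rw [hq, hq, Ne, add_left_inj, smul_right_inj ht, A.injective.eq_iff]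
    exact h.1
  · rw [hq, hq, hq, add_sub_add_right_eq_sub, add_sub_add_right_eq_sub, ← smul_sub, ← smul_sub,
      ← map_sub, ← map_sub, h.2, map_smul, smul_comm]

lemma SimilarConfig.refl (q : Config) : SimilarConfig q q :=
  ⟨1, LinearIsometryEquiv.refl ℝ _, 0, one_ne_zero, fun i => by simp⟩

lemma SimilarConfig.symm {q q' : Config} (h : SimilarConfig q q') : SimilarConfig q' q := by
  obtain ⟨t, A, c, ht, hq⟩ := h
  refine ⟨t⁻¹, A.symm, -(t⁻¹ • A.symm c), inv_ne_zero ht, fun i => ?_⟩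
  rw [hq]
  simp [smul_smul, ht]

lemma SimilarConfig.trans {q q' q'' : Config} (h : SimilarConfig q q') (h' : SimilarConfig q' q'') :
    SimilarConfig q q'' := by
  obtain ⟨t, A, c, ht, hq⟩ := h
  obtain ⟨t', A', c', ht', hq'⟩ := h'
  refine ⟨t' * t, A.trans A', t' • A' c + c', mul_ne_zero ht' ht, fun i => ?_⟩
  rw [hq', hq]
  simp [smul_smul, add_assoc]

lemma HasRatio.similar {q q' : Config} {u : ℝ} (h : HasRatio q u) (h' : HasRatio q' u) :
    SimilarConfig q q' := by
  set v := q 1 - q 2 with hv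
  set v' := q' 1 - q' 2 with hv'
  have hn : ‖v‖ ≠ 0 := norm_ne_zero_iff.2 (sub_ne_zero.2 h.1)
  have hn' : ‖v'‖ ≠ 0 := norm_ne_zero_iff.2 (sub_ne_zero.2 h'.1)
  have hw : ‖v‖ = ‖(‖v‖ / ‖v'‖) • v'‖ := by
    rw [norm_smul, Real.norm_of_nonneg (by positivity)]
    field_simp
  -- Two vectors of equal length are exchanged by the reflection in the hyperplane orthogonal to
  -- their difference.
  obtain ⟨A, hA⟩ : ∃ A : EuclideanSpace ℝ (Fin 3) ≃ₗᵢ[ℝ] EuclideanSpace ℝ (Fin 3),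
      A v = (‖v‖ / ‖v'‖) • v' := ⟨_, Submodule.reflection_sub hw⟩
  have hA' : (‖v'‖ / ‖v‖) • A v = v' := by
    rw [hA, smul_smul]
    field_simp
    simp
  refine ⟨‖v'‖ / ‖v‖, A, q' 2 - (‖v'‖ / ‖v‖) • A (q 2), div_ne_zero hn' hn, ?_⟩
  have key : ∀ (i : Fin 3) (s : ℝ), q i = q 2 + s • v → q' i = q' 2 + s • v' →
      q' i = (‖v'‖ / ‖v‖) • A (q i) + (q' 2 - (‖v'‖ / ‖v‖) • A (q 2)) := by
    intro i s e e'
    rw [e, e', map_add, map_smul, smul_add, smul_comm, hA']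
    abel
  have e0 : q 0 = q 2 + (-u) • v := by rw [neg_smul, ← h.2]; abel
  have e0' : q' 0 = q' 2 + (-u) • v' := by rw [neg_smul, ← h'.2]; abel
  intro i
  fin_cases i
  · exact key 0 (-u) e0 e0'
  · exact key 1 1 (by rw [hv]; module) (by rw [hv']; module)
  · exact key 2 0 (by simp) (by simp)

lemma exists_hasRatio (u : ℝ) : ∃ q : Config, HasRatio q u := by
  obtain ⟨e, he⟩ := exists_ne (0 : EuclideanSpace ℝ (Fin 3))
  exact ⟨![-u • e, e, 0], by simpa [HasRatio] using he⟩

/-- The ratio is a complete similarity invariant and every real number is a ratio, so classes and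
admissible zeros correspond bijectively. -/
lemma numCollinearCentral_eq {m α β : Fin 3 → ℝ} (j : Fin 3)
    (h : ∀ u ∈ interval (swapIdx j), ∀ q, HasRatio q u →
      (IsCentral m α q ↔ (redPoly m β).eval u = 0)) :
    numCollinearCentral m α j = numRoots m β (swapIdx j) := by
  choose r hr using exists_hasRatio
  have hinj : Function.Injective fun u => {q' : Config | SimilarConfig (r u) q'} := by
    intro u w huw
    have : r w ∈ {q' : Config | SimilarConfig (r u) q'} := by
      rw [show {q' : Config | SimilarConfig (r u) q'} = _ from huw]
      exact SimilarConfig.refl _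
    exact ((hr u).of_similar this).unique (hr w)
  rw [numRoots, ← hinj.injOn.encard_image, numCollinearCentral]
  congr 1
  ext S
  simp only [Set.mem_image, Set.mem_ofPred_eq]
  constructor
  · rintro ⟨q, ⟨hc, hq⟩, rfl⟩
    obtain ⟨u, hu, hqu⟩ := (collinearWithMiddle_iff j q).1 hc
    have hs := hqu.similar (hr u)
    exact ⟨u, ⟨hu, (h u hu q hqu).1 hq⟩, Set.ext fun q' =>
      ⟨fun hq' => hs.trans hq', fun hq' => hs.symm.trans hq'⟩⟩
  · rintro ⟨u, ⟨hu, h0⟩, rfl⟩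
    exact ⟨r u, ⟨(collinearWithMiddle_iff j _).2 ⟨u, hu, hr u⟩, (h u hu _ (hr u)).2 h0⟩, rfl⟩

lemma numCollinearCentral_two {μ : ℝ} (hμ : 0 < μ) (a b : ℝ) :
    numCollinearCentral ![μ, μ, 1] ![a, b, 1] 2 = numRoots ![μ, μ, 1] ![a, b, 1] 2 :=
  numCollinearCentral_eq 2 fun _ hu _ hq => isCentral_iff_of_pos hμ hq hu

lemma numCollinearCentral_one {μ : ℝ} (hμ : 0 < μ) (a b : ℝ) :
    numCollinearCentral ![μ, μ, 1] ![a, b, 1] 1 = numRoots ![μ, μ, 1] ![-a, b, 1] 0 :=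
  numCollinearCentral_eq 1 fun _ hu _ hq => isCentral_iff_of_lt hμ hq hu

lemma numCollinearCentral_zero {μ : ℝ} (hμ : 0 < μ) (a b : ℝ) :
    numCollinearCentral ![μ, μ, 1] ![a, b, 1] 0 = numRoots ![μ, μ, 1] ![a, -b, 1] 1 :=
  numCollinearCentral_eq 0 fun _ hu _ hq => isCentral_iff_of_middle hμ hq hu.2 hu.1

/-! ### The set of values, and the theorem -/

lemma range_numRoots {μ : ℝ} (hμ : 0 < μ) (i : Fin 3) :
    Set.range (fun p : ℝ × ℝ => numRoots ![μ, μ, 1] ![p.1, p.2, 1] i) = {0, 1, 2, 3} := by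
  ext n
  constructor
  · rintro ⟨p, rfl⟩
    have h := numRoots_le_three hμ p.1 p.2 i
    obtain ⟨n, hn⟩ := ENat.ne_top_iff_exists.1 (ne_top_of_le_ne_top (by simp) h)
    simp only [← hn] at h ⊢
    have : n ≤ 3 := by exact_mod_cast h
    interval_cases n <;> simp
  · intro hn
    obtain ⟨k, hk⟩ : ∃ k, (zerosTable k i : ℕ∞) = n := by
      -- Every column of the table contains 0, 1, 2 and 3, and every region is nonempty.
      have key : ∀ (i : Fin 3) (m : Fin 4), ∃ k, zerosTable k i = m := by decide
      rcases hn with rfl | rfl | rfl | rfl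
      · exact (key i 0).imp fun k hk => by simp [hk]
      · exact (key i 1).imp fun k hk => by simp [hk]
      · exact (key i 2).imp fun k hk => by simp [hk]
      · exact (key i 3).imp fun k hk => by simp [hk]
    obtain ⟨p, hp⟩ := nonempty_region hμ k
    exact ⟨p, (numRoots_cell hμ hp i).trans hk⟩

theorem mainTheorem2 (μ : ℝ) (hμ : 0 < μ) :
    (∃ R : Fin 13 → Set (ℝ × ℝ),
      Function.Injective R ∧
      Set.range R = regions ![μ, μ, 1] ∧
      ∀ k : Fin 13, ∀ p ∈ R k,
        (SignType.sign p.1, SignType.sign p.2) = quadrantTable k ∧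
        (∀ i : Fin 3, numRoots ![μ, μ, 1] ![p.1, p.2, 1] i = zerosTable k i) ∧
        numCollinearCentral ![μ, μ, 1] ![p.1, p.2, 1] 2 = zerosTable k 2 ∧
        numCollinearCentral ![μ, μ, 1] ![-p.1, p.2, 1] 1 = zerosTable k 0 ∧
        numCollinearCentral ![μ, μ, 1] ![p.1, -p.2, 1] 0 = zerosTable k 1) ∧
    ∀ j : Fin 3,
      Set.range (fun p : ℝ × ℝ => numCollinearCentral ![μ, μ, 1] ![p.1, p.2, 1] j) =
        {0, 1, 2, 3} := by
  refine ⟨⟨fun k => cell μ (quadrantTable k) (upTable k), cell_injective hμ,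
    range_cell_eq_regions hμ, fun k p hp => ⟨hp.1, numRoots_cell hμ hp, ?_, ?_, ?_⟩⟩, fun j => ?_⟩
  · rw [numCollinearCentral_two hμ, numRoots_cell hμ hp]
  · rw [numCollinearCentral_one hμ, neg_neg, numRoots_cell hμ hp]
  · rw [numCollinearCentral_zero hμ, neg_neg, numRoots_cell hμ hp]
  · fin_cases j
    · simp only [Fin.zero_eta, numCollinearCentral_zero hμ]
      -- Changing the sign of one parameter permutes the plane, so it does not affect the set of
      -- values.
      rw [← range_numRoots hμ 1, ← (Function.Involutive.surjective (f := fun p : ℝ × ℝ =>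
        (p.1, -p.2)) fun p => by simp).range_comp]
      simp [Function.comp_def]
    · simp only [Fin.mk_one, numCollinearCentral_one hμ]
      rw [← range_numRoots hμ 0, ← (Function.Involutive.surjective (f := fun p : ℝ × ℝ =>
        (-p.1, p.2)) fun p => by simp).range_comp]
      simp [Function.comp_def]
    · simp only [Fin.reduceFinMk, numCollinearCentral_two hμ]
      exact range_numRoots hμ 2

end
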